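/- **Theorem.** Consider the class of dissipative shallow-water systems $$\Delta_1:=u_t+uu_x+h_x-F(h,u_x,h_x)\,u_{xx}=0,\qquad \Delta_2:=h_t+uh_x+hu_x=0,\qquad(\ast)$$ where $F$ is a smooth nowhere vanishing function on a product $I\times J\times K$ of nonempty open intervals (the ranges of $h,u_x,h_x$), with $I\subseteq(0,\infty)$. Let $W\subseteq\mathbb R^3$ be any nonempty connected open set (the range of $(t,x,u)$). On the part of the jet space of $(t,x,u,h)$ where $(t,x,u)\in W$, $h\in I$, $u_x\in J$, $h_x\in K$, consider pairs $\Phi=(\rho,X)$ of differential functions (smooth functions of finitely many jet coordinates, of any order) such that for some smooth multipliers $\Lambda^1,\Lambda^2$ depending only on $(t,x,u,h)\in W\times I$ $$D_t\rho+D_xX=\Lambda^1\Delta_1+\Lambda^2\Delta_2$$ identically in the jet variables, where $D_t,D_x$ are the total derivatives. Two such pairs represent the same conservation law if their difference is trivial, i.e. is the sum of a pair of differential functions vanishing on the solution manifold (the jets satisfying $(\ast)$ and all its differential consequences) and a pair $(N^1,N^2)$ of differential functions with $D_tN^1+D_xN^2=0$ identically. Let $G^\sim$ be the equivalence group of the class,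 consisting of the transformations $$t'=at+b,\quad x'=cx+dt+e,\quad u'=\tfrac ca u+\tfrac da,\quad h'=\tfrac{c^2}{a^2}h,\quad F'=\tfrac{c^2}{a}F\qquad(a,c\neq0).$$ 1. Every system of the class has at most four linearly independent such conservation laws. 2. Conservation of mass, $\mathrm{CL}_1$: $D_th+D_x(hu)=0$, is a nontrivial conservation law of every system of the class. Every such conservation law of a system is a multiple of $\mathrm{CL}_1$ if and only if the system is not $G^\sim$-equivalent to one whose $F$ has one of the forms (a)–(d) below. Here $c_1,c_2$ are constants with $c_2\ne0$, $g$ is a smooth nowhere vanishing function on $J$, and $\int g(u_x)\,du_x$ is any antiderivative of $g$. (a) $F=\dfrac{g(u_x)}{c_1h+c_2}$. The conservation laws $\mathrm{CL}_1$ and $$D_t(c_1hu+c_2u)+D_x\Big(\tfrac12c_1h^2+\tfrac12c_2u^2+c_1hu^2+c_2h-\int g(u_x)\,du_x\Big)=0$$ are linearly independent, and they form a basis unless the system is $G^\sim$-equivalent to one of the form (b). (b) $F=\dfrac1{(c_1h+c_2)u_x^2}$, $0\notin J$. A basis is $\mathrm{CL}_1$, $$D_t(c_1hu+c_2u)+D_x\Big(\tfrac12(c_2u^2+c_1h^2)+(c_1u^2+c_2)h+\tfrac1{u_x}\Big)=0,$$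 $$D_t\Big(\tfrac12(c_1h+c_2)u^2+c_2(h\ln h-h)+\tfrac12c_1h^2-t\Big)+D_x\Big(\tfrac12c_1hu^3+\tfrac13c_2u^3+c_2hu\ln h+c_1h^2u+\tfrac u{u_x}\Big)=0.$$ (c) $F=\dfrac{g(u_x)}h$. The conservation laws $\mathrm{CL}_1$, $$D_t(xh-thu)+D_x\Big(xhu-thu^2-\tfrac12th^2+t\int g(u_x)\,du_x\Big)=0,$$ $$D_t(hu)+D_x\Big(\tfrac12h^2+hu^2-\int g(u_x)\,du_x\Big)=0$$ are linearly independent, and they form a basis unless the system is $G^\sim$-equivalent to one of the form (d). (d) $F=\dfrac1{hu_x^2}$, $0\notin J$. A basis is $\mathrm{CL}_1$, $$D_t(xh-thu)+D_x\Big(xhu-thu^2-\tfrac12th^2-\tfrac t{u_x}\Big)=0,$$ $$D_t(hu)+D_x\Big(\tfrac12h^2+hu^2+\tfrac1{u_x}\Big)=0,$$ $$D_t\Big(\tfrac12hu^2+\tfrac12h^2-t\Big)+D_x\Big(\tfrac12hu^3+h^2u+\tfrac u{u_x}\Big)=0.$$ 3. No system of the form (a) or (b) is $G^\sim$-equivalent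 to a system of the form (c) or (d). -/

import Mathlib

open Set
open scoped ContDiff BigOperators

noncomputable section

/-! ## The jet space of two functions `u`, `h` of `(t, x)` -/

/-- Coordinates on the infinite jet space: the independent variables `t`, `x`, and
`u i j`, `h i j` for the derivatives `∂ₜⁱ ∂ₓʲ u`, `∂ₜⁱ ∂ₓʲ h`. -/
inductive JetVar
  | t
  | x
  | u (i j : ℕ)
  | h (i j : ℕ)
  deriving DecidableEq

/-- A point of the infinite jet space. -/
abbrev Jet := JetVar → ℝ

/-- Partial derivative with respect to the jet coordinate `v`. -/
def pd (v : JetVar) (f : Jet → ℝ) (z : Jet) : ℝ :=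
  deriv (fun s => f (Function.update z v s)) (z v)

/-- Total derivative with respect to `t`. For functions of finitely many jet coordinates
only finitely many summands are nonzero. -/
def Dt (f : Jet → ℝ) (z : Jet) : ℝ :=
  pd .t f z + ∑ᶠ p : ℕ × ℕ, (z (.u (p.1 + 1) p.2) * pd (.u p.1 p.2) f z
    + z (.h (p.1 + 1) p.2) * pd (.h p.1 p.2) f z)

/-- Total derivative with respect to `x`. -/
def Dx (f : Jet → ℝ) (z : Jet) : ℝ :=
  pd .x f z + ∑ᶠ p : ℕ × ℕ, (z (.u p.1 (p.2 + 1)) * pd (.u p.1 p.2) f z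
    + z (.h p.1 (p.2 + 1)) * pd (.h p.1 p.2) f z)

/-- Differential functions on a domain `D` of the jet space: smooth functions of finitely
many jet coordinates. Values outside `D` are irrelevant. -/
def IsDiffFun (D : Set Jet) (f : Jet → ℝ) : Prop :=
  ∃ (A : Finset JetVar) (g : (A → ℝ) → ℝ),
    ContDiffOn ℝ ∞ g ((fun (z : Jet) (v : A) => z v) '' D) ∧
      ∀ z ∈ D, f z = g (fun v : A => z v)

/-- Pairs `(ρ, X)` of functions on the jet space (density and flux). -/
abbrev FluxPair := (Jet → ℝ) × (Jet → ℝ)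

/-- The total divergence `Dₜ ρ + Dₓ X`. -/
def totalDiv (Φ : FluxPair) (z : Jet) : ℝ := Dt Φ.1 z + Dx Φ.2 z

/-! ## The class of dissipative shallow-water systems -/

/-- A system `uₜ + u uₓ + hₓ - F(h, uₓ, hₓ) uₓₓ = 0`, `hₜ + u hₓ + h uₓ = 0` of the class: a
smooth nowhere vanishing function `F` on a product `I × J × K` of nonempty open intervals, the
ranges of `h > 0`, `uₓ` and `hₓ`. -/
structure SWSystem where
  I : Set ℝ
  J : Set ℝ
  K : Set ℝ
  F : ℝ → ℝ → ℝ → ℝ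
  isOpen_I : IsOpen I
  isOpen_J : IsOpen J
  isOpen_K : IsOpen K
  ordConnected_I : I.OrdConnected
  ordConnected_J : J.OrdConnected
  ordConnected_K : K.OrdConnected
  nonempty_I : I.Nonempty
  nonempty_J : J.Nonempty
  nonempty_K : K.Nonempty
  pos_of_mem : ∀ y ∈ I, 0 < y
  smooth_F : ContDiffOn ℝ ∞ (fun w : ℝ × ℝ × ℝ => F w.1 w.2.1 w.2.2) (I ×ˢ J ×ˢ K)
  F_ne_zero : ∀ y ∈ I, ∀ p ∈ J, ∀ q ∈ K, F y p q ≠ 0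

namespace SWSystem

variable (S : SWSystem) (W : Set (ℝ × ℝ × ℝ))

/-- The part of the jet space over which the system is considered; `W` is the range of
`(t, x, u)`, and all jet coordinates other than `t, x, u, h, uₓ, hₓ` are unrestricted. -/
def dom : Set Jet :=
  {z | (z .t, z .x, z (.u 0 0)) ∈ W ∧ z (.h 0 0) ∈ S.I ∧ z (.u 0 1) ∈ S.J ∧ z (.h 0 1) ∈ S.K}

/-- Left-hand side of the momentum equation. -/
def Delta₁ (z : Jet) : ℝ :=
  z (.u 1 0) + z (.u 0 0) * z (.u 0 1) + z (.h 0 1)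
    - S.F (z (.h 0 0)) (z (.u 0 1)) (z (.h 0 1)) * z (.u 0 2)

/-- Left-hand side of the mass equation. -/
def Delta₂ (z : Jet) : ℝ :=
  z (.h 1 0) + z (.u 0 0) * z (.h 0 1) + z (.h 0 0) * z (.u 0 1)

/-- The solution manifold in the jet space: the jets that satisfy the system and all its
differential consequences. -/
def solManifold : Set Jet :=
  {z | z ∈ S.dom W ∧ ∀ a b : ℕ,
    Dt^[a] (Dx^[b] S.Delta₁) z = 0 ∧ Dt^[a] (Dx^[b] Delta₂) z = 0}

/-- `Φ` is a conserved vector of the system. -/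
def IsConservedVector (Φ : FluxPair) : Prop :=
  IsDiffFun (S.dom W) Φ.1 ∧ IsDiffFun (S.dom W) Φ.2 ∧
    ∀ z ∈ S.solManifold W, totalDiv Φ z = 0

/-- `Φ` is trivial: the sum of a pair that vanishes on the solution manifold and a null
divergence. -/
def IsTrivial (Φ : FluxPair) : Prop :=
  ∃ M N : FluxPair,
    (IsDiffFun (S.dom W) M.1 ∧ IsDiffFun (S.dom W) M.2) ∧
    (IsDiffFun (S.dom W) N.1 ∧ IsDiffFun (S.dom W) N.2) ∧
    (∀ z ∈ S.dom W, Φ.1 z = M.1 z + N.1 z ∧ Φ.2 z = M.2 z + N.2 z) ∧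
    (∀ z ∈ S.solManifold W, M.1 z = 0 ∧ M.2 z = 0) ∧
    (∀ z ∈ S.dom W, totalDiv N z = 0)

/-- `Φ` is a conserved vector with multipliers `Λ¹(t, x, U, H)`, `Λ²(t, x, U, H)`:
`Dₜ ρ + Dₓ X = Λ¹ Δ₁ + Λ² Δ₂` identically on the jet space. -/
def HasZerothOrderMultipliers (Φ : FluxPair) : Prop :=
  S.IsConservedVector W Φ ∧
  ∃ L₁ L₂ : (ℝ × ℝ × ℝ) × ℝ → ℝ,
    ContDiffOn ℝ ∞ L₁ (W ×ˢ S.I) ∧ ContDiffOn ℝ ∞ L₂ (W ×ˢ S.I) ∧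
    ∀ z ∈ S.dom W, totalDiv Φ z =
      L₁ ((z .t, z .x, z (.u 0 0)), z (.h 0 0)) * S.Delta₁ z
        + L₂ ((z .t, z .x, z (.u 0 0)), z (.h 0 0)) * Delta₂ z

/-- The conservation laws represented by the `φ i` (that is, their classes modulo trivial
conserved vectors) are linearly independent. -/
def CLIndependent {n : ℕ} (φ : Fin n → FluxPair) : Prop :=
  ∀ c : Fin n → ℝ, S.IsTrivial W (∑ i, c i • φ i) → c = 0

/-- The `φ i` represent linearly independent conservation laws with multipliers depending on
`(t, x, U, H)`. -/
def AreIndependentCLs {n : ℕ} (φ : Fin n → FluxPair) : Prop :=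
  (∀ i, S.HasZerothOrderMultipliers W (φ i)) ∧ S.CLIndependent W φ

/-- The `φ i` represent a basis of the space of conservation laws with multipliers depending
on `(t, x, U, H)`. -/
def IsCLBasis {n : ℕ} (φ : Fin n → FluxPair) : Prop :=
  S.AreIndependentCLs W φ ∧
    ∀ Φ : FluxPair, S.HasZerothOrderMultipliers W Φ →
      ∃ c : Fin n → ℝ, S.IsTrivial W (Φ - ∑ i, c i • φ i)

end SWSystem

/-! ## The equivalence group -/

/-- The elements of the equivalence group `G^∼` of the class: the transformations
`t' = a t + b`, `x' = c x + d t + e`, `u' = (c / a) u + d / a`, `h' = (c / a)² h`,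
`F' = (c² / a) F` with `a, c ≠ 0`. They are the compositions of the flows of
`∂ₜ`, `∂ₓ`, `t ∂ₓ + ∂ᵤ`, `t ∂ₜ - u ∂ᵤ - 2 h ∂ₕ - F ∂_F`, `x ∂ₓ + u ∂ᵤ + 2 h ∂ₕ + 2 F ∂_F` and of the
reflections `(t, x, u, h, F) ↦ (-t, -x, u, h, -F)` and `(t, x, u, h, F) ↦ (-t, x, -u, h, -F)`. -/
structure EquivTransf where
  a : ℝ
  b : ℝ
  c : ℝ
  d : ℝ
  e : ℝ
  a_ne_zero : a ≠ 0
  c_ne_zero : c ≠ 0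

/-- The transformation `φ` maps the system `S` to the system `S'`. The derivatives transform by
`u'_{x'} = uₓ / a` and `h'_{x'} = (c / a²) hₓ`. -/
def EquivTransf.MapsSystem (φ : EquivTransf) (S S' : SWSystem) : Prop :=
  S'.I = (fun y => (φ.c / φ.a) ^ 2 * y) '' S.I ∧
  S'.J = (fun p => p / φ.a) '' S.J ∧
  S'.K = (fun q => φ.c / φ.a ^ 2 * q) '' S.K ∧
  ∀ y ∈ S.I, ∀ p ∈ S.J, ∀ q ∈ S.K,
    S'.F ((φ.c / φ.a) ^ 2 * y) (p / φ.a) (φ.c / φ.a ^ 2 * q) = φ.c ^ 2 / φ.a * S.F y p q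

/-- `G^∼`-equivalence of systems of the class. -/
def SWSystem.Equivalent (S S' : SWSystem) : Prop :=
  ∃ φ : EquivTransf, φ.MapsSystem S S'

/-! ## The table -/

namespace SWSystem

variable (S : SWSystem)

/-- `F = g(uₓ) / (c₁ h + c₂)`, where `g` is smooth and nowhere zero and `c₂ ≠ 0`. -/
def FormA (c₁ c₂ : ℝ) (g : ℝ → ℝ) : Prop :=
  c₂ ≠ 0 ∧ (∀ y ∈ S.I, c₁ * y + c₂ ≠ 0) ∧
  ContDiffOn ℝ ∞ g S.J ∧ (∀ p ∈ S.J, g p ≠ 0) ∧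
  ∀ y ∈ S.I, ∀ p ∈ S.J, ∀ q ∈ S.K, S.F y p q = g p / (c₁ * y + c₂)

/-- `F = 1 / ((c₁ h + c₂) uₓ²)`, where `c₂ ≠ 0`. -/
def FormB (c₁ c₂ : ℝ) : Prop :=
  c₂ ≠ 0 ∧ (∀ y ∈ S.I, c₁ * y + c₂ ≠ 0) ∧ (0 : ℝ) ∉ S.J ∧
  ∀ y ∈ S.I, ∀ p ∈ S.J, ∀ q ∈ S.K, S.F y p q = 1 / ((c₁ * y + c₂) * p ^ 2)

/-- `F = g(uₓ) / h`, where `g` is smooth and nowhere zero. -/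
def FormC (g : ℝ → ℝ) : Prop :=
  ContDiffOn ℝ ∞ g S.J ∧ (∀ p ∈ S.J, g p ≠ 0) ∧
  ∀ y ∈ S.I, ∀ p ∈ S.J, ∀ q ∈ S.K, S.F y p q = g p / y

/-- `F = 1 / (h uₓ²)`. -/
def FormD : Prop :=
  (0 : ℝ) ∉ S.J ∧ ∀ y ∈ S.I, ∀ p ∈ S.J, ∀ q ∈ S.K, S.F y p q = 1 / (y * p ^ 2)

/-- The system has one of the four special forms. -/
def InTable : Prop :=
  (∃ c₁ c₂ g, S.FormA c₁ c₂ g) ∨ (∃ c₁ c₂, S.FormB c₁ c₂) ∨ (∃ g, S.FormC g) ∨ S.FormD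

end SWSystem

/-- Conservation of mass. -/
def clMass : FluxPair :=
  (fun z => z (.h 0 0), fun z => z (.h 0 0) * z (.u 0 0))

/-- The generalized momentum law for `F = g(uₓ) / (c₁ h + c₂)`; `G` is an antiderivative
of `g`. -/
def clA (c₁ c₂ : ℝ) (G : ℝ → ℝ) : FluxPair :=
  (fun z => c₁ * z (.h 0 0) * z (.u 0 0) + c₂ * z (.u 0 0),
   fun z => 1 / 2 * c₁ * z (.h 0 0) ^ 2 + 1 / 2 * c₂ * z (.u 0 0) ^ 2
     + c₁ * z (.h 0 0) * z (.u 0 0) ^ 2 + c₂ * z (.h 0 0) - G (z (.u 0 1)))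

/-- The first nontrivial law for `F = 1 / ((c₁ h + c₂) uₓ²)`. -/
def clB₁ (c₁ c₂ : ℝ) : FluxPair :=
  (fun z => c₁ * z (.h 0 0) * z (.u 0 0) + c₂ * z (.u 0 0),
   fun z => 1 / 2 * (c₂ * z (.u 0 0) ^ 2 + c₁ * z (.h 0 0) ^ 2)
     + (c₁ * z (.u 0 0) ^ 2 + c₂) * z (.h 0 0) + 1 / z (.u 0 1))

/-- The second nontrivial law for `F = 1 / ((c₁ h + c₂) uₓ²)`. -/
def clB₂ (c₁ c₂ : ℝ) : FluxPair :=
  (fun z => 1 / 2 * (c₁ * z (.h 0 0) + c₂) * z (.u 0 0) ^ 2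
     + c₂ * (z (.h 0 0) * Real.log (z (.h 0 0)) - z (.h 0 0))
     + 1 / 2 * c₁ * z (.h 0 0) ^ 2 - z .t,
   fun z => 1 / 2 * c₁ * z (.h 0 0) * z (.u 0 0) ^ 3 + 1 / 3 * c₂ * z (.u 0 0) ^ 3
     + c₂ * z (.h 0 0) * z (.u 0 0) * Real.log (z (.h 0 0))
     + c₁ * z (.h 0 0) ^ 2 * z (.u 0 0) + z (.u 0 0) / z (.u 0 1))

/-- The center-of-mass law for `F = g(uₓ) / h`; `G` is an antiderivative of `g`. -/
def clC₁ (G : ℝ → ℝ) : FluxPair :=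
  (fun z => z .x * z (.h 0 0) - z .t * z (.h 0 0) * z (.u 0 0),
   fun z => z .x * z (.h 0 0) * z (.u 0 0) - z .t * z (.h 0 0) * z (.u 0 0) ^ 2
     - 1 / 2 * z .t * z (.h 0 0) ^ 2 + z .t * G (z (.u 0 1)))

/-- Conservation of momentum for `F = g(uₓ) / h`; `G` is an antiderivative of `g`. -/
def clC₂ (G : ℝ → ℝ) : FluxPair :=
  (fun z => z (.h 0 0) * z (.u 0 0),
   fun z => 1 / 2 * z (.h 0 0) ^ 2 + z (.h 0 0) * z (.u 0 0) ^ 2 - G (z (.u 0 1)))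

/-- The center-of-mass law for `F = 1 / (h uₓ²)`. -/
def clD₁ : FluxPair :=
  (fun z => z .x * z (.h 0 0) - z .t * z (.h 0 0) * z (.u 0 0),
   fun z => z .x * z (.h 0 0) * z (.u 0 0) - z .t * z (.h 0 0) * z (.u 0 0) ^ 2
     - 1 / 2 * z .t * z (.h 0 0) ^ 2 - z .t / z (.u 0 1))

/-- Conservation of momentum for `F = 1 / (h uₓ²)`. -/
def clD₂ : FluxPair :=
  (fun z => z (.h 0 0) * z (.u 0 0),
   fun z => 1 / 2 * z (.h 0 0) ^ 2 + z (.h 0 0) * z (.u 0 0) ^ 2 + 1 / z (.u 0 1))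

/-- Conservation of energy for `F = 1 / (h uₓ²)`. -/
def clD₃ : FluxPair :=
  (fun z => 1 / 2 * z (.h 0 0) * z (.u 0 0) ^ 2 + 1 / 2 * z (.h 0 0) ^ 2 - z .t,
   fun z => 1 / 2 * z (.h 0 0) * z (.u 0 0) ^ 3 + z (.h 0 0) ^ 2 * z (.u 0 0)
     + z (.u 0 0) / z (.u 0 1))

end

/-! The differential functions on an open set of jets form a commutative algebra `DF D` with
commuting derivations `dt`, `dx`, so the analysis is done once and the rest is algebra in this ring.

For fixed i, treat ∂ₜⁱu and ∂ₜⁱh as unknowns in x alone and let Eᵢ (`eul`) be the corresponding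
variational derivative. It kills Dₓ, and Eᵢ₊₁(Dₜ R) = Dₜ Eᵢ₊₁(R) + Eᵢ(R). If Dₜρ + DₓX = P = LΔ₁ +
MΔ₂ with L, M of order zero, then Eᵢ P = 0 for i > 1, whence E₀P = Dₜ E₁P, where E₁P is L for u and
M for h. Splitting with respect to the derivative coordinates gives the determining equations
(`detEqs`).

If L = 0, then M is constant and the law is a multiple of mass. If L ≠ 0, the equations (LF)_h = 0
and L F_{hₓ} = 0 force L = ℓ(t,x,u) φ(h) and F = g(uₓ)/φ(h). Compatibility with M gives hφ'' = kφ,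
and the remaining equations give k = 0, so φ = αh + β (`exists_isAffine`). For such F one gets ℓ = c
+ et + du with βe = 0 and d(2g + uₓg') = 0, and M is determined up to an additive constant
(`RedEqs.solve`). So e survives only for β = 0, and d only for g = K/uₓ². These alternatives are the
forms (a)–(d), and the four constants give the bound four. The listed laws realize the four
constants.

To pass between multipliers and laws: vectors with equal multipliers differ by a null divergence.
Conversely, a trivial vector whose density depends on (t,x,u,h) only has zero multipliers. Indeed,
after pullback to the solution manifold, parametrized by t, x and the x-derivatives of u and h, the
vanishing part disappears and the variational derivatives of the null density stay zero, so the
density depends on t, x alone (`IsTrivial.pdA_density`). All listed densities have order zero, so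
this settles independence.

Equivalence transformations rescale the slope α and keep β, while F fixes αh + β up to a factor.
Hence vanishing of β is invariant, which separates (a), (b) from (c), (d). -/

noncomputable section

open TopologicalSpace

/-! ## Smooth functions of finitely many jet coordinates -/

/-- Restriction of a jet to finitely many coordinates. -/
def restr (A : Finset JetVar) (z : Jet) : A → ℝ := fun v => z v

/-- The map `s`, which prescribes the coordinates in `A` and keeps those of `z` elsewhere, is a
continuous section through `z`. Openness lets representatives, smooth only on the projected set, be
differentiated by `fderiv`. -/
theorem isOpen_restr_image (D : Opens Jet) (A : Finset JetVar) :
    IsOpen (restr A '' (D : Set Jet)) := by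
  rw [isOpen_iff_mem_nhds]
  rintro _ ⟨z, hz, rfl⟩
  let s : (A → ℝ) → Jet := fun w v => if h : v ∈ A then w ⟨v, h⟩ else z v
  have hs : Continuous s := by
    refine continuous_pi fun v => ?_
    by_cases h : v ∈ A
    · simpa [s, h] using continuous_apply (⟨v, h⟩ : A)
    · simpa [s, h] using continuous_const
  have hsz : s (restr A z) = z := by
    funext v
    by_cases h : v ∈ A <;> simp [s, h, restr]
  have hmem : s ⁻¹' (D : Set Jet) ∈ nhds (restr A z) :=
    hs.continuousAt.preimage_mem_nhds (by rw [hsz]; exact D.isOpen.mem_nhds hz)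
  refine Filter.mem_of_superset hmem fun w hw => ⟨s w, hw, ?_⟩
  funext v
  simp [s, restr]

/-- Smooth functions of finitely many jet coordinates with values in a normed space. -/
def IsSmoothCyl {E : Type*} [NormedAddCommGroup E] [NormedSpace ℝ E] (D : Opens Jet)
    (f : Jet → E) : Prop :=
  ∃ (A : Finset JetVar) (g : (A → ℝ) → E),
    ContDiffOn ℝ ∞ g (restr A '' (D : Set Jet)) ∧ ∀ z ∈ D, f z = g (restr A z)

namespace IsSmoothCyl

variable {E E' : Type*} [NormedAddCommGroup E] [NormedSpace ℝ E] [NormedAddCommGroup E']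
  [NormedSpace ℝ E'] {D : Opens Jet}

/-- Representatives over different finite coordinate sets become comparable after enlarging the
sets. -/
theorem exists_superset {f : Jet → E} {A B : Finset JetVar} (hAB : A ⊆ B) {g : (A → ℝ) → E}
    (hg : ContDiffOn ℝ ∞ g (restr A '' (D : Set Jet))) (hf : ∀ z ∈ D, f z = g (restr A z)) :
    ∃ g' : (B → ℝ) → E, ContDiffOn ℝ ∞ g' (restr B '' (D : Set Jet)) ∧
      ∀ z ∈ D, f z = g' (restr B z) := by
  refine ⟨fun w => g fun v => w ⟨v, hAB v.2⟩, ?_, fun z hz => hf z hz⟩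
  refine hg.comp (contDiff_pi.2 fun v => contDiff_apply ℝ ℝ _).contDiffOn ?_
  rintro _ ⟨z, hz, rfl⟩
  exact ⟨z, hz, rfl⟩

theorem congr {f f' : Jet → E} (hf : IsSmoothCyl D f) (h : ∀ z ∈ D, f' z = f z) :
    IsSmoothCyl D f' := by
  obtain ⟨A, g, hg, hfg⟩ := hf
  exact ⟨A, g, hg, fun z hz => (h z hz).trans (hfg z hz)⟩

theorem pi {ι : Type*} [Fintype ι] {f : Jet → ι → ℝ}
    (hf : ∀ i, IsSmoothCyl D fun z => f z i) : IsSmoothCyl D f := by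
  choose A g hg hfg using hf
  have hsub : ∀ i, A i ⊆ Finset.univ.biUnion A :=
    fun i => Finset.subset_biUnion_of_mem A (Finset.mem_univ i)
  choose g' hg' hfg' using fun i => exists_superset (hsub i) (hg i) (hfg i)
  exact ⟨_, fun w i => g' i w, contDiffOn_pi.2 hg', fun z hz => funext fun i => hfg' i z hz⟩

theorem prodMk {f : Jet → E} {f' : Jet → E'} (hf : IsSmoothCyl D f) (hf' : IsSmoothCyl D f') :
    IsSmoothCyl D fun z => (f z, f' z) := by
  obtain ⟨A, g, hg, hfg⟩ := hf
  obtain ⟨A', g', hg', hfg'⟩ := hf'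
  obtain ⟨k, hk, hfk⟩ := exists_superset (Finset.subset_union_left (s₂ := A')) hg hfg
  obtain ⟨k', hk', hfk'⟩ := exists_superset (Finset.subset_union_right (s₁ := A)) hg' hfg'
  exact ⟨_, fun w => (k w, k' w), hk.prodMk hk', fun z hz => Prod.ext (hfk z hz) (hfk' z hz)⟩

theorem comp {f : Jet → E} (hf : IsSmoothCyl D f) {φ : E → E'} {U : Set E}
    (hφ : ContDiffOn ℝ ∞ φ U) (hU : ∀ z ∈ D, f z ∈ U) : IsSmoothCyl D fun z => φ (f z) := by
  obtain ⟨A, g, hg, hfg⟩ := hf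
  refine ⟨A, φ ∘ g, hφ.comp hg ?_, fun z hz => congrArg φ (hfg z hz)⟩
  rintro _ ⟨z, hz, rfl⟩
  exact hfg z hz ▸ hU z hz

theorem coord (v : JetVar) : IsSmoothCyl D fun z => z v :=
  ⟨{v}, fun w => w ⟨v, by simp⟩, (contDiff_apply ℝ ℝ _).contDiffOn, fun _ _ => rfl⟩

theorem const (c : E) : IsSmoothCyl D fun _ => c :=
  ⟨∅, fun _ => c, contDiffOn_const, fun _ _ => rfl⟩

end IsSmoothCyl

/-! ## The algebra of differential functions on an open set -/

variable {D : Opens Jet}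

/-- Extension by zero. -/
def zext (f : D → ℝ) (z : Jet) : ℝ :=
  open Classical in if h : z ∈ D then f ⟨z, h⟩ else 0

theorem zext_of_mem (f : D → ℝ) {z : Jet} (h : z ∈ D) : zext f z = f ⟨z, h⟩ := by
  simp [zext, h]

variable (D) in
/-- The algebra of differential functions on `D`. -/
def diffAlg : Subalgebra ℝ (D → ℝ) where
  carrier := {f | IsSmoothCyl D (zext f)}
  mul_mem' := fun {a b} ha hb =>
    ((ha.prodMk hb).comp (φ := fun p : ℝ × ℝ => p.1 * p.2) (U := univ)
      (contDiff_fst.mul contDiff_snd).contDiffOn (fun _ _ => mem_univ _)).congr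
      fun z hz => by simp [zext_of_mem _ hz]
  add_mem' := fun {a b} ha hb =>
    ((ha.prodMk hb).comp (φ := fun p : ℝ × ℝ => p.1 + p.2) (U := univ)
      (contDiff_fst.add contDiff_snd).contDiffOn (fun _ _ => mem_univ _)).congr
      fun z hz => by simp [zext_of_mem _ hz]
  algebraMap_mem' := fun c => (IsSmoothCyl.const c).congr fun z hz => by
    simp [zext_of_mem _ hz]

variable (D) in
/-- Differential functions on `D`, as a type. -/
def DF : Type := diffAlg D

namespace DF

instance : CommRing (DF D) := inferInstanceAs (CommRing (diffAlg D))

instance : Algebra ℝ (DF D) := inferInstanceAs (Algebra ℝ (diffAlg D))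

/-- Evaluation at a point of `D`, as an algebra homomorphism. -/
def ev (z : D) : DF D →ₐ[ℝ] ℝ := (Pi.evalAlgHom ℝ (fun _ : D => ℝ) z).comp (diffAlg D).val

theorem ext {f g : DF D} (h : ∀ z, ev z f = ev z g) : f = g :=
  Subtype.ext (funext h)

/-- The differential function given by a smooth function of finitely many coordinates. -/
def mk (f : Jet → ℝ) (hf : IsSmoothCyl D f) : DF D :=
  ⟨fun z => f z, hf.congr fun z hz => by simp [zext_of_mem _ hz]⟩

@[simp] theorem ev_mk (f : Jet → ℝ) (hf : IsSmoothCyl D f) (z : D) : ev z (mk f hf) = f z := rfl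

/-- Extension of a differential function by zero. -/
def toFun (f : DF D) : Jet → ℝ := zext f.1

theorem toFun_of_mem (f : DF D) {z : Jet} (hz : z ∈ D) : f.toFun z = ev ⟨z, hz⟩ f :=
  zext_of_mem _ hz

theorem isSmoothCyl_toFun (f : DF D) : IsSmoothCyl D f.toFun := f.2

theorem exists_rep (f : DF D) : ∃ (A : Finset JetVar) (g : (A → ℝ) → ℝ),
    ContDiffOn ℝ ∞ g (restr A '' (D : Set Jet)) ∧ ∀ z : D, ev z f = g (restr A z) := by
  obtain ⟨A, g, hg, h⟩ := f.isSmoothCyl_toFun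
  exact ⟨A, g, hg, fun z => (f.toFun_of_mem z.2).symm.trans (h z z.2)⟩

variable (D) in
/-- The jet coordinates as differential functions. -/
def coord (v : JetVar) : DF D := mk (fun z => z v) (IsSmoothCyl.coord v)

@[simp] theorem ev_coord (v : JetVar) (z : D) : ev z (coord D v) = (z : Jet) v := rfl

/-! ### Partial derivatives -/

theorem update_eventually_mem (z : D) (v : JetVar) :
    ∀ᶠ s in nhds ((z : Jet) v), Function.update (z : Jet) v s ∈ D := by
  have hc : Continuous fun s : ℝ => Function.update (z : Jet) v s := continuous_const.update v continuous_id
  exact hc.continuousAt.eventually_mem (by simpa using D.isOpen.mem_nhds z.2)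

theorem hasDerivAt_restr_update (A : Finset JetVar) (v : JetVar) (z : Jet) (s : ℝ) :
    HasDerivAt (fun s => restr A (Function.update z v s)) (restr A (Pi.single v 1)) s := by
  refine hasDerivAt_pi.2 fun w => ?_
  by_cases h : (w : JetVar) = v
  · simpa [restr, h] using hasDerivAt_id' s
  · simpa [restr, h] using hasDerivAt_const s (z w)

theorem differentiableAt_rep {A : Finset JetVar} {E : Type*} [NormedAddCommGroup E]
    [NormedSpace ℝ E] {g : (A → ℝ) → E}
    (hg : ContDiffOn ℝ ∞ g (restr A '' (D : Set Jet))) (z : D) :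
    DifferentiableAt ℝ g (restr A z) :=
  (hg.contDiffAt ((isOpen_restr_image D A).mem_nhds ⟨z, z.2, rfl⟩)).differentiableAt (by simp)

/-- Along a coordinate line the representative moves in the direction `restr A (Pi.single v 1)`.
This direction is zero for `v ∉ A`, which is why only finitely many partial derivatives of a
differential function are nonzero. -/
theorem hasDerivAt_rep {f : Jet → ℝ} {A : Finset JetVar} {g : (A → ℝ) → ℝ}
    (hg : ContDiffOn ℝ ∞ g (restr A '' (D : Set Jet))) (h : ∀ z : D, f z = g (restr A z))
    (v : JetVar) (z : D) :
    HasDerivAt (fun s => f (Function.update z v s))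
      (fderiv ℝ g (restr A z) (restr A (Pi.single v 1))) ((z : Jet) v) := by
  have h1 := (differentiableAt_rep hg z).hasFDerivAt
  have h2 := hasDerivAt_restr_update A v z ((z : Jet) v)
  rw [← Function.update_eq_self v (z : Jet)] at h1
  have h3 := h1.comp_hasDerivAt _ (by simpa using h2)
  rw [Function.update_eq_self] at h3
  refine h3.congr_of_eventuallyEq ?_
  filter_upwards [update_eventually_mem z v] with s hs
  exact h ⟨_, hs⟩

theorem contDiffOn_fderiv_rep {A : Finset JetVar} {g : (A → ℝ) → ℝ}
    (hg : ContDiffOn ℝ ∞ g (restr A '' (D : Set Jet))) (e : A → ℝ) :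
    ContDiffOn ℝ ∞ (fun w => fderiv ℝ g w e) (restr A '' (D : Set Jet)) :=
  (hg.fderiv_of_isOpen (isOpen_restr_image D A) (by simp)).clm_apply contDiffOn_const

theorem isSmoothCyl_pd {f : Jet → ℝ} (hf : IsSmoothCyl D f) (v : JetVar) :
    IsSmoothCyl D (pd v f) := by
  obtain ⟨A, g, hg, h⟩ := hf
  exact ⟨A, _, contDiffOn_fderiv_rep hg (restr A (Pi.single v 1)), fun z hz =>
    (hasDerivAt_rep hg (fun z => h z z.2) v ⟨z, hz⟩).deriv⟩

theorem hasDerivAt_pd {f : Jet → ℝ} (hf : IsSmoothCyl D f) (v : JetVar) {z : Jet} (hz : z ∈ D) :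
    HasDerivAt (fun s => f (Function.update z v s)) (pd v f z) (z v) := by
  obtain ⟨A, g, hg, h⟩ := hf
  exact (hasDerivAt_rep hg (fun z => h z z.2) v ⟨z, hz⟩).differentiableAt.hasDerivAt

theorem pd_congr {f f' : Jet → ℝ} (h : ∀ z ∈ D, f z = f' z) (v : JetVar) {z : Jet} (hz : z ∈ D) :
    pd v f z = pd v f' z := by
  refine Filter.EventuallyEq.deriv_eq ?_
  filter_upwards [update_eventually_mem ⟨z, hz⟩ v] with s hs
  exact h _ hs

/-- Partial derivative of differential functions, as a function. -/
def pdFun (v : JetVar) (f : DF D) : DF D := mk (pd v f.toFun) (isSmoothCyl_pd f.isSmoothCyl_toFun v)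

theorem hasDerivAt_pdFun (v : JetVar) (f : DF D) (z : D) :
    HasDerivAt (fun s => f.toFun (Function.update z v s)) (ev z (pdFun v f)) ((z : Jet) v) :=
  hasDerivAt_pd f.isSmoothCyl_toFun v z.2

theorem pdFun_eq_of_hasDerivAt {v : JetVar} {f : DF D} {z : D} {a : ℝ}
    (h : HasDerivAt (fun s => f.toFun (Function.update z v s)) a ((z : Jet) v)) :
    ev z (pdFun v f) = a := (hasDerivAt_pdFun v f z).unique h

theorem toFun_add (f g : DF D) : (f + g).toFun = f.toFun + g.toFun := by
  funext z
  by_cases h : z ∈ D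
  · simp [toFun_of_mem _ h]
  · simp [toFun, zext, h]

theorem toFun_mul (f g : DF D) : (f * g).toFun = f.toFun * g.toFun := by
  funext z
  by_cases h : z ∈ D
  · simp [toFun_of_mem _ h]
  · simp [toFun, zext, h]

theorem toFun_smul (c : ℝ) (f : DF D) : (c • f).toFun = c • f.toFun := by
  funext z
  by_cases h : z ∈ D
  · simp [toFun_of_mem _ h]
  · simp [toFun, zext, h]

/-- The partial derivatives are derivations. -/
def pdA (v : JetVar) : Derivation ℝ (DF D) (DF D) :=
  Derivation.mk'
    { toFun := pdFun v
      map_add' := fun f g => ext fun z => pdFun_eq_of_hasDerivAt (by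
        rw [toFun_add, map_add]
        exact (hasDerivAt_pdFun v f z).add (hasDerivAt_pdFun v g z))
      map_smul' := fun c f => ext fun z => pdFun_eq_of_hasDerivAt (by
        rw [toFun_smul, RingHom.id_apply, map_smul]
        exact (hasDerivAt_pdFun v f z).const_smul c) }
    fun f g => ext fun z => pdFun_eq_of_hasDerivAt (by
      rw [toFun_mul]
      have h := (hasDerivAt_pdFun v f z).mul (hasDerivAt_pdFun v g z)
      simp only [Function.update_eq_self, toFun_of_mem _ z.2] at h
      refine h.congr_deriv ?_
      change _ = ev z (f * pdFun v g + g * pdFun v f)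
      rw [map_add, map_mul, map_mul]
      ring)

theorem hasDerivAt_pdA (v : JetVar) (f : DF D) (z : D) :
    HasDerivAt (fun s => f.toFun (Function.update z v s)) (ev z (pdA v f)) ((z : Jet) v) :=
  hasDerivAt_pdFun v f z

theorem ev_pdA_eq_of_hasDerivAt {v : JetVar} {f : DF D} {z : D} {a : ℝ}
    (h : HasDerivAt (fun s => f.toFun (Function.update z v s)) a ((z : Jet) v)) :
    ev z (pdA v f) = a := (hasDerivAt_pdFun v f z).unique h

theorem pd_eq_ev {f : Jet → ℝ} (hf : IsSmoothCyl D f) (v : JetVar) (z : D) :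
    pd v f z = ev z (pdA v (mk f hf)) :=
  pd_congr (fun z hz => by rw [toFun_of_mem _ hz, ev_mk]) v z.2

theorem ev_pdA_mk {f : Jet → ℝ} (hf : IsSmoothCyl D f) {v : JetVar} {z : D} {a : ℝ}
    (h : HasDerivAt (fun s => f (Function.update z v s)) a ((z : Jet) v)) :
    ev z (pdA v (mk f hf)) = a := by
  rw [← pd_eq_ev]; exact h.deriv

theorem ev_pdA_rep {f : DF D} {A : Finset JetVar} {g : (A → ℝ) → ℝ}
    (hg : ContDiffOn ℝ ∞ g (restr A '' (D : Set Jet))) (h : ∀ z : D, ev z f = g (restr A z))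
    (v : JetVar) (z : D) :
    ev z (pdA v f) = fderiv ℝ g (restr A z) (restr A (Pi.single v 1)) :=
  ev_pdA_eq_of_hasDerivAt
    (hasDerivAt_rep hg (fun z => (toFun_of_mem _ z.2).trans (h z)) v z)

theorem restr_single_of_notMem {A : Finset JetVar} {v : JetVar} (hv : v ∉ A) :
    restr A (Pi.single v 1) = 0 := by
  funext w
  have : (w : JetVar) ≠ v := fun h => hv (h ▸ w.2)
  simp [restr, this]

theorem exists_finset_pdA (f : DF D) : ∃ A : Finset JetVar, ∀ v ∉ A, pdA v f = 0 := by
  obtain ⟨A, g, hg, h⟩ := f.exists_rep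
  refine ⟨A, fun v hv => ext fun z => ?_⟩
  rw [ev_pdA_rep hg h, restr_single_of_notMem hv, map_zero, map_zero]

@[simp] theorem pdA_coord (v w : JetVar) : pdA v (coord D w) = if v = w then 1 else 0 := by
  refine ext fun z => ev_pdA_mk _ ?_
  by_cases h : v = w
  · subst h; simpa using hasDerivAt_id' ((z : Jet) v)
  · have h' : w ≠ v := fun e => h e.symm
    simpa [h, h'] using hasDerivAt_const ((z : Jet) v) ((z : Jet) w)

/-- Both sides are values of the second Fréchet derivative of one representative, which is
symmetric. -/
theorem pdA_comm (v w : JetVar) (f : DF D) : pdA v (pdA w f) = pdA w (pdA v f) := by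
  obtain ⟨A, g, hg, h⟩ := f.exists_rep
  refine ext fun z => ?_
  have key : ∀ v w : JetVar, ev z (pdA v (pdA w f)) =
      fderiv ℝ (fderiv ℝ g) (restr A z) (restr A (Pi.single v 1)) (restr A (Pi.single w 1)) := by
    intro v w
    rw [ev_pdA_rep (contDiffOn_fderiv_rep hg (restr A (Pi.single w 1)))
      (fun z => ev_pdA_rep hg h w z)]
    rw [fderiv_clm_apply (differentiableAt_rep
      (hg.fderiv_of_isOpen (isOpen_restr_image D A) (by simp)) z) (differentiableAt_const _)]
    simp
  rw [key, key]
  exact ((hg.contDiffAt ((isOpen_restr_image D A).mem_nhds ⟨z, z.2, rfl⟩)).isSymmSndFDerivAt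
    (by simpa using WithTop.coe_le_coe.2 (le_top : (2 : ℕ∞) ≤ ⊤))) _ _

/-! ### Constants -/

/-- The representative has zero Fréchet derivative, tested on basis vectors, on the projection of
`D`, which is open and connected. -/
theorem exists_eq_algebraMap (hD : IsPreconnected (D : Set Jet)) {f : DF D}
    (hf : ∀ v, pdA v f = 0) : ∃ c : ℝ, f = algebraMap ℝ (DF D) c := by
  obtain ⟨A, g, hg, h⟩ := f.exists_rep
  have hpre : IsPreconnected (restr A '' (D : Set Jet)) :=
    hD.image _ (Continuous.continuousOn (continuous_pi fun v => continuous_apply (v : JetVar)))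
  obtain ⟨c, hc⟩ := (isOpen_restr_image D A).exists_is_const_of_fderiv_eq_zero hpre
    (hg.differentiableOn (by simp)) (by
      rintro _ ⟨z, hz, rfl⟩
      refine ContinuousLinearMap.coe_injective (LinearMap.pi_ext' fun v => LinearMap.ext_ring ?_)
      have h1 := ev_pdA_rep hg h v ⟨z, hz⟩
      rw [hf, map_zero] at h1
      have h2 : restr A (Pi.single (v : JetVar) 1) = Pi.single v 1 := by
        funext w
        by_cases hw : w = v
        · subst hw; simp [restr]
        · have hw' : (w : JetVar) ≠ v := fun e => hw (Subtype.ext e)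
          rw [restr, Pi.single_eq_of_ne hw', Pi.single_eq_of_ne hw]
      rw [h2] at h1
      exact h1.symm)
  refine ⟨c, ext fun z => ?_⟩
  rw [h z, hc _ ⟨z, z.2, rfl⟩, AlgHom.commutes]
  rfl

/-- A differential function that does not depend on the coordinate `v` takes the same value at
jets that differ only in this coordinate. -/
theorem ev_eq_of_update {f : DF D} {v : JetVar} (hf : pdA v f = 0)
    (hv : ∀ z ∈ D, OrdConnected {s | Function.update z v s ∈ D}) {z z' : D} {s : ℝ}
    (h : (z' : Jet) = Function.update z v s) : ev z' f = ev z f := by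
  set U := {s | Function.update (z : Jet) v s ∈ D}
  have hU : Convex ℝ U := (hv z z.2).convex
  have hd : ∀ x ∈ U, HasDerivWithinAt (fun s => f.toFun (Function.update z v s)) 0 U x := by
    intro x hx
    have h1 := hasDerivAt_pdA v f ⟨_, hx⟩
    simp only [Function.update_idem, Function.update_self, hf, map_zero] at h1
    exact h1.hasDerivWithinAt
  have hz : (z : Jet) v ∈ U := by simp [U]
  have hs : s ∈ U := by
    change Function.update (z : Jet) v s ∈ D
    rw [← h]; exact z'.2
  -- The slice through `z` is an interval, so the mean value inequality with bound 0 applies.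
  have h2 := hU.norm_image_sub_le_of_norm_hasDerivWithin_le (C := 0) hd (by simp) hz hs
  simp only [zero_mul, norm_le_zero_iff, sub_eq_zero, Function.update_eq_self] at h2
  rw [← h, toFun_of_mem _ z'.2, toFun_of_mem _ z.2] at h2
  exact h2

end DF

namespace DF

/-! ### Vector fields on the jet space -/

/-- The derivation along the vector field with coefficients `c`, as a function. -/
def vfFun (c : JetVar → DF D) (f : DF D) : DF D := ∑ᶠ v, c v * pdA v f

theorem vfFun_eq_sum (c : JetVar → DF D) {f : DF D} {A : Finset JetVar}
    (hA : ∀ v ∉ A, pdA v f = 0) : vfFun c f = ∑ v ∈ A, c v * pdA v f :=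
  finsum_eq_sum_of_support_subset _ fun v hv => by
    by_contra h
    exact hv (by simp [hA v h])

theorem exists_finset_pdA₂ (f g : DF D) :
    ∃ A : Finset JetVar, ∀ v ∉ A, pdA v f = 0 ∧ pdA v g = 0 := by
  obtain ⟨A, hA⟩ := f.exists_finset_pdA
  obtain ⟨B, hB⟩ := g.exists_finset_pdA
  exact ⟨A ∪ B, fun v hv => ⟨hA v fun h => hv (Finset.mem_union_left _ h),
    hB v fun h => hv (Finset.mem_union_right _ h)⟩⟩

/-- The derivation along the vector field with coefficients `c`. -/
def vf (c : JetVar → DF D) : Derivation ℝ (DF D) (DF D) :=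
  Derivation.mk'
    { toFun := vfFun c
      map_add' := fun f g => by
        obtain ⟨A, hA⟩ := exists_finset_pdA₂ f g
        rw [vfFun_eq_sum c (fun v hv => (hA v hv).1), vfFun_eq_sum c (fun v hv => (hA v hv).2),
          vfFun_eq_sum c (A := A) (fun v hv => by rw [map_add, (hA v hv).1, (hA v hv).2, add_zero]),
          ← Finset.sum_add_distrib]
        simp only [map_add, mul_add]
      map_smul' := fun r f => by
        obtain ⟨A, hA⟩ := f.exists_finset_pdA
        rw [vfFun_eq_sum c hA, vfFun_eq_sum c (A := A) (fun v hv => by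
          rw [Derivation.map_smul, hA v hv, smul_zero]), RingHom.id_apply, Finset.smul_sum]
        simp only [Derivation.map_smul, mul_smul_comm] }
    fun f g => by
      obtain ⟨A, hA⟩ := exists_finset_pdA₂ f g
      change vfFun c (f * g) = f • vfFun c g + g • vfFun c f
      rw [vfFun_eq_sum c (fun v hv => (hA v hv).1), vfFun_eq_sum c (fun v hv => (hA v hv).2),
        vfFun_eq_sum c (A := A) (fun v hv => by
          rw [Derivation.leibniz, (hA v hv).1, (hA v hv).2, smul_zero, smul_zero, add_zero]),
        smul_eq_mul, smul_eq_mul, Finset.mul_sum, Finset.mul_sum, ← Finset.sum_add_distrib]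
      refine Finset.sum_congr rfl fun v _ => ?_
      rw [Derivation.leibniz, smul_eq_mul, smul_eq_mul]
      ring

theorem vf_eq_sum (c : JetVar → DF D) {f : DF D} {A : Finset JetVar}
    (hA : ∀ v ∉ A, pdA v f = 0) : vf c f = ∑ v ∈ A, c v * pdA v f := vfFun_eq_sum c hA

theorem vf_apply (c : JetVar → DF D) (f : DF D) : vf c f = ∑ᶠ v, c v * pdA v f := rfl

@[simp] theorem vf_coord (c : JetVar → DF D) (w : JetVar) : vf c (coord D w) = c w := by
  rw [vf_eq_sum c (A := {w}) (fun v hv => by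
    rw [pdA_coord, if_neg (by simpa using hv)])]
  simp

theorem vf_single (v : JetVar) (f : DF D) : vf (Pi.single v 1) f = pdA v f := by
  rw [vf_apply, finsum_eq_single _ v (fun w hw => by simp [hw])]
  simp

/-- The second-order terms cancel because partial derivatives commute; what remains is a vector
field, read off from its values on the coordinates. -/
theorem vf_commutator (c d : JetVar → DF D) (f : DF D) :
    vf c (vf d f) - vf d (vf c f) = vf (fun w => vf c (d w) - vf d (c w)) f := by
  obtain ⟨A, hA⟩ := f.exists_finset_pdA
  have key : ∀ c d : JetVar → DF D, vf c (vf d f) =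
      ∑ w ∈ A, (vf c (d w) * pdA w f + ∑ v ∈ A, d w * c v * pdA v (pdA w f)) := by
    intro c d
    rw [vf_eq_sum d hA, map_sum]
    refine Finset.sum_congr rfl fun w _ => ?_
    rw [Derivation.leibniz, smul_eq_mul, smul_eq_mul, vf_eq_sum c (f := pdA w f) (A := A)
      (fun v hv => by rw [pdA_comm, hA v hv, map_zero]), Finset.mul_sum, add_comm, mul_comm]
    simp only [mul_assoc]
  rw [key, key, vf_eq_sum _ hA, Finset.sum_add_distrib, Finset.sum_add_distrib,
    Finset.sum_comm (s := A) (t := A)]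
  simp only [sub_mul, Finset.sum_sub_distrib]
  have : ∀ v w : JetVar, d w * c v * pdA v (pdA w f) = c v * d w * pdA w (pdA v f) := by
    intro v w; rw [pdA_comm, mul_comm (d w)]
  simp only [this]
  ring

theorem vf_comm {c d : JetVar → DF D} (h : ∀ w, vf c (d w) = vf d (c w)) (f : DF D) :
    vf c (vf d f) = vf d (vf c f) := by
  rw [← sub_eq_zero, vf_commutator, vf_apply]
  simp [h]

/-- ∂ᵥ is the vector field with constant coefficients `Pi.single v 1`, so only the derivatives of
`c` survive in the commutator. -/
theorem pdA_vf (v : JetVar) (c : JetVar → DF D) (f : DF D) :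
    pdA v (vf c f) = vf c (pdA v f) + vf (fun w => pdA v (c w)) f := by
  have h := vf_commutator (Pi.single v 1) c f
  have h0 : ∀ w : JetVar, vf c ((Pi.single v (1 : DF D) : JetVar → DF D) w) = 0 := by
    intro w
    rcases eq_or_ne w v with rfl | hw
    · simp
    · simp [hw]
  simp only [vf_single, h0, sub_zero] at h
  rw [← h]; ring

/-! ### Total derivatives -/

/-- Coefficients of the total derivative with respect to `x`. -/
def cx : JetVar → DF D
  | .t => 0
  | .x => 1
  | .u i j => coord D (.u i (j + 1))
  | .h i j => coord D (.h i (j + 1))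

/-- Coefficients of the total derivative with respect to `t`. -/
def ct : JetVar → DF D
  | .t => 1
  | .x => 0
  | .u i j => coord D (.u (i + 1) j)
  | .h i j => coord D (.h (i + 1) j)

/-- The total derivative with respect to `x`. -/
def dx : Derivation ℝ (DF D) (DF D) := vf cx

/-- The total derivative with respect to `t`. -/
def dt : Derivation ℝ (DF D) (DF D) := vf ct

@[simp] theorem dx_coord (w : JetVar) : dx (coord D w) = cx w := vf_coord _ _

@[simp] theorem dt_coord (w : JetVar) : dt (coord D w) = ct w := vf_coord _ _

theorem dx_dt (f : DF D) : dx (dt f) = dt (dx f) := by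
  refine vf_comm (fun w => ?_) f
  cases w <;> simp [cx, ct]

/-- Matches the sum over all jet coordinates in `vf` with the sum over pairs in `Dt` and `Dx`. -/
theorem finsum_jetVar {M : Type*} [AddCommMonoid M] {f : JetVar → M}
    (hf : f.support.Finite) :
    ∑ᶠ v, f v = f .t + f .x + ∑ᶠ p : ℕ × ℕ, (f (.u p.1 p.2) + f (.h p.1 p.2)) := by
  have hu : Function.Injective fun p : ℕ × ℕ => JetVar.u p.1 p.2 := by
    rintro ⟨a, b⟩ ⟨c, d⟩ h; simpa using h
  have hh : Function.Injective fun p : ℕ × ℕ => JetVar.h p.1 p.2 := by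
    rintro ⟨a, b⟩ ⟨c, d⟩ h; simpa using h
  have huniv : (univ : Set JetVar) = ({.t, .x} ∪ range fun p : ℕ × ℕ => JetVar.u p.1 p.2) ∪
      range fun p : ℕ × ℕ => JetVar.h p.1 p.2 := by
    ext v
    cases v <;> simp
  rw [← finsum_mem_univ, huniv, finsum_mem_union' (by
      rw [Set.disjoint_left]; rintro v (hv | ⟨p, rfl⟩) ⟨q, h⟩
      · subst h; simp at hv
      · simp at h) (hf.inter_of_right _) (hf.inter_of_right _),
    finsum_mem_union' (by
      rw [Set.disjoint_left]; rintro v hv ⟨q, h⟩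
      subst h; simp at hv) (hf.inter_of_right _) (hf.inter_of_right _),
    finsum_mem_pair (by simp), finsum_mem_range hu, finsum_mem_range hh,
    finsum_add_distrib (hf.preimage hu.injOn) (hf.preimage hh.injOn), add_assoc]

theorem ev_vf (c : JetVar → DF D) (f : DF D) (z : D) :
    ev z (vf c f) = ev z (c .t) * ev z (pdA .t f) + ev z (c .x) * ev z (pdA .x f) +
      ∑ᶠ p : ℕ × ℕ, (ev z (c (.u p.1 p.2)) * ev z (pdA (.u p.1 p.2) f) +
        ev z (c (.h p.1 p.2)) * ev z (pdA (.h p.1 p.2) f)) := by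
  obtain ⟨A, hA⟩ := f.exists_finset_pdA
  have hs : (Function.support fun v => ev z (c v) * ev z (pdA v f)) ⊆ (A : Set JetVar) := by
    intro v hv
    by_contra h
    exact hv (by simp [hA v h])
  rw [vf_eq_sum c hA, map_sum, ← finsum_jetVar (f := fun v => ev z (c v) * ev z (pdA v f))
    (A.finite_toSet.subset hs), finsum_eq_sum_of_support_subset _ hs]
  simp only [map_mul]

/-- The bridge from `Dx` on raw functions to the derivation `dx`. Values off `D` play no role
because `D` is open. -/
theorem Dx_eq_ev {f : Jet → ℝ} (hf : IsSmoothCyl D f) (z : D) :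
    Dx f z = ev z (dx (mk f hf)) := by
  rw [dx, ev_vf, Dx]
  simp only [pd_eq_ev hf, cx, map_zero, map_one, ev_coord]
  ring

theorem Dt_eq_ev {f : Jet → ℝ} (hf : IsSmoothCyl D f) (z : D) :
    Dt f z = ev z (dt (mk f hf)) := by
  rw [dt, ev_vf, Dt]
  simp only [pd_eq_ev hf, ct, map_zero, map_one, ev_coord]
  ring

theorem isSmoothCyl_of_eq_ev {f : Jet → ℝ} {F : DF D} (h : ∀ z : D, f z = ev z F) :
    IsSmoothCyl D f :=
  F.isSmoothCyl_toFun.congr fun z hz => by rw [h ⟨z, hz⟩, toFun_of_mem _ hz]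

theorem mk_eq_of_eq_ev {f : Jet → ℝ} {F : DF D} (h : ∀ z : D, f z = ev z F) :
    mk f (isSmoothCyl_of_eq_ev h) = F := ext fun z => h z

theorem iterate_Dx_eq_ev {f : Jet → ℝ} {F : DF D} (h : ∀ z : D, f z = ev z F) (n : ℕ) (z : D) :
    Dx^[n] f z = ev z (dx^[n] F) := by
  induction n generalizing f F with
  | zero => exact h z
  | succ n ih =>
    refine ih (f := Dx f) (F := dx F) fun z => ?_
    rw [Dx_eq_ev (isSmoothCyl_of_eq_ev h), mk_eq_of_eq_ev h]

theorem iterate_Dt_eq_ev {f : Jet → ℝ} {F : DF D} (h : ∀ z : D, f z = ev z F) (n : ℕ) (z : D) :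
    Dt^[n] f z = ev z (dt^[n] F) := by
  induction n generalizing f F with
  | zero => exact h z
  | succ n ih =>
    refine ih (f := Dt f) (F := dt F) fun z => ?_
    rw [Dt_eq_ev (isSmoothCyl_of_eq_ev h), mk_eq_of_eq_ev h]

/-! ### Pullbacks -/

/-- The jet with coordinates `σ v z`. -/
def evJet (σ : JetVar → DF D) (z : D) : Jet := fun v => ev z (σ v)

/-- Pullback of a differential function under the map with components `σ`. -/
def pull (σ : JetVar → DF D) (hσ : ∀ z, evJet σ z ∈ D) (f : DF D) : DF D :=
  mk (fun z => f.toFun fun v => (σ v).toFun z) <| by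
    obtain ⟨A, g, hg, h⟩ := f.exists_rep
    have hσ' : ∀ z (hz : z ∈ D), (fun v => (σ v).toFun z) = evJet σ ⟨z, hz⟩ :=
      fun z hz => funext fun v => toFun_of_mem _ hz
    have hA : IsSmoothCyl D fun z => fun v : A => (σ v).toFun z :=
      IsSmoothCyl.pi fun v => (σ v).isSmoothCyl_toFun
    refine (hA.comp hg fun z hz => ⟨evJet σ ⟨z, hz⟩, hσ _, ?_⟩).congr fun z hz => ?_
    · rw [← hσ' z hz]; rfl
    · rw [hσ' z hz, toFun_of_mem _ (hσ _), h]
      exact congrArg g (funext fun v => (congrFun (hσ' z hz) v).symm)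

theorem ev_pull (σ : JetVar → DF D) (hσ : ∀ z, evJet σ z ∈ D) (f : DF D) (z : D) :
    ev z (pull σ hσ f) = ev ⟨evJet σ z, hσ z⟩ f := by
  rw [pull, ev_mk]
  have : (fun v => (σ v).toFun z) = evJet σ z := funext fun v => toFun_of_mem _ z.2
  rw [this, toFun_of_mem _ (hσ z)]

theorem pull_add (σ : JetVar → DF D) (hσ : ∀ z, evJet σ z ∈ D) (f g : DF D) :
    pull σ hσ (f + g) = pull σ hσ f + pull σ hσ g := ext fun z => by simp [ev_pull]

theorem pull_mul (σ : JetVar → DF D) (hσ : ∀ z, evJet σ z ∈ D) (f g : DF D) :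
    pull σ hσ (f * g) = pull σ hσ f * pull σ hσ g := ext fun z => by simp [ev_pull]

/-- The pullback as an algebra homomorphism. -/
def pullHom (σ : JetVar → DF D) (hσ : ∀ z, evJet σ z ∈ D) : DF D →ₐ[ℝ] DF D where
  toFun := pull σ hσ
  map_one' := ext fun z => by simp [ev_pull]
  map_mul' := pull_mul σ hσ
  map_zero' := ext fun z => by simp [ev_pull]
  map_add' := pull_add σ hσ
  commutes' := fun c => ext fun z => by simp [ev_pull]

theorem ev_pullHom (σ : JetVar → DF D) (hσ : ∀ z, evJet σ z ∈ D) (f : DF D) (z : D) :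
    ev z (pullHom σ hσ f) = ev ⟨evJet σ z, hσ z⟩ f := ev_pull σ hσ f z

@[simp] theorem pullHom_coord (σ : JetVar → DF D) (hσ : ∀ z, evJet σ z ∈ D) (v : JetVar) :
    pullHom σ hσ (coord D v) = σ v := ext fun z => by rw [ev_pullHom]; rfl

/-- The chain rule. The map has infinitely many components, but `f` sees only finitely many of them.
-/
theorem pdA_pullHom (σ : JetVar → DF D) (hσ : ∀ z, evJet σ z ∈ D) {f : DF D}
    {A : Finset JetVar} (hA : ∀ w ∉ A, pdA w f = 0) (v : JetVar) :
    pdA v (pullHom σ hσ f) = ∑ w ∈ A, pullHom σ hσ (pdA w f) * pdA v (σ w) := by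
  obtain ⟨B, g, hg, h⟩ := f.exists_rep
  -- `A` is any bound for the dependence of `f`, while `B` comes from a representative; both sums
  -- agree with the one over `A ∪ B`.
  have hsum : ∑ w ∈ A, pullHom σ hσ (pdA w f) * pdA v (σ w) =
      ∑ w ∈ A ∪ B, pullHom σ hσ (pdA w f) * pdA v (σ w) :=
    Finset.sum_subset Finset.subset_union_left fun w _ hw => by simp [hA w hw]
  have hsum' : ∑ w ∈ B, pullHom σ hσ (pdA w f) * pdA v (σ w) =
      ∑ w ∈ A ∪ B, pullHom σ hσ (pdA w f) * pdA v (σ w) :=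
    Finset.sum_subset Finset.subset_union_right fun w _ hw => by
      have : pdA w f = 0 := ext fun z => by
        rw [ev_pdA_rep hg h, restr_single_of_notMem hw, map_zero, map_zero]
      simp [this]
  rw [hsum, ← hsum']
  refine ext fun z => ev_pdA_eq_of_hasDerivAt ?_
  have h1 : HasDerivAt (fun s => fun w : B => (σ w).toFun (Function.update z v s))
      (fun w : B => ev z (pdA v (σ w))) ((z : Jet) v) :=
    hasDerivAt_pi.2 fun w => hasDerivAt_pdA v (σ w) z
  have h2 := (differentiableAt_rep hg ⟨evJet σ z, hσ z⟩).hasFDerivAt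
  have h0 : (fun w : B => (σ w).toFun (Function.update z v ((z : Jet) v))) =
      restr B (evJet σ z) := by
    funext w
    rw [Function.update_eq_self, toFun_of_mem _ z.2]; rfl
  simp only [← h0] at h2
  have h3 := h2.comp_hasDerivAt _ h1
  rw [h0] at h3
  refine (h3.congr_of_eventuallyEq ?_).congr_deriv ?_
  · filter_upwards [update_eventually_mem z v] with s hs
    rw [toFun_of_mem _ hs, ev_pullHom, h]
    refine congrArg g (funext fun w => ?_)
    exact (toFun_of_mem _ hs).symm
  · rw [pi_eq_sum_univ' (fun w : B => ev z (pdA v (σ w))), map_sum, map_sum, ← Finset.sum_coe_sort B]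
    refine Finset.sum_congr rfl fun w _ => ?_
    rw [map_mul, ev_pullHom, ev_pdA_rep hg h, map_smul, smul_eq_mul, mul_comm]
    congr 2
    funext w'
    by_cases hw : w' = w
    · subst hw; simp [restr]
    · simp [restr, hw]

/-- The hypothesis says that the fields `c` and `d` are related by the map on coordinates; the chain
rule extends this to all functions. -/
theorem vf_pullHom (σ : JetVar → DF D) (hσ : ∀ z, evJet σ z ∈ D) {c d : JetVar → DF D}
    (h : ∀ w, vf c (σ w) = pullHom σ hσ (d w)) (f : DF D) :
    vf c (pullHom σ hσ f) = pullHom σ hσ (vf d f) := by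
  obtain ⟨A, hA⟩ := f.exists_finset_pdA
  obtain ⟨B, hB⟩ := (pullHom σ hσ f).exists_finset_pdA
  choose T hT using fun w => (σ w).exists_finset_pdA
  set C := B ∪ A.biUnion T
  have hBC : ∀ v ∉ C, pdA v (pullHom σ hσ f) = 0 := fun v hv =>
    hB v fun hv' => hv (Finset.mem_union_left _ hv')
  rw [vf_eq_sum d hA, vf_eq_sum c hBC, map_sum]
  simp only [pdA_pullHom σ hσ hA, Finset.mul_sum]
  rw [Finset.sum_comm]
  refine Finset.sum_congr rfl fun w hw => ?_
  rw [map_mul, ← h, vf_eq_sum c (f := σ w) (A := C) (fun v hv => hT w v fun hv' => hv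
    (Finset.mem_union_right _ (Finset.mem_biUnion.2 ⟨w, hw, hv'⟩))), Finset.sum_mul]
  refine Finset.sum_congr rfl fun v _ => ?_
  ring

end DF

namespace DF

/-! ### Variational derivatives with respect to `x` -/

/-- The jet coordinate `u i j` or `h i j`. -/
def jv (κ : Bool) (i j : ℕ) : JetVar := bif κ then .u i j else .h i j

theorem pdA_jv_zero_dx (κ : Bool) (i : ℕ) (f : DF D) :
    pdA (jv κ i 0) (dx f) = dx (pdA (jv κ i 0) f) := by
  rw [dx, pdA_vf, vf_apply (fun w => pdA (jv κ i 0) (cx w))]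
  have : ∀ w, pdA (jv κ i 0) (cx w : DF D) = 0 := by
    intro w; cases κ <;> cases w <;> simp [jv, cx]
  simp [this]

/-- The coordinate with index j + 1 enters the coefficients of Dₓ only in front of the partial
derivative with index j. -/
theorem pdA_jv_succ_dx (κ : Bool) (i j : ℕ) (f : DF D) :
    pdA (jv κ i (j + 1)) (dx f) = dx (pdA (jv κ i (j + 1)) f) + pdA (jv κ i j) f := by
  have : (fun w => pdA (jv κ i (j + 1)) (cx w : DF D)) = Pi.single (jv κ i j) 1 := by
    funext w
    cases κ <;> cases w <;> simp [jv, cx, Pi.single_apply, eq_comm]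
  rw [dx, pdA_vf, this, vf_single]

theorem pdA_jv_zero_dt (κ : Bool) (j : ℕ) (f : DF D) :
    pdA (jv κ 0 j) (dt f) = dt (pdA (jv κ 0 j) f) := by
  rw [dt, pdA_vf, vf_apply (fun w => pdA (jv κ 0 j) (ct w))]
  have : ∀ w, pdA (jv κ 0 j) (ct w : DF D) = 0 := by
    intro w; cases κ <;> cases w <;> simp [jv, ct]
  simp [this]

theorem pdA_jv_succ_dt (κ : Bool) (i j : ℕ) (f : DF D) :
    pdA (jv κ (i + 1) j) (dt f) = dt (pdA (jv κ (i + 1) j) f) + pdA (jv κ i j) f := by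
  have : (fun w => pdA (jv κ (i + 1) j) (ct w : DF D)) = Pi.single (jv κ i j) 1 := by
    funext w
    cases κ <;> cases w <;> simp [jv, ct, Pi.single_apply, eq_comm]
  rw [dt, pdA_vf, this, vf_single]

/-- The order of a jet coordinate. -/
def jord : JetVar → ℕ
  | .t => 0
  | .x => 0
  | .u i j => i + j
  | .h i j => i + j

theorem jord_jv (κ : Bool) (i j : ℕ) : jord (jv κ i j) = i + j := by cases κ <;> rfl

theorem exists_jord_bound (f : DF D) : ∃ N, ∀ v, N ≤ jord v → pdA v f = 0 := by
  obtain ⟨A, hA⟩ := f.exists_finset_pdA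
  refine ⟨A.sup jord + 1, fun v hv => hA v fun h => ?_⟩
  have := Finset.le_sup (f := jord) h
  omega

/-- `f ↦ -Dₓ f`. -/
def ndx : Module.End ℝ (DF D) := -(dx : Derivation ℝ (DF D) (DF D)).toLinearMap

theorem ndx_apply (f : DF D) : ndx f = -dx f := rfl

/-- The operator `∑ⱼ (-Dₓ)ʲ (g · ∂b/∂vⱼ)`, where `vⱼ` runs through the `x`-derivatives of
`∂ₜⁱ u` or `∂ₜⁱ h`; for `g = 1` this is the variational derivative. -/
def eul (κ : Bool) (i : ℕ) (g b : DF D) : DF D := ∑ᶠ j, (ndx ^ j) (g * pdA (jv κ i j) b)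

theorem eul_eq_sum (κ : Bool) (i : ℕ) (g : DF D) {b : DF D} {N : ℕ}
    (hN : ∀ j, N ≤ j → pdA (jv κ i j) b = 0) :
    eul κ i g b = ∑ j ∈ Finset.range N, (ndx ^ j) (g * pdA (jv κ i j) b) :=
  finsum_eq_sum_of_support_subset _ fun j hj => by
    by_contra h
    exact hj (by
      change (ndx ^ j) (g * pdA (jv κ i j) b) = 0
      rw [hN j (by simpa using h), mul_zero, map_zero])

theorem exists_eul_bound (κ : Bool) (i : ℕ) (b : DF D) :
    ∃ N, ∀ j, N ≤ j → pdA (jv κ i j) b = 0 := by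
  obtain ⟨N, hN⟩ := b.exists_jord_bound
  exact ⟨N, fun j hj => hN _ (by rw [jord_jv]; omega)⟩

theorem eul_add_left (κ : Bool) (i : ℕ) (g g' b : DF D) :
    eul κ i (g + g') b = eul κ i g b + eul κ i g' b := by
  obtain ⟨N, hN⟩ := exists_eul_bound κ i b
  rw [eul_eq_sum κ i _ hN, eul_eq_sum κ i _ hN, eul_eq_sum κ i _ hN, ← Finset.sum_add_distrib]
  simp only [add_mul, map_add]

theorem eul_zero_left (κ : Bool) (i : ℕ) (b : DF D) : eul κ i 0 b = 0 := by
  simp [eul]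

theorem eul_sum_left {ι : Type*} (κ : Bool) (i : ℕ) (s : Finset ι) (g : ι → DF D) (b : DF D) :
    eul κ i (∑ a ∈ s, g a) b = ∑ a ∈ s, eul κ i (g a) b :=
  map_sum (⟨⟨fun g => eul κ i g b, eul_zero_left κ i b⟩, fun g g' => eul_add_left κ i g g' b⟩ :
    DF D →+ DF D) g s

theorem eul_add_right (κ : Bool) (i : ℕ) (g b b' : DF D) :
    eul κ i g (b + b') = eul κ i g b + eul κ i g b' := by
  obtain ⟨N, hN⟩ := exists_eul_bound κ i b
  obtain ⟨N', hN'⟩ := exists_eul_bound κ i b'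
  have h1 : ∀ j, max N N' ≤ j → pdA (jv κ i j) b = 0 := fun j hj => hN j (by omega)
  have h2 : ∀ j, max N N' ≤ j → pdA (jv κ i j) b' = 0 := fun j hj => hN' j (by omega)
  rw [eul_eq_sum κ i g h1, eul_eq_sum κ i g h2,
    eul_eq_sum κ i g (N := max N N') (fun j hj => by rw [map_add, h1 j hj, h2 j hj, add_zero]),
    ← Finset.sum_add_distrib]
  simp only [mul_add, map_add]

/-- Summation by parts: the commutator term shifts j by one and the sum telescopes against the
product rule. The weight `g` is kept general because the chain rule for variational derivatives
produces weights. -/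
theorem eul_dx (κ : Bool) (i : ℕ) (g b : DF D) : eul κ i g (dx b) = eul κ i (ndx g) b := by
  obtain ⟨N, hN⟩ := exists_eul_bound κ i b
  have hN1 : ∀ j, N + 1 ≤ j → pdA (jv κ i j) (dx b) = 0 := by
    rintro (_ | j) hj
    · omega
    · rw [pdA_jv_succ_dx, hN _ (by omega), hN _ (by omega), map_zero, add_zero]
  have key : ∀ j, (ndx ^ j) (ndx g * pdA (jv κ i j) b) =
      (ndx ^ (j + 1)) (g * pdA (jv κ i j) b) + (ndx ^ j) (g * dx (pdA (jv κ i j) b)) := by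
    intro j
    rw [pow_succ, Module.End.mul_apply, ← map_add, ndx_apply, ndx_apply, Derivation.leibniz,
      smul_eq_mul, smul_eq_mul]
    congr 1; ring
  rw [eul_eq_sum κ i g hN1, eul_eq_sum κ i _ hN, Finset.sum_range_succ']
  simp only [key, pdA_jv_succ_dx, pdA_jv_zero_dx, mul_add, map_add, Finset.sum_add_distrib]
  have h2 := Finset.sum_range_succ' (fun j => (ndx ^ j) (g * dx (pdA (jv κ i j) b))) N
  rw [Finset.sum_range_succ, hN N le_rfl] at h2
  simp only [map_zero, mul_zero, add_zero] at h2
  rw [h2]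
  ring

theorem eul_iterate_dx (κ : Bool) (i j : ℕ) (g b : DF D) :
    eul κ i g (dx^[j] b) = eul κ i ((ndx ^ j) g) b := by
  induction j generalizing g with
  | zero => rfl
  | succ j ih => rw [Function.iterate_succ_apply', eul_dx, ih, pow_succ, Module.End.mul_apply]

theorem eul_one_dx (κ : Bool) (i : ℕ) (b : DF D) : eul κ i 1 (dx b) = 0 := by
  rw [eul_dx, ndx_apply, Derivation.map_one_eq_zero, neg_zero, eul_zero_left]

theorem ndx_pow_dt (j : ℕ) (f : DF D) : (ndx ^ j) (dt f) = dt ((ndx ^ j) f) := by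
  induction j generalizing f with
  | zero => rfl
  | succ j ih =>
    rw [pow_succ, Module.End.mul_apply, Module.End.mul_apply, ndx_apply, ndx_apply, dx_dt,
      ← Derivation.map_neg, ih]

theorem eul_zero_dt (κ : Bool) (f : DF D) : eul κ 0 1 (dt f) = dt (eul κ 0 1 f) := by
  obtain ⟨N, hN⟩ := exists_eul_bound κ 0 f
  rw [eul_eq_sum κ 0 1 hN, eul_eq_sum κ 0 1 (N := N)
    (fun j hj => by rw [pdA_jv_zero_dt, hN j hj, map_zero]), map_sum]
  simp only [one_mul, pdA_jv_zero_dt, ndx_pow_dt]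

/-- The extra term comes from the commutator of Dₜ with the partial derivative of index i + 1. It is
what recovers information on a density from its divergence. -/
theorem eul_succ_dt (κ : Bool) (i : ℕ) (f : DF D) :
    eul κ (i + 1) 1 (dt f) = dt (eul κ (i + 1) 1 f) + eul κ i 1 f := by
  obtain ⟨N, hN⟩ := f.exists_jord_bound
  have h0 : ∀ i j, N ≤ j → pdA (jv κ i j) f = 0 := fun i j hj => hN _ (by rw [jord_jv]; omega)
  rw [eul_eq_sum κ _ 1 (h0 _), eul_eq_sum κ _ 1 (h0 _), eul_eq_sum κ _ 1 (N := N)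
    (fun j hj => by rw [pdA_jv_succ_dt, h0 _ j hj, h0 _ j hj, map_zero, add_zero]), map_sum,
    ← Finset.sum_add_distrib]
  simp only [one_mul, pdA_jv_succ_dt, ndx_pow_dt, map_add]

/-- Descent in i: Eᵢ R is zero for large i since R has finite order, and applying Eₘ₊₁ to the
identity, with Eₘ₊₁ P = 0 and Eₘ₊₁ R = 0, leaves Eₘ R = 0. -/
theorem eul_density_eq_zero {R X P : DF D} (hP : dt R + dx X = P) (κ : Bool) {n : ℕ}
    (hn : ∀ i, n < i → eul κ i 1 P = 0) {i : ℕ} (hi : n ≤ i) : eul κ i 1 R = 0 := by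
  obtain ⟨N, hN⟩ := R.exists_jord_bound
  have step : ∀ m, n ≤ m → eul κ (m + 1) 1 R = 0 → eul κ m 1 R = 0 := by
    intro m hm h
    have h1 := hn (m + 1) (by omega)
    rw [← hP, eul_add_right, eul_succ_dt, eul_one_dx, h, map_zero, zero_add, add_zero] at h1
    exact h1
  have large : ∀ m, N ≤ m → eul κ m 1 R = 0 := by
    intro m hm
    rw [eul_eq_sum κ m 1 (N := 0) (fun j _ => hN _ (by rw [jord_jv]; omega)), Finset.range_zero,
      Finset.sum_empty]
  have main : ∀ k m, n ≤ m → N ≤ m + k → eul κ m 1 R = 0 := by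
    intro k
    induction k with
    | zero => exact fun m _ h => large m h
    | succ k ih => exact fun m hm h => step m hm (ih (m + 1) (by omega) (by omega))
  exact main N i hi (by omega)

/-- The Euler–Lagrange equation for a total divergence of first order in `∂ₜ`. -/
theorem eul_zero_eq_dt_eul_one {R X P : DF D} (hP : dt R + dx X = P) (κ : Bool)
    (hn : ∀ i, 1 < i → eul κ i 1 P = 0) : eul κ 0 1 P = dt (eul κ 1 1 P) := by
  have h1 := eul_density_eq_zero hP κ hn le_rfl
  have h0 : eul κ 1 1 P = eul κ 0 1 R := by
    rw [← hP, eul_add_right, eul_succ_dt, eul_one_dx, h1, map_zero, zero_add, add_zero]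
  rw [h0, ← hP, eul_add_right, eul_zero_dt, eul_one_dx, add_zero]

theorem sum_jetVar {M : Type*} [AddCommMonoid M] {F : JetVar → M} (ht : F .t = 0) (hx : F .x = 0)
    (N : ℕ) : ∑ w ∈ ({.t, .x} ∪ (Finset.univ ×ˢ (Finset.range N ×ˢ Finset.range N)).image
      fun q : Bool × ℕ × ℕ => jv q.1 q.2.1 q.2.2), F w =
    ∑ κ : Bool, ∑ i ∈ Finset.range N, ∑ j ∈ Finset.range N, F (jv κ i j) := by
  rw [Finset.sum_union, Finset.sum_pair (by simp), ht, hx, add_zero, zero_add, Finset.sum_image,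
    Finset.sum_product]
  · simp only [Finset.sum_product]
  · rintro ⟨κ, i, j⟩ _ ⟨κ', i', j'⟩ _ h
    cases κ <;> cases κ' <;> simp_all [jv]
  · rw [Finset.disjoint_left]
    rintro v hv hv'
    simp only [Finset.mem_image] at hv'
    obtain ⟨⟨κ, i, j⟩, -, rfl⟩ := hv'
    cases κ <;> simp [jv] at hv

/-- The variational derivatives of the pullback of a function whose variational derivatives
vanish. -/
theorem eul_pullHom_eq_zero (σ : JetVar → DF D) (hσ : ∀ z, evJet σ z ∈ D)
    {a : Bool → ℕ → DF D} (ha : ∀ κ i j, σ (jv κ i j) = dx^[j] (a κ i))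
    (ht : ∀ κ j, pdA (jv κ 0 j) (σ .t) = 0) (hx : ∀ κ j, pdA (jv κ 0 j) (σ .x) = 0)
    (hdx : ∀ f, dx (pullHom σ hσ f) = pullHom σ hσ (dx f))
    {f : DF D} (hf : ∀ κ i, eul κ i 1 f = 0) (κ : Bool) : eul κ 0 1 (pullHom σ hσ f) = 0 := by
  obtain ⟨N, hN⟩ := f.exists_jord_bound
  set A : Finset JetVar := {.t, .x} ∪ (Finset.univ ×ˢ (Finset.range N ×ˢ Finset.range N)).image
      fun q : Bool × ℕ × ℕ => jv q.1 q.2.1 q.2.2 with hAdef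
  have hA : ∀ w ∉ A, pdA w f = 0 := by
    intro w hw
    refine hN w ?_
    by_contra hlt
    refine hw ?_
    cases w with
    | t => simp [A]
    | x => simp [A]
    | u i j =>
      refine Finset.mem_union_right _ (Finset.mem_image.2 ⟨(true, i, j), ?_, rfl⟩)
      simp only [jord] at hlt
      simp; omega
    | h i j =>
      refine Finset.mem_union_right _ (Finset.mem_image.2 ⟨(false, i, j), ?_, rfl⟩)
      simp only [jord] at hlt
      simp; omega
  have hpd : ∀ k, pdA (jv κ 0 k) (pullHom σ hσ f) = ∑ κ' : Bool, ∑ i ∈ Finset.range N,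
      ∑ j ∈ Finset.range N, pullHom σ hσ (pdA (jv κ' i j) f) * pdA (jv κ 0 k) (dx^[j] (a κ' i)) := by
    intro k
    rw [pdA_pullHom σ hσ hA, sum_jetVar (by rw [ht, mul_zero]) (by rw [hx, mul_zero])]
    simp only [ha]
  -- One bound for all the finitely many components involved, so that every `eul` below becomes a
  -- sum over the same range.
  obtain ⟨K, hK⟩ : ∃ K, (∀ k, K ≤ k → pdA (jv κ 0 k) (pullHom σ hσ f) = 0) ∧
      ∀ κ', ∀ i ∈ Finset.range N, ∀ j ∈ Finset.range N, ∀ k, K ≤ k →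
        pdA (jv κ 0 k) (dx^[j] (a κ' i)) = 0 := by
    obtain ⟨K, hK⟩ := exists_eul_bound κ 0 (pullHom σ hσ f)
    choose T hT using fun q : Bool × ℕ × ℕ => exists_eul_bound κ 0 (dx^[q.2.2] (a q.1 q.2.1))
    refine ⟨K + (Finset.univ ×ˢ (Finset.range N ×ˢ Finset.range N)).sup T,
      fun k hk => hK k (by omega), fun κ' i hi j hj k hk => hT (κ', i, j) k ?_⟩
    have := Finset.le_sup (f := T) (b := (κ', i, j))
      (s := Finset.univ ×ˢ (Finset.range N ×ˢ Finset.range N)) (by simp_all)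
    omega
  have hpow : ∀ j g, pullHom σ hσ ((ndx ^ j) g) = (ndx ^ j) (pullHom σ hσ g) := by
    intro j
    induction j with
    | zero => exact fun g => rfl
    | succ j ih =>
      intro g
      rw [pow_succ, Module.End.mul_apply, Module.End.mul_apply, ih, ndx_apply, ndx_apply, map_neg, hdx]
  -- Chain rule for variational derivatives: the powers of Dₓ acting on `a κ' i` are moved onto the
  -- weights, where they assemble to the pullback of `eul κ' i 1 f`.
  calc eul κ 0 1 (pullHom σ hσ f)
      = ∑ κ' : Bool, ∑ i ∈ Finset.range N, ∑ j ∈ Finset.range N,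
          eul κ 0 (pullHom σ hσ (pdA (jv κ' i j) f)) (dx^[j] (a κ' i)) := by
        rw [eul_eq_sum κ 0 1 hK.1]
        simp only [hpd, one_mul, map_sum]
        rw [Finset.sum_comm]
        refine Finset.sum_congr rfl fun κ' _ => ?_
        rw [Finset.sum_comm]
        refine Finset.sum_congr rfl fun i hi => ?_
        rw [Finset.sum_comm]
        refine Finset.sum_congr rfl fun j hj => ?_
        rw [eul_eq_sum κ 0 _ (hK.2 κ' i hi j hj)]
    _ = ∑ κ' : Bool, ∑ i ∈ Finset.range N, eul κ 0 (pullHom σ hσ (eul κ' i 1 f)) (a κ' i) := by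
        refine Finset.sum_congr rfl fun κ' _ => Finset.sum_congr rfl fun i _ => ?_
        rw [eul_eq_sum κ' i 1 (N := N) (fun j hj => hN _ (by rw [jord_jv]; omega)), map_sum,
          eul_sum_left]
        simp only [eul_iterate_dx, hpow, one_mul]
    _ = 0 := by simp [hf, eul_zero_left]

end DF

/-! ## Systems of the class -/

namespace DF

theorem pdA_mk_eq_zero {f : Jet → ℝ} (hf : IsSmoothCyl D f) {v : JetVar}
    (h : ∀ z s, f (Function.update z v s) = f z) : pdA v (mk f hf) = 0 :=
  ext fun z => ev_pdA_mk _ (by simpa [h] using hasDerivAt_const ((z : Jet) v) (f z))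

theorem iterate_dx_coord (κ : Bool) (i j : ℕ) :
    dx^[j] (coord D (jv κ i 0)) = coord D (jv κ i j) := by
  induction j with
  | zero => rfl
  | succ j ih => rw [Function.iterate_succ_apply', ih, dx_coord]; cases κ <;> rfl

end DF

namespace SWSystem

open DF

variable (S : SWSystem) {W : Set (ℝ × ℝ × ℝ)} (hW : IsOpen W)

/-- The domain of the system as an open subset of the jet space. -/
def domO : Opens Jet :=
  ⟨S.dom W, by
    have h1 : Continuous fun z : Jet => (z .t, z .x, z (.u 0 0)) := by fun_prop
    exact (hW.preimage h1).inter ((S.isOpen_I.preimage (continuous_apply _)).inter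
      ((S.isOpen_J.preimage (continuous_apply _)).inter
        (S.isOpen_K.preimage (continuous_apply _))))⟩

theorem mem_domO {z : Jet} : z ∈ S.domO hW ↔ (z .t, z .x, z (.u 0 0)) ∈ W ∧ z (.h 0 0) ∈ S.I ∧
    z (.u 0 1) ∈ S.J ∧ z (.h 0 1) ∈ S.K := Iff.rfl

/-- The jet with given `(t, x, u)`, `h`, `uₓ`, `hₓ` and with the other coordinates of `z`. -/
def jetWith (w : ℝ × ℝ × ℝ) (y p q : ℝ) (z : Jet) : Jet
  | .t => w.1
  | .x => w.2.1
  | .u 0 0 => w.2.2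
  | .h 0 0 => y
  | .u 0 1 => p
  | .h 0 1 => q
  | v => z v

theorem jetWith_self (z : Jet) :
    jetWith (z .t, z .x, z (.u 0 0)) (z (.h 0 0)) (z (.u 0 1)) (z (.h 0 1)) z = z := by
  funext v
  unfold jetWith
  split <;> rfl

/-- The domain is the image of `W × I × J × K × Jet` under `jetWith`, which overwrites the
restricted coordinates. -/
theorem isPreconnected_domO (hW' : IsPreconnected W) :
    IsPreconnected (S.domO hW : Set Jet) := by
  have hcont : Continuous fun a : (ℝ × ℝ × ℝ) × ℝ × ℝ × ℝ × Jet =>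
      jetWith a.1 a.2.1 a.2.2.1 a.2.2.2.1 a.2.2.2.2 := by
    refine continuous_pi fun v => ?_
    unfold jetWith
    split <;> fun_prop
  have himage : (S.domO hW : Set Jet) = (fun a : (ℝ × ℝ × ℝ) × ℝ × ℝ × ℝ × Jet =>
      jetWith a.1 a.2.1 a.2.2.1 a.2.2.2.1 a.2.2.2.2) '' (W ×ˢ S.I ×ˢ S.J ×ˢ S.K ×ˢ univ) := by
    ext z
    constructor
    · intro hz
      exact ⟨(_, _, _, _, z), ⟨hz.1, hz.2.1, hz.2.2.1, hz.2.2.2, mem_univ _⟩, jetWith_self z⟩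
    · rintro ⟨⟨w, y, p, q, z⟩, ⟨h1, h2, h3, h4, -⟩, rfl⟩
      exact ⟨h1, h2, h3, h4⟩
  rw [himage]
  exact (hW'.prod (S.ordConnected_I.isPreconnected.prod (S.ordConnected_J.isPreconnected.prod
    (S.ordConnected_K.isPreconnected.prod isPreconnected_univ)))).image _ hcont.continuousOn

theorem jetWith_mem {w : ℝ × ℝ × ℝ} {y p q : ℝ} (z : Jet) (h1 : w ∈ W) (h2 : y ∈ S.I)
    (h3 : p ∈ S.J) (h4 : q ∈ S.K) : jetWith w y p q z ∈ S.domO hW := ⟨h1, h2, h3, h4⟩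

theorem nonempty_domO (hW' : W.Nonempty) : Nonempty (S.domO hW) := by
  obtain ⟨w, hw⟩ := hW'
  obtain ⟨y, hy⟩ := S.nonempty_I
  obtain ⟨p, hp⟩ := S.nonempty_J
  obtain ⟨q, hq⟩ := S.nonempty_K
  exact ⟨⟨_, S.jetWith_mem hW 0 hw hy hp hq⟩⟩

/-- The function `F` as a differential function. -/
def FF : DF (S.domO hW) :=
  DF.mk (fun z => S.F (z (.h 0 0)) (z (.u 0 1)) (z (.h 0 1)))
    (((IsSmoothCyl.coord (.h 0 0)).prodMk ((IsSmoothCyl.coord (.u 0 1)).prodMk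
      (IsSmoothCyl.coord (.h 0 1)))).comp S.smooth_F fun _ hz => ⟨hz.2.1, hz.2.2.1, hz.2.2.2⟩)

theorem ev_FF (z : S.domO hW) :
    ev z (S.FF hW) = S.F ((z : Jet) (.h 0 0)) ((z : Jet) (.u 0 1)) ((z : Jet) (.h 0 1)) := rfl

theorem pdA_FF {v : JetVar} (h1 : v ≠ .h 0 0) (h2 : v ≠ .u 0 1) (h3 : v ≠ .h 0 1) :
    pdA v (S.FF hW) = 0 :=
  pdA_mk_eq_zero _ fun z s => by
    rw [Function.update_of_ne h1.symm, Function.update_of_ne h2.symm, Function.update_of_ne h3.symm]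

/-- The momentum equation solved for `uₜ` and the mass equation solved for `hₜ`. -/
def rhs (κ : Bool) : DF (S.domO hW) :=
  bif κ then -(coord _ (.u 0 0) * coord _ (.u 0 1) + coord _ (.h 0 1)
    - S.FF hW * coord _ (.u 0 2))
  else -(coord _ (.u 0 0) * coord _ (.h 0 1) + coord _ (.h 0 0) * coord _ (.u 0 1))

/-- The left-hand sides of the equations as differential functions. -/
def delta (κ : Bool) : DF (S.domO hW) := coord _ (jv κ 1 0) - S.rhs hW κ

theorem ev_delta_true (z : S.domO hW) : ev z (S.delta hW true) = S.Delta₁ z := by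
  simp [delta, rhs, jv, Delta₁, ev_FF]
  ring

theorem ev_delta_false (z : S.domO hW) : ev z (S.delta hW false) = Delta₂ z := by
  simp [delta, rhs, jv, Delta₂]
  ring

/-! ### The solution manifold -/

/-- Coefficients of the total derivative with respect to `t` on the solution manifold. -/
def cev : JetVar → DF (S.domO hW)
  | .t => 1
  | .x => 0
  | .u 0 j => dx^[j] (S.rhs hW true)
  -- The t-derivatives are not coordinates on the solution manifold. The value zero keeps the field
  -- commuting with `dx`.
  | .u (_ + 1) _ => 0
  | .h 0 j => dx^[j] (S.rhs hW false)
  | .h (_ + 1) _ => 0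

/-- The total derivative with respect to `t` on the solution manifold. -/
def dev : Derivation ℝ (DF (S.domO hW)) (DF (S.domO hW)) := vf (S.cev hW)

theorem cev_jv_zero (κ : Bool) (j : ℕ) : S.cev hW (jv κ 0 j) = dx^[j] (S.rhs hW κ) := by
  cases κ <;> rfl

theorem dev_coord (v : JetVar) : S.dev hW (coord _ v) = S.cev hW v := vf_coord _ _

/-- The nonconstant coefficients are the Dₓ-prolongations of the right-hand sides, so the two fields
commute on coordinates. -/
theorem dx_dev (f : DF (S.domO hW)) : dx (S.dev hW f) = S.dev hW (dx f) := by
  refine vf_comm (fun w => ?_) f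
  change dx _ = S.dev hW _
  match w with
  | .t => simp [cev, cx]
  | .x => simp [cev, cx]
  | .u 0 j =>
    rw [cev, cx, dev_coord, cev, Function.iterate_succ_apply']
  | .u (i + 1) j => simp [cev, cx, dev_coord]
  | .h 0 j =>
    rw [cev, cx, dev_coord, cev, Function.iterate_succ_apply']
  | .h (i + 1) j => simp [cev, cx, dev_coord]

theorem iterate_dx_dev (j : ℕ) (f : DF (S.domO hW)) :
    dx^[j] (S.dev hW f) = S.dev hW (dx^[j] f) := by
  induction j with
  | zero => rfl
  | succ j ih => rw [Function.iterate_succ_apply', Function.iterate_succ_apply', ih, dx_dev]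

/-- The `t`-derivatives of `u` and `h` on the solution manifold. -/
def solT (κ : Bool) (i : ℕ) : DF (S.domO hW) := (S.dev hW)^[i] (coord _ (jv κ 0 0))

/-- Components of the projection of the jet space to the solution manifold. -/
def solMap : JetVar → DF (S.domO hW)
  | .t => coord _ .t
  | .x => coord _ .x
  | .u i j => dx^[j] (S.solT hW true i)
  | .h i j => dx^[j] (S.solT hW false i)

theorem solMap_jv (κ : Bool) (i j : ℕ) :
    S.solMap hW (jv κ i j) = dx^[j] (S.solT hW κ i) := by cases κ <;> rfl

/-- Pure x-derivatives are fixed by the projection. They include all dependent coordinates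
restricted by `dom` and all arguments of `F`. -/
theorem solMap_jv_zero (κ : Bool) (j : ℕ) : S.solMap hW (jv κ 0 j) = coord _ (jv κ 0 j) := by
  rw [solMap_jv]; exact iterate_dx_coord κ 0 j

theorem evJet_solMap_jv_zero (κ : Bool) (j : ℕ) (z : S.domO hW) :
    evJet (S.solMap hW) z (jv κ 0 j) = (z : Jet) (jv κ 0 j) := by
  rw [evJet, solMap_jv_zero, ev_coord]

theorem evJet_solMap_mem (z : S.domO hW) : evJet (S.solMap hW) z ∈ S.domO hW := by
  rw [mem_domO]
  have h1 := S.evJet_solMap_jv_zero hW true 0 z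
  have h2 := S.evJet_solMap_jv_zero hW false 0 z
  have h3 := S.evJet_solMap_jv_zero hW true 1 z
  have h4 := S.evJet_solMap_jv_zero hW false 1 z
  simp only [jv, cond_true, cond_false] at h1 h2 h3 h4
  rw [h1, h2, h3, h4]
  exact z.2

/-- The pullback to the solution manifold. -/
abbrev solPull : DF (S.domO hW) →ₐ[ℝ] DF (S.domO hW) :=
  pullHom (S.solMap hW) (S.evJet_solMap_mem hW)

theorem dx_solPull (f : DF (S.domO hW)) : dx (S.solPull hW f) = S.solPull hW (dx f) := by
  refine vf_pullHom _ _ (fun w => ?_) f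
  change dx _ = _
  cases w <;> simp [solMap, cx, Function.iterate_succ_apply']

/-- Together with `dx_solPull`, this reduces the vanishing of all differential consequences to that
of the two equations. -/
theorem dev_solPull (f : DF (S.domO hW)) :
    S.dev hW (S.solPull hW f) = S.solPull hW (dt f) := by
  refine vf_pullHom _ _ (fun w => ?_) f
  change S.dev hW _ = _
  cases w with
  | t => simp [solMap, ct, dev_coord, cev]
  | x => simp [solMap, ct, dev_coord, cev]
  | u i j => rw [solMap, ct, pullHom_coord, solMap, ← iterate_dx_dev, solT, solT,
      Function.iterate_succ_apply']
  | h i j => rw [solMap, ct, pullHom_coord, solMap, ← iterate_dx_dev, solT, solT,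
      Function.iterate_succ_apply']

theorem solPull_FF : S.solPull hW (S.FF hW) = S.FF hW := by
  refine DF.ext fun z => ?_
  have h2 := S.evJet_solMap_jv_zero hW false 0 z
  have h3 := S.evJet_solMap_jv_zero hW true 1 z
  have h4 := S.evJet_solMap_jv_zero hW false 1 z
  simp only [jv, cond_true, cond_false] at h2 h3 h4
  rw [ev_pullHom, ev_FF, ev_FF]
  dsimp only
  rw [h2, h3, h4]

theorem solPull_delta (κ : Bool) : S.solPull hW (S.delta hW κ) = 0 := by
  have h : ∀ κ j, S.solPull hW (coord _ (jv κ 0 j)) = coord _ (jv κ 0 j) := fun κ j => by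
    rw [pullHom_coord, solMap_jv_zero]
  have h1 := h true 0
  have h2 := h false 0
  have h3 := h true 1
  have h4 := h false 1
  have h5 := h true 2
  simp only [jv, cond_true, cond_false] at h1 h2 h3 h4 h5
  have hr : S.solPull hW (S.rhs hW κ) = S.rhs hW κ := by
    cases κ <;> simp only [rhs, cond_true, cond_false, map_neg, map_sub, map_add, map_mul,
      h1, h2, h3, h4, h5, solPull_FF]
  rw [delta, map_sub, hr, pullHom_coord, solMap_jv, Function.iterate_zero, id, solT,
    Function.iterate_one, dev_coord, cev_jv_zero, Function.iterate_zero, id, sub_self]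

theorem solPull_iterate (κ : Bool) (a b : ℕ) :
    S.solPull hW (dt^[a] (dx^[b] (S.delta hW κ))) = 0 := by
  induction a with
  | zero =>
    induction b with
    | zero => exact S.solPull_delta hW κ
    | succ b ih =>
      simp only [Function.iterate_zero, id] at ih ⊢
      rw [Function.iterate_succ_apply', ← dx_solPull, ih, map_zero]
  | succ a ih => rw [Function.iterate_succ_apply', ← dev_solPull, ih, map_zero]

theorem evJet_solMap_mem_solManifold (z : S.domO hW) :
    evJet (S.solMap hW) z ∈ S.solManifold W := by
  refine ⟨S.evJet_solMap_mem hW z, fun a b => ?_⟩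
  have key : ∀ κ, ev ⟨_, S.evJet_solMap_mem hW z⟩ (dt^[a] (dx^[b] (S.delta hW κ))) = 0 := by
    intro κ
    rw [← ev_pullHom, solPull_iterate, map_zero]
  exact ⟨(iterate_Dt_eq_ev (fun z => iterate_Dx_eq_ev
      (fun z => (S.ev_delta_true hW z).symm) b z) a ⟨_, S.evJet_solMap_mem hW z⟩).trans (key true),
    (iterate_Dt_eq_ev (fun z => iterate_Dx_eq_ev
      (fun z => (S.ev_delta_false hW z).symm) b z) a ⟨_, S.evJet_solMap_mem hW z⟩).trans (key false)⟩

/-- A density of order zero of a trivial conserved vector does not depend on `u` and `h`. -/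
theorem IsTrivial.pdA_density {S : SWSystem} {hW : IsOpen W} {Φ : FluxPair}
    (hΦ : S.IsTrivial W Φ) {ρ : DF (S.domO hW)} (hρ : ∀ z : S.domO hW, Φ.1 z = ev z ρ)
    (hdep : ∀ z z' : S.domO hW, (z : Jet) .t = (z' : Jet) .t → (z : Jet) .x = (z' : Jet) .x →
      (∀ κ, (z : Jet) (jv κ 0 0) = (z' : Jet) (jv κ 0 0)) → ev z ρ = ev z' ρ)
    (hdep' : ∀ κ j, pdA (jv κ 0 (j + 1)) ρ = 0) (κ : Bool) :
    pdA (jv κ 0 0) ρ = 0 := by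
  obtain ⟨M, N, ⟨hM1, -⟩, ⟨hN1, hN2⟩, hsum, hM, hN⟩ := hΦ
  have hN1' : IsSmoothCyl (S.domO hW) N.1 := hN1
  have hN2' : IsSmoothCyl (S.domO hW) N.2 := hN2
  have hdiv : dt (DF.mk N.1 hN1') + dx (DF.mk N.2 hN2') = 0 := DF.ext fun z => by
    rw [map_add, ← Dt_eq_ev, ← Dx_eq_ev, map_zero]
    exact hN z z.2
  -- A null divergence is the case P = 0, so the descent reaches every i.
  have heul : ∀ κ i, eul κ i 1 (DF.mk N.1 hN1') = 0 := fun κ i =>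
    eul_density_eq_zero hdiv κ (n := 0)
      (fun i _ => by rw [eul_eq_sum κ i 1 (N := 0) (fun j _ => map_zero _)]; rfl) (Nat.zero_le i)
  -- On solution jets the density equals `N.1`; projecting does not change `ρ`, since t, x, u, h are
  -- kept.
  have hpull : S.solPull hW (DF.mk N.1 hN1') = ρ := DF.ext fun z => by
    rw [ev_pullHom, ev_mk]
    have h1 := (hsum _ (S.evJet_solMap_mem hW z)).1
    rw [(hM _ (S.evJet_solMap_mem_solManifold hW z)).1, zero_add] at h1
    rw [← h1, hρ ⟨_, S.evJet_solMap_mem hW z⟩]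
    exact hdep _ _ rfl rfl fun κ => S.evJet_solMap_jv_zero hW κ 0 z
  have h0 := eul_pullHom_eq_zero _ (S.evJet_solMap_mem hW) (S.solMap_jv hW)
    (fun κ j => by cases κ <;> simp [solMap, jv]) (fun κ j => by cases κ <;> simp [solMap, jv])
    (S.dx_solPull hW) heul κ
  rw [hpull, eul_eq_sum κ 0 1 (N := 1) (by
    rintro (_ | j) hj
    · omega
    · exact hdep' κ j)] at h0
  simpa using h0

end SWSystem

local notation "Pt" => DF.pdA JetVar.t
local notation "Px" => DF.pdA JetVar.x
local notation "Pu" => DF.pdA (JetVar.u 0 0)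
local notation "Ph" => DF.pdA (JetVar.h 0 0)
local notation "Pp" => DF.pdA (JetVar.u 0 1)
local notation "Pq" => DF.pdA (JetVar.h 0 1)
local notation "Xt" => DF.coord _ JetVar.t
local notation "Xx" => DF.coord _ JetVar.x
local notation "Xu" => DF.coord _ (JetVar.u 0 0)
local notation "Xh" => DF.coord _ (JetVar.h 0 0)
local notation "Xp" => DF.coord _ (JetVar.u 0 1)
local notation "Xq" => DF.coord _ (JetVar.h 0 1)
local notation "Xr" => DF.coord _ (JetVar.u 0 2)
local notation "Xs" => DF.coord _ (JetVar.h 0 2)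

/-! ### The determining equations for multipliers -/

namespace DF

/-- `f` depends only on the coordinates in `A`. -/
def Dep (A : Finset JetVar) (f : DF D) : Prop := ∀ v ∉ A, pdA v f = 0

theorem Dep.pdA {A : Finset JetVar} {f : DF D} (hf : Dep A f) (w : JetVar) :
    Dep A (pdA w f) := fun v hv => by rw [pdA_comm, hf v hv, map_zero]

theorem Dep.vf {A : Finset JetVar} {f : DF D} (hf : Dep A f) (c : JetVar → DF D) :
    vf c f = ∑ v ∈ A, c v * DF.pdA v f := vf_eq_sum c hf

/-- The coordinates `t, x, u, h`. -/
abbrev coords₀ : Finset JetVar := {.t, .x, .u 0 0, .h 0 0}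

/-- The coordinates `h, uₓ, hₓ`. -/
abbrev coordsF : Finset JetVar := {.h 0 0, .u 0 1, .h 0 1}

theorem Dep.dx₀ {f : DF D} (hf : Dep coords₀ f) :
    dx f = Px f + Xp * Pu f + Xq * Ph f := by
  rw [dx, hf.vf]
  simp [coords₀, cx]
  ring

theorem Dep.dt₀ {f : DF D} (hf : Dep coords₀ f) :
    dt f = Pt f + coord _ (.u 1 0) * Pu f + coord _ (.h 1 0) * Ph f := by
  rw [dt, hf.vf]
  simp [coords₀, ct]
  ring

theorem Dep.dxF {f : DF D} (hf : Dep coordsF f) :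
    dx f = Xq * Ph f + Xr * Pp f + Xs * Pq f := by
  rw [dx, hf.vf]
  simp [coordsF, cx]
  ring

end DF

namespace SWSystem

open DF

variable (S : SWSystem) {W : Set (ℝ × ℝ × ℝ)} (hW : IsOpen W)

theorem dep_FF : Dep coordsF (S.FF hW) := fun v hv => by
  simp only [coordsF, Finset.mem_insert, Finset.mem_singleton, not_or] at hv
  exact S.pdA_FF hW hv.1 hv.2.1 hv.2.2

theorem mul_delta_eq (L M : DF (S.domO hW)) : L * S.delta hW true + M * S.delta hW false =
    L * (coord _ (.u 1 0) + Xu * Xp + Xq - S.FF hW * Xr)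
      + M * (coord _ (.h 1 0) + Xu * Xq + Xh * Xp) := by
  simp only [delta, rhs, cond_true, cond_false, jv]
  ring

/-- The coordinate uₜ occurs only in Δ₁, with coefficient 1, and no x-derivative of uₜ occurs. -/
theorem eul_true_one_mul_delta {L M : DF (S.domO hW)} (hL : Dep coords₀ L) (hM : Dep coords₀ M) :
    eul true 1 1 (L * S.delta hW true + M * S.delta hW false) = L := by
  have hF := S.dep_FF hW
  rw [S.mul_delta_eq hW]
  rw [eul_eq_sum true 1 1 (N := 1), Finset.sum_range_one]
  · simp [jv, Derivation.leibniz, hL _, hM _, hF _]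
  · intro j hj
    have h0 : j ≠ 0 := by omega
    simp [jv, Derivation.leibniz, h0, hL _, hM _, hF _]

theorem eul_false_one_mul_delta {L M : DF (S.domO hW)} (hL : Dep coords₀ L) (hM : Dep coords₀ M) :
    eul false 1 1 (L * S.delta hW true + M * S.delta hW false) = M := by
  have hF := S.dep_FF hW
  rw [S.mul_delta_eq hW]
  rw [eul_eq_sum false 1 1 (N := 1), Finset.sum_range_one]
  · simp [jv, Derivation.leibniz, hL _, hM _, hF _]
  · intro j hj
    have h0 : j ≠ 0 := by omega
    simp [jv, Derivation.leibniz, h0, hL _, hM _, hF _]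

/-- The determining equations for multipliers `L`, `M` of order zero. -/
structure DetEqs (F L M : DF D) : Prop where
  mul_Fq : L * Pq F = 0
  Mu : Pu M = Ph L
  Mh : Xh * Ph M = Pu L
  LF : L * Ph F + Ph L * F = 0
  mass : Px L + Xu * Px M + Pt M = 0
  visc : 2 * Pu L * F + Pp F * (Px L + Xp * Pu L) = 0
  mom : Xu * Px L + Xh * Px M + Pt L
    + F * (Px (Px L) + 2 * Xp * Pu (Px L) + Xp ^ 2 * Pu (Pu L)) = 0

/-- The two equations E₀P = Dₜ E₁P have right-hand sides Dₜ L and Dₜ M. Since L, M and F involve few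
coordinates, both can be split: differentiating with respect to a coordinate that enters linearly
extracts its coefficient. -/
theorem detEqs {R X L M : DF (S.domO hW)} (hL : Dep coords₀ L) (hM : Dep coords₀ M)
    (h : dt R + dx X = L * S.delta hW true + M * S.delta hW false) :
    DetEqs (S.FF hW) L M := by
  set F := S.FF hW with hFdef
  have hF : Dep coordsF F := S.dep_FF hW
  set P := L * S.delta hW true + M * S.delta hW false with hP
  have hPe : P = L * (coord _ (.u 1 0) + Xu * Xp + Xq - F * Xr)
      + M * (coord _ (.h 1 0) + Xu * Xq + Xh * Xp) := S.mul_delta_eq hW L M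
  -- variational derivatives of `P`
  have hu : ∀ i, 1 < i → eul true i 1 P = 0 := by
    intro i hi
    rw [eul_eq_sum true i 1 (N := 0), Finset.range_zero, Finset.sum_empty]
    intro j _
    have h0 : i ≠ 0 := by omega
    have h1 : i ≠ 1 := by omega
    rw [hPe]
    simp [jv, Derivation.leibniz, h0, h1, hL _, hM _, hF _]
  have hh : ∀ i, 1 < i → eul false i 1 P = 0 := by
    intro i hi
    rw [eul_eq_sum false i 1 (N := 0), Finset.range_zero, Finset.sum_empty]
    intro j _
    have h0 : i ≠ 0 := by omega
    have h1 : i ≠ 1 := by omega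
    rw [hPe]
    simp [jv, Derivation.leibniz, h0, h1, hL _, hM _, hF _]
  have eu1 := S.eul_true_one_mul_delta hW hL hM
  have eh1 := S.eul_false_one_mul_delta hW hL hM
  rw [← hP] at eu1 eh1
  have pu0 : Pu P = Pu L * (coord _ (.u 1 0) + Xu * Xp + Xq - F * Xr)
      + L * Xp + Pu M * (coord _ (.h 1 0) + Xu * Xq + Xh * Xp) + M * Xq := by
    rw [hPe]
    simp [Derivation.leibniz, hF _]
    ring
  have pp0 : Pp P = L * Xu - L * Pp F * Xr + M * Xh := by
    rw [hPe]
    simp [Derivation.leibniz, hL _, hM _]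
    ring
  have pr0 : pdA (.u 0 2) P = -(L * F) := by
    rw [hPe]
    simp [Derivation.leibniz, hL _, hM _, hF _]
  have ph0 : Ph P = Ph L * (coord _ (.u 1 0) + Xu * Xp + Xq - F * Xr) - L * Ph F * Xr
      + Ph M * (coord _ (.h 1 0) + Xu * Xq + Xh * Xp) + M * Xp := by
    rw [hPe]
    simp [Derivation.leibniz]
    ring
  have pq0 : Pq P = L - L * Pq F * Xr + M * Xu := by
    rw [hPe]
    simp [Derivation.leibniz, hL _, hM _]
    ring
  have eu0 : eul true 0 1 P = Pu P - dx (Pp P) + dx (dx (pdA (.u 0 2) P)) := by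
    rw [eul_eq_sum true 0 1 (N := 3)]
    · simp [Finset.sum_range_succ, jv, ndx_apply, pow_succ]
      ring
    · intro j hj
      have h0 : j ≠ 0 := by omega
      have h1 : j ≠ 1 := by omega
      have h2 : j ≠ 2 := by omega
      rw [hPe]
      simp [jv, Derivation.leibniz, h0, h1, h2, hL _, hM _, hF _]
  have eh0 : eul false 0 1 P = Ph P - dx (Pq P) := by
    rw [eul_eq_sum false 0 1 (N := 2)]
    · simp [Finset.sum_range_succ, jv, ndx_apply]
      ring
    · intro j hj
      have h0 : j ≠ 0 := by omega
      have h1 : j ≠ 1 := by omega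
      rw [hPe]
      simp [jv, Derivation.leibniz, h0, h1, hL _, hM _, hF _]
  have EU := eul_zero_eq_dt_eul_one h true hu
  have EH := eul_zero_eq_dt_eul_one h false hh
  rw [eu0, eu1, pu0, pp0, pr0] at EU
  rw [eh0, eh1, ph0, pq0] at EH
  -- the coefficient of `uₓₓₓ` in the second equation
  have h1 : L * Pq F = 0 := by
    have e := EH
    simp only [map_add, map_sub, Derivation.leibniz, smul_eq_mul, hL.dx₀, hM.dx₀, hM.dt₀,
      (hF.pdA (.h 0 1)).dxF, dx_coord, cx] at e
    have e' := congrArg (pdA (.u 0 3)) e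
    simp [Derivation.leibniz, hL _, hM _, hF _, (hL.pdA _) _, (hM.pdA _) _, (hF.pdA _) _,
      ((hF.pdA _).pdA _) _] at e'
    exact e'
  have EH1 : Ph L * (coord _ (.u 1 0) + Xu * Xp + Xq - F * Xr) - L * Ph F * Xr
      + Ph M * (Xu * Xq + Xh * Xp) + M * Xp
      - (Px L + Xp * Pu L + Xq * Ph L) - (Px M + Xp * Pu M + Xq * Ph M) * Xu - M * Xp
      - Pt M - coord _ (.u 1 0) * Pu M = 0 := by
    rw [h1] at EH
    simp only [map_add, map_sub, Derivation.leibniz, smul_eq_mul, hL.dx₀, hM.dx₀, hM.dt₀, zero_mul,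
      map_zero, dx_coord, cx] at EH
    linear_combination EH
  -- In the h-equation, `h2`, `h4` and `h3` are the coefficients of uₜ, uₓₓ and uₓ, and `h5` is the
  -- rest.
  have h2 : Pu M = Ph L := by
    have e := congrArg (pdA (.u 1 0)) EH1
    simp [Derivation.leibniz, hL _, hM _, hF _, (hL.pdA _) _, (hM.pdA _) _, (hF.pdA _) _] at e
    linear_combination -e
  have h4 : L * Ph F + Ph L * F = 0 := by
    have e := congrArg (pdA (.u 0 2)) EH1
    simp [Derivation.leibniz, hL _, hM _, hF _, (hL.pdA _) _, (hM.pdA _) _, (hF.pdA _) _] at e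
    linear_combination -e
  have EH2 : Xp * (Xh * Ph M - Pu L) - (Px L + Xu * Px M + Pt M) = 0 := by
    linear_combination EH1 + Xr * h4 + (Xp * Xu + coord _ (.u 1 0)) * h2
  have h3 : Xh * Ph M = Pu L := by
    have e := congrArg Pp EH2
    simp [Derivation.leibniz, (hL.pdA _) _, (hM.pdA _) _] at e
    linear_combination e
  have h5 : Px L + Xu * Px M + Pt M = 0 := by
    linear_combination Xp * h3 - EH2
  -- By `h1` and `h4` the hₓ and hₓₓ terms drop out before the second Dₓ. The last term cancels
  -- against the same term in the uₓ-derivative of P, so no second derivatives of F arise.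
  have hLF : dx (L * F) = F * (Px L + Xp * Pu L) + L * Pp F * Xr := by
    rw [Derivation.leibniz, hL.dx₀, hF.dxF, smul_eq_mul, smul_eq_mul]
    linear_combination Xq * h4 + Xs * h1
  have EU1 : -(Pu L * F * Xr) - Xu * Px L - Xh * Px M - Pt L
      - (Xq * Ph F + Xr * Pp F + Xs * Pq F) * (Px L + Xp * Pu L)
      - F * (Px (Px L) + Xp * Pu (Px L) + Xq * Ph (Px L) + Xr * Pu L
        + Xp * (Px (Pu L) + Xp * Pu (Pu L) + Xq * Ph (Pu L))) = 0 := by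
    simp only [map_neg, hLF] at EU
    simp only [map_add, map_sub, Derivation.leibniz, smul_eq_mul, hL.dx₀, hM.dx₀, hL.dt₀,
      (hL.pdA .x).dx₀, (hL.pdA (.u 0 0)).dx₀, hF.dxF, dx_coord, cx] at EU
    linear_combination EU + (-coord _ (.h 1 0) - Xu * Xq) * h2 + Xq * h3
  have h6 : 2 * Pu L * F + Pp F * (Px L + Xp * Pu L) = 0 := by
    have e := congrArg (pdA (.u 0 2)) EU1
    simp [Derivation.leibniz, hF _, (hL.pdA _) _, (hM.pdA _) _, (hF.pdA _) _,
      ((hL.pdA _).pdA _) _] at e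
    linear_combination -e
  have h7 : Pq F * (Px L + Xp * Pu L) = 0 := by
    have e := congrArg (pdA (.h 0 2)) EU1
    simp [Derivation.leibniz, hF _, (hL.pdA _) _, (hM.pdA _) _, (hF.pdA _) _,
      ((hL.pdA _).pdA _) _] at e
    linear_combination e
  -- The x- and u-derivatives of `h4` remove the hₓ terms remaining in `EU1`.
  have hx4 : Px L * Ph F + Ph (Px L) * F = 0 := by
    have e := congrArg Px h4
    simp [Derivation.leibniz, hF _, (hF.pdA _) _] at e
    rw [pdA_comm .x] at e
    linear_combination e
  have hu4 : Pu L * Ph F + Ph (Pu L) * F = 0 := by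
    have e := congrArg Pu h4
    simp [Derivation.leibniz, hF _, (hF.pdA _) _] at e
    rw [pdA_comm (.u 0 0)] at e
    linear_combination e
  refine ⟨h1, h2, h3, h4, h5, h6, ?_⟩
  rw [pdA_comm .x (.u 0 0)] at EU1
  linear_combination -EU1 - Xr * h6 - Xs * h7 - Xq * hx4 - Xq * Xp * hu4

end SWSystem

/-! ### Solution of the determining equations -/

namespace DF

theorem isUnit_of_ev_ne_zero {f : DF D} (h : ∀ z, ev z f ≠ 0) : IsUnit f := by
  have hs : IsSmoothCyl D fun z => (f.toFun z)⁻¹ :=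
    f.isSmoothCyl_toFun.comp (φ := fun r : ℝ => r⁻¹) (U := {0}ᶜ)
      (fun r hr => (contDiffAt_inv ℝ hr).contDiffWithinAt)
      fun z hz => by rw [toFun_of_mem _ hz]; exact h _
  refine IsUnit.of_mul_eq_one (mk _ hs) (ext fun z => ?_)
  rw [map_mul, ev_mk, toFun_of_mem _ z.2, map_one]
  exact mul_inv_cancel₀ (h z)

@[simp] theorem pdA_two (v : JetVar) : pdA v (2 : DF D) = 0 := by
  rw [← Nat.cast_ofNat]; exact Derivation.map_natCast _ _

@[simp] theorem pdA_algebraMap (v : JetVar) (c : ℝ) : pdA v (algebraMap ℝ (DF D) c) = 0 :=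
  Derivation.map_algebraMap _ _

/-- The coordinates `t, x, u`. -/
abbrev coords₁ : Finset JetVar := {.t, .x, .u 0 0}

theorem Dep.eq_const (hD : IsPreconnected (D : Set Jet)) {A : Finset JetVar} {f : DF D}
    (hf : Dep A f) (h : ∀ v ∈ A, DF.pdA v f = 0) : ∃ c : ℝ, f = algebraMap ℝ (DF D) c :=
  exists_eq_algebraMap hD fun v => by
    by_cases hv : v ∈ A
    · exact h v hv
    · exact hf v hv

section Closure

variable {A : Finset JetVar} {f f' : DF D}

theorem Dep.add (hf : Dep A f) (hf' : Dep A f') : Dep A (f + f') := fun v hv => by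
  rw [map_add, hf v hv, hf' v hv, add_zero]

theorem Dep.sub (hf : Dep A f) (hf' : Dep A f') : Dep A (f - f') := fun v hv => by
  rw [map_sub, hf v hv, hf' v hv, sub_zero]

theorem Dep.mul (hf : Dep A f) (hf' : Dep A f') : Dep A (f * f') := fun v hv => by
  rw [Derivation.leibniz, hf v hv, hf' v hv, smul_zero, smul_zero, add_zero]

theorem Dep.pow (hf : Dep A f) (n : ℕ) : Dep A (f ^ n) := fun v hv => by
  rw [Derivation.leibniz_pow, hf v hv, smul_zero, smul_zero]

theorem Dep.mono {B : Finset JetVar} (hf : Dep A f) (h : A ⊆ B) : Dep B f :=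
  fun v hv => hf v fun hv' => hv (h hv')

theorem dep_algebraMap (c : ℝ) : Dep A (algebraMap ℝ (DF D) c) := fun v _ => pdA_algebraMap v c

theorem dep_coord {v : JetVar} (h : v ∈ A) : Dep A (coord D v) := fun w hw => by
  rw [pdA_coord, if_neg]
  rintro rfl
  exact hw h

end Closure

end DF

namespace SWSystem

open DF

variable {F L M φ g : DF D}

/-- The determining equations after the substitution `L = ℓ φ(h)`, `F = g(uₓ) / φ(h)`. -/
structure RedEqs (φ g ℓ M : DF D) : Prop where
  Mu : Pu M = ℓ * Ph φ
  Mh : Xh * Ph M = Pu ℓ * φ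
  uu : Xh * Ph (Ph φ) * ℓ = φ * Pu (Pu ℓ)
  mass : φ * Px ℓ + Xu * Px M + Pt M = 0
  visc : 2 * g * Pu ℓ + Pp g * (Px ℓ + Xp * Pu ℓ) = 0
  mom : φ * (Xu * Px ℓ + Pt ℓ) + Xh * Px M
    + g * (Px (Px ℓ) + 2 * Xp * Pu (Px ℓ) + Xp ^ 2 * Pu (Pu ℓ)) = 0
  momh : Ph φ * (Xu * Px ℓ + Pt ℓ) + Px M + φ * Pu (Px ℓ) = 0
  massh : Xh * Ph φ * Px ℓ + φ * (Xu * Pu (Px ℓ) + Pu (Pt ℓ)) = 0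

/-- As LF = ℓg, the equation (LF)_h = 0 makes ℓ independent of h. Of the added equations, `uu`
equates the mixed derivatives of M in u and h; `momh` and `massh` are h-derivatives of `mom` and
`mass` (the latter times h) with h M_h eliminated. -/
theorem DetEqs.reduce (h : DetEqs F L M) (hL : Dep coords₀ L) (hF : IsUnit F) (hφ : IsUnit φ)
    (hφd : Dep {.h 0 0} φ) (hgd : Dep {.u 0 1} g) (hg : F * φ = g) :
    ∃ ℓ : DF D, L = ℓ * φ ∧ Dep coords₁ ℓ ∧ RedEqs φ g ℓ M := by
  obtain ⟨ℓ, rfl⟩ : ∃ ℓ, L = ℓ * φ := by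
    obtain ⟨ψ, hψ⟩ := hφ.exists_left_inv
    exact ⟨L * ψ, by rw [mul_assoc, hψ, mul_one]⟩
  obtain ⟨-, e2, e3, e4, e5, e6, e7⟩ := h
  have hℓ : Dep coords₁ ℓ := by
    intro v hv
    by_cases hvh : v = .h 0 0
    · subst hvh
      have e := congrArg Ph hg
      simp only [Derivation.leibniz, smul_eq_mul, hgd (.h 0 0) (by simp)] at e
      simp only [Derivation.leibniz, smul_eq_mul] at e4
      refine (hF.mul hφ).mul_right_eq_zero.1 ?_
      linear_combination e4 - ℓ * e
    · have e := hL v (by simp_all)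
      simp only [Derivation.leibniz, smul_eq_mul, hφd v (by simp_all), mul_zero, zero_add] at e
      exact hφ.mul_right_eq_zero.1 e
  have r2 : Pu M = ℓ * Ph φ := by
    rw [e2]; simp [Derivation.leibniz, hℓ _]
  have r3 : Xh * Ph M = Pu ℓ * φ := by
    rw [e3]; simp [Derivation.leibniz, hφd _]; ring
  have r5 : φ * Px ℓ + Xu * Px M + Pt M = 0 := by
    rw [← e5]; simp [Derivation.leibniz, hφd _]
  have r6 : 2 * g * Pu ℓ + Pp g * (Px ℓ + Xp * Pu ℓ) = 0 := by
    rw [← hg]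
    simp [Derivation.leibniz, hφd _] at e6 ⊢
    linear_combination e6
  have r7 : φ * (Xu * Px ℓ + Pt ℓ) + Xh * Px M
      + g * (Px (Px ℓ) + 2 * Xp * Pu (Px ℓ) + Xp ^ 2 * Pu (Pu ℓ)) = 0 := by
    rw [← hg]
    simp [Derivation.leibniz, hφd _] at e7
    linear_combination e7
  have ruu : Xh * Ph (Ph φ) * ℓ = φ * Pu (Pu ℓ) := by
    have a := congrArg Ph r2
    have b := congrArg Pu r3
    simp [Derivation.leibniz, hφd _, hℓ _] at a b
    rw [pdA_comm] at a
    linear_combination b - Xh * a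
  have rx : Xh * Ph (Px M) = Pu (Px ℓ) * φ := by
    have a := congrArg Px r3
    simp [Derivation.leibniz, hφd _] at a
    rw [pdA_comm, pdA_comm (.u 0 0)]
    linear_combination a
  have rt : Xh * Ph (Pt M) = Pu (Pt ℓ) * φ := by
    have a := congrArg Pt r3
    simp [Derivation.leibniz, hφd _] at a
    rw [pdA_comm, pdA_comm (.u 0 0)]
    linear_combination a
  refine ⟨ℓ, rfl, hℓ, r2, r3, ruu, r5, r6, r7, ?_, ?_⟩
  · have a := congrArg Ph r7
    simp [Derivation.leibniz, hgd _, (hℓ.pdA _) _, ((hℓ.pdA _).pdA _) _] at a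
    linear_combination a - rx
  · have a := congrArg Ph r5
    simp [Derivation.leibniz, (hℓ.pdA _) _] at a
    linear_combination Xh * a - Xu * rx - rt

/-- The logarithm of `h`. -/
def lnH (S : SWSystem) {W : Set (ℝ × ℝ × ℝ)} (hW : IsOpen W) : DF (S.domO hW) :=
  DF.mk (fun z => Real.log (z (.h 0 0))) <|
    (IsSmoothCyl.coord (.h 0 0)).comp (φ := Real.log) (U := {0}ᶜ) Real.contDiffOn_log
      fun _ hz => (S.pos_of_mem _ hz.2.1).ne'

variable (S : SWSystem) {W : Set (ℝ × ℝ × ℝ)} (hW : IsOpen W)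

theorem dep_lnH : Dep {.h 0 0} (S.lnH hW) := fun v hv =>
  pdA_mk_eq_zero _ fun z s => by
    rw [Function.update_of_ne]
    simpa [eq_comm] using hv

theorem h_mul_pdA_lnH : Xh * Ph (S.lnH hW) = 1 := DF.ext fun z => by
  have hz : (z : Jet) (.h 0 0) ≠ 0 := (S.pos_of_mem _ z.2.2.1).ne'
  have : ev z (Ph (S.lnH hW)) = ((z : Jet) (.h 0 0))⁻¹ := ev_pdA_mk _ (by
    simpa using Real.hasDerivAt_log hz)
  rw [map_mul, this, ev_coord, map_one, mul_inv_cancel₀ hz]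

theorem isUnit_h : IsUnit (Xh : DF (S.domO hW)) :=
  isUnit_of_ev_ne_zero fun z => (S.pos_of_mem _ z.2.2.1).ne'

/-- The general solution of the determining equations for `F = g(uₓ) / (α h + β)`. -/
theorem RedEqs.solve {S : SWSystem} {hW : IsOpen W} (hW' : IsConnected W) {α β : ℝ}
    {g ℓ M φ : DF (S.domO hW)} (hφe : φ = algebraMap ℝ _ α * Xh + algebraMap ℝ _ β)
    (hφ : IsUnit φ) (hgd : Dep {.u 0 1} g) (hℓ : Dep coords₁ ℓ) (hM : Dep coords₀ M)
    (h : RedEqs φ g ℓ M) :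
    ∃ c d e k : ℝ, β * e = 0 ∧ algebraMap ℝ _ d * (2 * g + Xp * Pp g) = 0 ∧
      ℓ = algebraMap ℝ _ c + algebraMap ℝ _ e * Xt + algebraMap ℝ _ d * Xu ∧
      M = algebraMap ℝ _ α * (algebraMap ℝ _ c * Xu + algebraMap ℝ _ e * (Xt * Xu - Xx)
        + algebraMap ℝ _ 2⁻¹ * algebraMap ℝ _ d * Xu ^ 2)
        + algebraMap ℝ _ d * (algebraMap ℝ _ α * Xh + algebraMap ℝ _ β * S.lnH hW)
        + algebraMap ℝ _ k := by
  have hpre := S.isPreconnected_domO hW hW'.isPreconnected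
  obtain ⟨z₀⟩ := S.nonempty_domO hW hW'.nonempty
  set a : DF (S.domO hW) := algebraMap ℝ _ α with ha
  set b : DF (S.domO hW) := algebraMap ℝ _ β with hb
  have da : ∀ v, pdA v a = 0 := fun v => pdA_algebraMap v α
  have db : ∀ v, pdA v b = 0 := fun v => pdA_algebraMap v β
  have two : IsUnit (2 : DF (S.domO hW)) := isUnit_of_ev_ne_zero fun z => by
    rw [map_ofNat]; exact two_ne_zero
  have hφh : Ph φ = a := by rw [hφe]; simp [Derivation.leibniz, da, db]
  have hφd : Dep {.h 0 0} φ := fun v hv => by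
    rw [hφe]; simp [Derivation.leibniz, da, db]; simp at hv; simp [hv]
  obtain ⟨r2, r3, ruu, r5, r6, r7, r7h, r5h⟩ := h
  rw [hφh] at r2 ruu r7h r5h
  have uu : Pu (Pu ℓ) = 0 := hφ.mul_right_eq_zero.1 (by rw [← ruu, da]; ring)
  -- The h-derivative of `momh`, times h, reads (2αh + β) ℓₓᵤ = 0; a further h-derivative separates
  -- α from β.
  have ux : Pu (Px ℓ) = 0 := by
    have e1 := congrArg Ph r7h
    have rx := congrArg Px r3
    simp [Derivation.leibniz, da, hφh, hφd _, (hℓ.pdA _) _, ((hℓ.pdA _).pdA _) _] at e1 rx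
    rw [pdA_comm, pdA_comm .x (.u 0 0)] at rx
    have e2 : (2 * a * Xh + b) * Pu (Px ℓ) = 0 := by
      linear_combination Xh * e1 - rx - Pu (Px ℓ) * hφe
    have e3 := congrArg Ph e2
    simp [Derivation.leibniz, da, db, ((hℓ.pdA _).pdA _) _] at e3
    have e4 : a * Pu (Px ℓ) = 0 := two.mul_right_eq_zero.1 (by linear_combination e3)
    exact hφ.mul_right_eq_zero.1 (by linear_combination e2 - Xh * e4 + Pu (Px ℓ) * hφe)
  -- The u-derivative of `momh` with M_u = αℓ, and the h-derivative of `massh`, give two equations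
  -- whose difference is αℓₓ = 0.
  have axut : a * (2 * Px ℓ + Pu (Pt ℓ)) = 0 := by
    have e1 := congrArg Pu r7h
    have e2 := congrArg Px r2
    simp [Derivation.leibniz, da, ux] at e1 e2
    rw [pdA_comm] at e2
    linear_combination e1 - e2
  have axut' : a * (Px ℓ + Pu (Pt ℓ)) = 0 := by
    have e1 := congrArg Ph r5h
    simp [Derivation.leibniz, da, ux, hφh, (hℓ.pdA _) _, ((hℓ.pdA _).pdA _) _] at e1
    linear_combination e1
  have ax : a * Px ℓ = 0 := by linear_combination axut - axut'
  have ut : Pu (Pt ℓ) = 0 := hφ.mul_right_eq_zero.1 (by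
    linear_combination r5h - Xh * ax - φ * Xu * ux)
  -- The u-derivative of `mom` is φℓₓ + αhℓₓ = 0, whose second term is already zero.
  have hx : Px ℓ = 0 := by
    have e1 := congrArg Pu r7
    have e2 := congrArg Px r2
    have e3 : Pu (Px (Px ℓ)) = 0 := by rw [pdA_comm, ux, map_zero]
    simp [Derivation.leibniz, da, ux, ut, uu, e3, hφd _, hgd _] at e1 e2
    rw [pdA_comm] at e2
    refine hφ.mul_right_eq_zero.1 ?_
    rw [e2] at e1
    linear_combination e1 - Xh * ax
  have Mx : Px M = -(a * Pt ℓ) := by linear_combination r7h - a * Xu * hx - φ * ux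
  -- With M_x = -αℓₜ, `mom` becomes (φ - αh) ℓₜ = 0.
  have hbt : b * Pt ℓ = 0 := by
    rw [hx, uu] at r7
    simp at r7
    linear_combination r7 - Xh * Mx - Pt ℓ * hφe
  have Mt : Pt M = a * Xu * Pt ℓ := by linear_combination r5 - φ * hx - Xu * Mx
  have tx : Px (Pt ℓ) = 0 := by rw [pdA_comm, hx, map_zero]
  -- Equality of the mixed derivatives of M in t and x gives αℓₜₜ = 0, and βℓₜₜ = 0 follows from
  -- `hbt`.
  have tt : Pt (Pt ℓ) = 0 := by
    have e1 := congrArg Px Mt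
    have e2 := congrArg Pt Mx
    have e3 := congrArg Pt hbt
    simp [Derivation.leibniz, da, db, tx] at e1 e2 e3
    rw [pdA_comm, e2] at e1
    refine hφ.mul_right_eq_zero.1 ?_
    linear_combination -Xh * e1 + e3 + Pt (Pt ℓ) * hφe
  obtain ⟨e, he⟩ := (hℓ.pdA .t).eq_const hpre (by simp [tt, tx, ut])
  have tu : Pt (Pu ℓ) = 0 := by rw [pdA_comm, ut]
  have xu : Px (Pu ℓ) = 0 := by rw [pdA_comm, ux]
  obtain ⟨d, hd⟩ := (hℓ.pdA (.u 0 0)).eq_const hpre (by simp [tu, xu, uu])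
  obtain ⟨c, hc⟩ := ((hℓ.sub ((dep_algebraMap e).mul (dep_coord (v := .t) (by simp)))).sub
    ((dep_algebraMap d).mul (dep_coord (v := .u 0 0) (by simp)))).eq_const hpre (by
      simp [Derivation.leibniz, he, hx, hd])
  have hℓe : ℓ = algebraMap ℝ _ c + algebraMap ℝ _ e * Xt + algebraMap ℝ _ d * Xu := by
    rw [← hc]; ring
  have hlog := S.h_mul_pdA_lnH hW
  have hhalf : (2 : DF (S.domO hW)) * algebraMap ℝ _ 2⁻¹ = 1 := by
    rw [← map_ofNat (algebraMap ℝ (DF (S.domO hW))) 2, ← map_mul]; norm_num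
  -- The subtracted expression is a primitive of the four known derivatives of M; the logarithm
  -- comes from h M_h = dφ.
  obtain ⟨k, hk⟩ : ∃ k, M - (a * (algebraMap ℝ _ c * Xu + algebraMap ℝ _ e * (Xt * Xu - Xx)
        + algebraMap ℝ _ 2⁻¹ * algebraMap ℝ _ d * Xu ^ 2)
        + algebraMap ℝ _ d * (a * Xh + b * S.lnH hW)) = algebraMap ℝ _ k := by
    refine Dep.eq_const (A := coords₀) hpre ?_ ?_
    · refine hM.sub (((dep_algebraMap α).mul ((((dep_algebraMap c).mul (dep_coord (by simp))).add
        ((dep_algebraMap e).mul (((dep_coord (by simp)).mul (dep_coord (by simp))).sub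
          (dep_coord (by simp))))).add (((dep_algebraMap _).mul (dep_algebraMap d)).mul
          ((dep_coord (by simp)).pow 2)))).add ((dep_algebraMap d).mul
          (((dep_algebraMap α).mul (dep_coord (by simp))).add
          ((dep_algebraMap β).mul ((S.dep_lnH hW).mono (by simp))))))
    · intro v hv
      simp only [coords₀, Finset.mem_insert, Finset.mem_singleton] at hv
      rcases hv with rfl | rfl | rfl | rfl
      · simp [Derivation.leibniz, Derivation.leibniz_pow, da, db, S.dep_lnH hW _, Mt, he]
        ring
      · simp [Derivation.leibniz, Derivation.leibniz_pow, da, db, S.dep_lnH hW _, Mx, he]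
      · simp [Derivation.leibniz, Derivation.leibniz_pow, da, db, S.dep_lnH hW _, r2, hℓe]
        linear_combination (-a * algebraMap ℝ _ d * Xu) * hhalf
      · refine (S.isUnit_h hW).mul_right_eq_zero.1 ?_
        simp [Derivation.leibniz, Derivation.leibniz_pow, da, db]
        rw [hd] at r3
        linear_combination r3 + algebraMap ℝ _ d * hφe - algebraMap ℝ _ d * b * hlog
  refine ⟨c, d, e, k, ?_, ?_, hℓe, ?_⟩
  · rw [he, ← map_mul] at hbt
    simpa using congrArg (ev z₀) hbt
  · rw [hx, hd] at r6
    linear_combination r6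
  · rw [← hk]; ring

end SWSystem

/-! ### Systems with an additional conservation law -/

namespace SWSystem

open DF

/-- `F = g(uₓ) / (α h + β)`, where `g` is smooth and nowhere zero. -/
structure IsAffine (S : SWSystem) (α β : ℝ) (g : ℝ → ℝ) : Prop where
  ne : ∀ y ∈ S.I, α * y + β ≠ 0
  smooth : ContDiffOn ℝ ∞ g S.J
  g_ne : ∀ p ∈ S.J, g p ≠ 0
  F_eq : ∀ y ∈ S.I, ∀ p ∈ S.J, ∀ q ∈ S.K, S.F y p q = g p / (α * y + β)

variable (S : SWSystem) {W : Set (ℝ × ℝ × ℝ)} (hW : IsOpen W)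

theorem isUnit_FF : IsUnit (S.FF hW) :=
  isUnit_of_ev_ne_zero fun z => S.F_ne_zero _ z.2.2.1 _ z.2.2.2.1 _ z.2.2.2.2

theorem ordConnected_update {v : JetVar} (hv : v = .h 0 0 ∨ v = .u 0 1 ∨ v = .h 0 1) :
    ∀ z ∈ S.domO hW, OrdConnected {s | Function.update z v s ∈ S.domO hW} := by
  rintro z ⟨h1, h2, h3, h4⟩
  simp only [mem_domO]
  rcases hv with rfl | rfl | rfl
  · simpa [h1, h3, h4] using S.ordConnected_I
  · simpa [h1, h2, h4] using S.ordConnected_J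
  · simpa [h1, h2, h3] using S.ordConnected_K

/-- Components of the map that freezes `(t, x, u)` at `w`. -/
def baseMap (w : ℝ × ℝ × ℝ) : JetVar → DF (S.domO hW)
  | .t => algebraMap ℝ _ w.1
  | .x => algebraMap ℝ _ w.2.1
  | .u 0 0 => algebraMap ℝ _ w.2.2
  | v => coord _ v

theorem evJet_baseMap (w : ℝ × ℝ × ℝ) (z : S.domO hW) : evJet (S.baseMap hW w) z =
    jetWith w ((z : Jet) (.h 0 0)) ((z : Jet) (.u 0 1)) ((z : Jet) (.h 0 1)) z := by
  funext v
  simp only [evJet, baseMap, jetWith]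
  split <;> first | (simp; done) | (split <;> simp_all)

theorem evJet_baseMap_mem {w : ℝ × ℝ × ℝ} (hw : w ∈ W) (z : S.domO hW) :
    evJet (S.baseMap hW w) z ∈ S.domO hW := by
  rw [evJet_baseMap]
  exact S.jetWith_mem hW _ hw z.2.2.1 z.2.2.2.1 z.2.2.2.2

theorem evJet_baseMap_self (z : S.domO hW) :
    evJet (S.baseMap hW ((z : Jet) .t, (z : Jet) .x, (z : Jet) (.u 0 0))) z = z := by
  rw [evJet_baseMap, jetWith_self]

theorem pdA_baseMap_of_mem {v : JetVar} (hv : v ∈ coords₁) (w : ℝ × ℝ × ℝ) (v' : JetVar) :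
    pdA v (S.baseMap hW w v') = 0 := by
  simp only [coords₁, Finset.mem_insert, Finset.mem_singleton] at hv
  unfold baseMap
  split
  · simp
  · simp
  · simp
  · rw [pdA_coord, if_neg]
    rintro rfl
    simp_all

theorem pdA_baseMap_of_notMem {v : JetVar} (hv : v ∉ coords₁) (w : ℝ × ℝ × ℝ) (v' : JetVar) :
    pdA v (S.baseMap hW w v') = if v = v' then 1 else 0 := by
  simp only [coords₁, Finset.mem_insert, Finset.mem_singleton, not_or] at hv
  unfold baseMap
  split
  · rw [if_neg hv.1, pdA_algebraMap]
  · rw [if_neg hv.2.1, pdA_algebraMap]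
  · rw [if_neg hv.2.2, pdA_algebraMap]
  · rw [pdA_coord]

/-! ### Freezing the coordinates t, x, u -/

variable {w : ℝ × ℝ × ℝ} (hw : w ∈ W)

/-- Freezing `(t, x, u)` at `w`. -/
abbrev freeze : DF (S.domO hW) →ₐ[ℝ] DF (S.domO hW) :=
  pullHom (S.baseMap hW w) (S.evJet_baseMap_mem hW hw)

theorem pdA_freeze_of_mem {v : JetVar} (hv : v ∈ coords₁) (f : DF (S.domO hW)) :
    pdA v (S.freeze hW hw f) = 0 := by
  obtain ⟨A, hA⟩ := f.exists_finset_pdA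
  rw [pdA_pullHom _ _ hA]
  simp [S.pdA_baseMap_of_mem hW hv]

theorem pdA_freeze_of_notMem {v : JetVar} (hv : v ∉ coords₁) (f : DF (S.domO hW)) :
    pdA v (S.freeze hW hw f) = S.freeze hW hw (pdA v f) := by
  obtain ⟨A, hA⟩ := f.exists_finset_pdA
  rw [pdA_pullHom _ _ (A := insert v A) fun w hw => hA w fun h => hw (Finset.mem_insert_of_mem h)]
  simp [S.pdA_baseMap_of_notMem hW hv]

/-- All partial derivatives of the frozen function vanish, so connectedness of the whole domain
suffices; no slice of `W` has to be connected. -/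
theorem freeze_const (hW' : IsConnected W) {f : DF (S.domO hW)} (hf : Dep coords₁ f) :
    ∃ c : ℝ, S.freeze hW hw f = algebraMap ℝ _ c :=
  exists_eq_algebraMap (S.isPreconnected_domO hW hW'.isPreconnected) fun v => by
    by_cases hv : v ∈ coords₁
    · exact S.pdA_freeze_of_mem hW hw hv f
    · rw [S.pdA_freeze_of_notMem hW hw hv, hf v hv, map_zero]

theorem freeze_of_dep {f : DF (S.domO hW)}
    (hf : ∀ z z' : S.domO hW, (z : Jet) (.h 0 0) = (z' : Jet) (.h 0 0) →
      (z : Jet) (.u 0 1) = (z' : Jet) (.u 0 1) → (z : Jet) (.h 0 1) = (z' : Jet) (.h 0 1) →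
      ev z f = ev z' f) : S.freeze hW hw f = f := DF.ext fun z => by
  rw [ev_pullHom]
  exact hf _ _ rfl rfl rfl

theorem freeze_FF : S.freeze hW hw (S.FF hW) = S.FF hW :=
  S.freeze_of_dep hW hw fun z z' h1 h2 h3 => by rw [ev_FF, ev_FF, h1, h2, h3]

theorem freeze_coord {v : JetVar} (hv : v ∉ coords₁) :
    S.freeze hW hw (coord _ v) = coord _ v := by
  simp only [coords₁, Finset.mem_insert, Finset.mem_singleton, not_or] at hv
  rw [pullHom_coord]
  unfold baseMap
  split <;> simp_all

/-- If `L = ℓ φ(h)` is the first multiplier, then `φ` is affine. -/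
theorem RedEqs.pdA_pdA_eq_zero {S : SWSystem} {hW : IsOpen W} (hW' : IsConnected W)
    {φ g ℓ M : DF (S.domO hW)} (h : RedEqs φ g ℓ M) (hφ : IsUnit φ) (hg : IsUnit g)
    (hφd : Dep {.h 0 0} φ) (hℓ : Dep coords₁ ℓ)
    (hw : w ∈ W) (hφw : S.freeze hW hw φ = φ) (hℓw : S.freeze hW hw ℓ = 1)
    (hφw' : ∀ {w'} (hw' : w' ∈ W), S.freeze hW hw' φ = φ) :
    Ph (Ph φ) = 0 := by
  obtain ⟨r2, r3, ruu, r5, r6, r7, r7h, r5h⟩ := h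
  obtain ⟨z₀⟩ := S.nonempty_domO hW hW'.nonempty
  have hh : IsUnit (Xh : DF (S.domO hW)) := S.isUnit_h hW
  obtain ⟨κ, hκ⟩ := S.freeze_const hW hw hW' ((hℓ.pdA (.u 0 0)).pdA (.u 0 0))
  have frφ : ∀ {w'} (hw' : w' ∈ W), S.freeze hW hw' (Ph φ) = Ph φ := fun hw' => by
    rw [← S.pdA_freeze_of_notMem hW hw' (by simp), hφw']
  have frφ' : ∀ {w'} (hw' : w' ∈ W), S.freeze hW hw' (Ph (Ph φ)) = Ph (Ph φ) := fun hw' => by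
    rw [← S.pdA_freeze_of_notMem hW hw' (by simp), frφ]
  set k : DF (S.domO hW) := algebraMap ℝ _ κ with hk
  have dk : ∀ v, pdA v k = 0 := fun v => pdA_algebraMap v κ
  -- Separation of variables in `uu`: where ℓ is frozen to 1 this gives hφ'' = kφ, and then ℓᵤᵤ = kℓ
  -- everywhere.
  have hφ2 : Xh * Ph (Ph φ) = k * φ := by
    have e := congrArg (S.freeze hW hw) ruu
    simp only [map_mul, hℓw, hφw, frφ' hw, S.freeze_coord hW hw (v := .h 0 0) (by simp), hκ] at e
    linear_combination e
  have uu : Pu (Pu ℓ) = k * ℓ := by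
    have e : φ * (Pu (Pu ℓ) - k * ℓ) = 0 := by linear_combination ℓ * hφ2 - ruu
    linear_combination hφ.mul_right_eq_zero.1 e
  suffices hk0 : k = 0 by
    exact hh.mul_right_eq_zero.1 (by rw [hφ2, hk0, zero_mul])
  have hk0 : k ^ 2 = 0 → k = 0 := fun e => by
    have e' := congrArg (ev z₀) e
    rw [map_pow, hk, AlgHom.commutes, map_zero] at e'
    have : κ = 0 := by simpa using e'
    rw [hk, this, map_zero]
  have two : IsUnit (2 : DF (S.domO hW)) := isUnit_of_ev_ne_zero fun z => by
    rw [map_ofNat]; exact two_ne_zero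
  have ii : Ph φ * (2 * Px ℓ + Xu * Pu (Px ℓ) + Pu (Pt ℓ)) + k * φ * Px ℓ = 0 := by
    have e1 := congrArg Pu r7h
    have e2 := congrArg Px r2
    have e3 := congrArg Px uu
    simp [Derivation.leibniz, dk, hφd _, (hφd.pdA _) _] at e1 e2 e3
    rw [pdA_comm] at e2 e3
    rw [pdA_comm .x] at e3
    linear_combination e1 - e2 - φ * e3
  -- Eliminating ℓₓᵤ and ℓₜᵤ between `ii` and `massh` leaves ℓₓ times an expression in h alone.
  have hR : Px ℓ * (2 * φ * Ph φ - Xh * Ph φ ^ 2 + k * φ ^ 2) = 0 := by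
    linear_combination φ * ii - Ph φ * r5h
  -- If ℓₓ = 0, then kℓₜ and kM_x vanish, and k times `mom` becomes g k² uₓ² ℓ = 0. Freezing, then
  -- differentiating twice in uₓ, gives k² = 0.
  by_cases hx : Px ℓ = 0
  · have ux : Pu (Px ℓ) = 0 := by rw [hx, map_zero]
    have kt : k * Pt ℓ = 0 := by
      have e1 := congrArg Ph r7h
      have e2 := congrArg Px r3
      simp [Derivation.leibniz, hx, (hℓ.pdA _) _, hφd _] at e1 e2
      rw [pdA_comm, pdA_comm .x, hx] at e2
      simp at e2
      refine hφ.mul_right_eq_zero.1 ?_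
      linear_combination Xh * e1 - e2 - Pt ℓ * hφ2
    have e : g * (k ^ 2 * Xp ^ 2 * ℓ) = 0 := by
      rw [ux, hx, uu] at r7
      rw [ux, hx] at r7h
      simp at r7 r7h
      linear_combination k * r7 - k * Xh * r7h - φ * kt + Xh * Ph φ * kt
    have e1 := congrArg (S.freeze hW hw) (hg.mul_right_eq_zero.1 e)
    rw [map_mul, map_mul, map_pow, map_pow, hk, AlgHom.commutes, ← hk, hℓw,
      S.freeze_coord hW hw (by simp), map_zero, mul_one] at e1
    have e2 := congrArg Pp (congrArg Pp e1)
    simp [Derivation.leibniz, Derivation.leibniz_pow, dk] at e2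
    exact hk0 (two.mul_right_eq_zero.1 (by linear_combination e2))
  · obtain ⟨z₁, hz₁⟩ : ∃ z, ev z (Px ℓ) ≠ 0 := by
      by_contra! hall
      exact hx (DF.ext fun z => by rw [hall z, map_zero])
    have hw₁ : ((z₁ : Jet) .t, (z₁ : Jet) .x, (z₁ : Jet) (.u 0 0)) ∈ W := z₁.2.1
    obtain ⟨m, hm⟩ := S.freeze_const hW hw₁ hW' (hℓ.pdA .x)
    have hm0 : m ≠ 0 := by
      have e := congrArg (ev z₁) hm
      rw [ev_pullHom, AlgHom.commutes] at e
      have hz : (⟨_, S.evJet_baseMap_mem hW hw₁ z₁⟩ : S.domO hW) = z₁ :=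
        Subtype.ext (S.evJet_baseMap_self hW z₁)
      rw [hz] at e
      exact fun h0 => hz₁ (by rw [e, h0]; simp)
    have hmu : IsUnit (algebraMap ℝ (DF (S.domO hW)) m) := (IsUnit.mk0 m hm0).map _
    -- Freezing where ℓₓ ≠ 0 gives a first-order equation for φ. With its derivative and hφ'' = kφ
    -- it yields 2φ' = -3kφ, and substituting back, 4k = 9k²h. As h varies, k² = 0.
    have R0 : 2 * φ * Ph φ - Xh * Ph φ ^ 2 + k * φ ^ 2 = 0 := by
      have e := congrArg (S.freeze hW hw₁) hR
      simp only [map_mul, map_add, map_sub, map_pow, hm, map_ofNat, hφw' hw₁, frφ hw₁,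
        S.freeze_coord hW hw₁ (v := .h 0 0) (by simp), hk, AlgHom.commutes, map_zero] at e
      exact hmu.mul_right_eq_zero.1 e
    have R1 : Ph φ ^ 2 + 2 * φ * Ph (Ph φ) = 0 := by
      have e := congrArg Ph R0
      simp [Derivation.leibniz, Derivation.leibniz_pow, dk] at e
      linear_combination e + 2 * Ph φ * hφ2
    have R2 : 2 * Ph φ + 3 * k * φ = 0 := hφ.mul_right_eq_zero.1 (by
      linear_combination R0 + Xh * R1 - 2 * φ * hφ2)
    have R3 : 2 * Ph (Ph φ) + 3 * k * Ph φ = 0 := by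
      have e := congrArg Ph R2
      have h3 : (3 : DF (S.domO hW)) = 2 + 1 := by norm_num
      simp [h3, Derivation.leibniz, dk] at e
      linear_combination e
    have R4 : 4 * k - 9 * k ^ 2 * Xh = 0 := hφ.mul_right_eq_zero.1 (by
      linear_combination 2 * Xh * R3 - 4 * hφ2 - 3 * k * Xh * R2)
    have R5 : 9 * k ^ 2 = 0 := by
      have h9 : (9 : DF (S.domO hW)) = 2 * 2 * 2 + 1 := by norm_num
      have h4 : (4 : DF (S.domO hW)) = 2 * 2 := by norm_num
      have e := congrArg Ph R4
      simp [h9, h4, Derivation.leibniz, Derivation.leibniz_pow, dk] at e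
      linear_combination e
    have nine : IsUnit (9 : DF (S.domO hW)) := isUnit_of_ev_ne_zero fun z => by
      rw [map_ofNat]; exact OfNat.ofNat_ne_zero 9
    exact hk0 (nine.mul_right_eq_zero.1 R5)

theorem jetWith_update_h (w : ℝ × ℝ × ℝ) (y y' p q : ℝ) (z : Jet) :
    jetWith w y' p q z = Function.update (jetWith w y p q z) (.h 0 0) y' := by
  funext v
  by_cases hv : v = .h 0 0
  · subst hv; simp [jetWith]
  · rw [Function.update_of_ne hv]
    unfold jetWith
    split <;> simp_all

theorem jetWith_update_q (w : ℝ × ℝ × ℝ) (y p q q' : ℝ) (z : Jet) :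
    jetWith w y p q' z = Function.update (jetWith w y p q z) (.h 0 1) q' := by
  funext v
  by_cases hv : v = .h 0 1
  · subst hv; simp [jetWith]
  · rw [Function.update_of_ne hv]
    unfold jetWith
    split <;> simp_all

/-- If a system admits a multiplier with nonzero first component, then `F = g(uₓ) / (α h + β)`. -/
theorem exists_isAffine {S : SWSystem} {hW : IsOpen W} (hW' : IsConnected W)
    {L M : DF (S.domO hW)} (h : DetEqs (S.FF hW) L M) (hL : Dep coords₀ L)
    (hLpt : ∀ z z' : S.domO hW, (z : Jet) .t = (z' : Jet) .t → (z : Jet) .x = (z' : Jet) .x →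
      (z : Jet) (.u 0 0) = (z' : Jet) (.u 0 0) → (z : Jet) (.h 0 0) = (z' : Jet) (.h 0 0) →
      ev z L = ev z' L) (hL0 : L ≠ 0) : ∃ α β g, S.IsAffine α β g := by
  obtain ⟨z₀, hz₀⟩ : ∃ z, ev z L ≠ 0 := by
    by_contra! hall
    exact hL0 (DF.ext fun z => by rw [hall z, map_zero])
  have hw : ((z₀ : Jet) .t, (z₀ : Jet) .x, (z₀ : Jet) (.u 0 0)) ∈ W := z₀.2.1
  have hpre := S.isPreconnected_domO hW hW'.isPreconnected
  -- Freezing L at a point where it is nonzero makes the factor ℓ = L/φ equal to 1 at that (t, x,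
  -- u).
  set φ := S.freeze hW hw L with hφdef
  set g := S.FF hW * φ with hgdef
  have evφ : ∀ z z' : S.domO hW, (z : Jet) (.h 0 0) = (z' : Jet) (.h 0 0) → ev z φ = ev z' φ :=
    fun z z' hz => by
      rw [hφdef, ev_pullHom, ev_pullHom]
      exact hLpt _ _ rfl rfl rfl hz
  have hφd : Dep {.h 0 0} φ := fun v hv => by
    by_cases hv' : v ∈ coords₁
    · exact S.pdA_freeze_of_mem hW hw hv' L
    · rw [S.pdA_freeze_of_notMem hW hw hv', hL v, map_zero]
      simp_all
  have hgh : Ph g = 0 := by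
    have e := congrArg (S.freeze hW hw) h.LF
    rw [map_add, map_mul, map_mul, ← S.pdA_freeze_of_notMem hW hw (by simp), freeze_FF,
      ← S.pdA_freeze_of_notMem hW hw (by simp), map_zero] at e
    rw [hgdef, Derivation.leibniz, smul_eq_mul, smul_eq_mul]
    linear_combination e
  -- Since `g` is independent of h, its value is unchanged when h is moved to its value at `z₀`,
  -- where φ is nonzero. This also makes φ nonzero everywhere.
  have hgu : IsUnit g := isUnit_of_ev_ne_zero fun z => by
    have hz' : Function.update (z : Jet) (.h 0 0) ((z₀ : Jet) (.h 0 0)) ∈ S.domO hW := by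
      have := z.2
      rw [mem_domO] at this ⊢
      simpa [this.1, this.2.2.1, this.2.2.2] using z₀.2.2.1
    rw [← ev_eq_of_update hgh (S.ordConnected_update hW (Or.inl rfl)) (z' := ⟨_, hz'⟩) rfl, hgdef,
      map_mul]
    refine mul_ne_zero (S.F_ne_zero _ hz'.2.1 _ hz'.2.2.1 _ hz'.2.2.2) ?_
    rw [evφ ⟨_, hz'⟩ z₀ (by simp), hφdef, ev_pullHom]
    have hz : (⟨_, S.evJet_baseMap_mem hW hw z₀⟩ : S.domO hW) = z₀ :=
      Subtype.ext (S.evJet_baseMap_self hW z₀)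
    rwa [hz]
  have hφu : IsUnit φ := isUnit_of_mul_isUnit_right hgu
  have hFq : Pq (S.FF hW) = 0 := by
    have e := congrArg (S.freeze hW hw) h.mul_Fq
    rw [map_mul, ← S.pdA_freeze_of_notMem hW hw (by simp), freeze_FF, map_zero] at e
    exact hφu.mul_right_eq_zero.1 e
  have hgd : Dep {.u 0 1} g := fun v hv => by
    by_cases h1 : v = .h 0 0
    · rw [h1, hgh]
    · rw [hgdef, Derivation.leibniz, hφd v (by simpa using h1), smul_zero, zero_add]
      by_cases h2 : v = .h 0 1
      · rw [h2, hFq, smul_zero]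
      · rw [S.dep_FF hW v (by simp_all), smul_zero]
  obtain ⟨ℓ, hℓ, hℓd, hred⟩ := h.reduce hL (S.isUnit_FF hW) hφu hφd hgd rfl
  have hφw : ∀ {w'} (hw' : w' ∈ W), S.freeze hW hw' φ = φ := fun hw' =>
    S.freeze_of_dep hW hw' fun z z' h1 _ _ => evφ z z' h1
  have hℓw : S.freeze hW hw ℓ = 1 := by
    have e := congrArg (S.freeze hW hw) hℓ
    rw [map_mul, hφw hw, ← hφdef] at e
    have e' : φ * (S.freeze hW hw ℓ - 1) = 0 := by linear_combination -e
    linear_combination hφu.mul_right_eq_zero.1 e'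
  have hφ2 := hred.pdA_pdA_eq_zero hW' hφu hgu hφd hℓd hw (hφw hw) hℓw hφw
  obtain ⟨α, hα⟩ := (hφd.pdA (.h 0 0)).eq_const hpre (by simpa using hφ2)
  obtain ⟨β, hβ⟩ := (hφd.sub ((dep_algebraMap α).mul (dep_coord (v := .h 0 0) (by simp)))).eq_const
    hpre (by simp [Derivation.leibniz, hα])
  have hφe : ∀ z : S.domO hW, ev z φ = α * (z : Jet) (.h 0 0) + β := fun z => by
    have e := congrArg (ev z) hβ
    rw [map_sub, map_mul, AlgHom.commutes, AlgHom.commutes, ev_coord] at e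
    simp only [Algebra.algebraMap_self, RingHom.id_apply] at e
    linarith
  obtain ⟨y₀, hy₀⟩ := S.nonempty_I
  obtain ⟨q₀, hq₀⟩ := S.nonempty_K
  have hne : ∀ y ∈ S.I, α * y + β ≠ 0 := by
    intro y hy
    obtain ⟨p, hp⟩ := S.nonempty_J
    have e := hφe ⟨_, S.jetWith_mem hW 0 hw hy hp hq₀⟩
    change _ = α * y + β at e
    rw [← e]
    exact (hφu.map (ev _)).ne_zero
  -- The product Fφ is constant along h and hₓ because `I` and `K` are intervals; `y₀` and `q₀` are
  -- base values.
  have key : ∀ y ∈ S.I, ∀ p ∈ S.J, ∀ q ∈ S.K,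
      S.F y p q * (α * y + β) = S.F y₀ p q₀ * (α * y₀ + β) := by
    intro y hy p hp q hq
    have e : ∀ y (hy : y ∈ S.I) q (hq : q ∈ S.K),
        ev ⟨_, S.jetWith_mem hW 0 hw hy hp hq⟩ g = S.F y p q * (α * y + β) := by
      intro y hy q hq
      rw [hgdef, map_mul, hφe]; rfl
    have e1 := ev_eq_of_update hgh (S.ordConnected_update hW (Or.inl rfl))
      (z := ⟨_, S.jetWith_mem hW 0 hw hy hp hq⟩) (z' := ⟨_, S.jetWith_mem hW 0 hw hy₀ hp hq⟩)
      (s := y₀) (jetWith_update_h _ _ _ _ _ _)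
    have e2 := ev_eq_of_update (hgd (.h 0 1) (by simp)) (S.ordConnected_update hW (by simp))
      (z := ⟨_, S.jetWith_mem hW 0 hw hy₀ hp hq⟩) (z' := ⟨_, S.jetWith_mem hW 0 hw hy₀ hp hq₀⟩)
      (s := q₀) (jetWith_update_q _ _ _ _ _ _)
    rw [e y₀ hy₀ q hq, e y hy q hq] at e1
    rw [e y₀ hy₀ q₀ hq₀, e y₀ hy₀ q hq] at e2
    rw [← e1, e2]
  refine ⟨α, β, fun p => S.F y₀ p q₀ * (α * y₀ + β), hne, ?_, ?_, ?_⟩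
  · refine ContDiffOn.mul (S.smooth_F.comp (f := fun p : ℝ => (y₀, p, q₀)) ?_ ?_) contDiffOn_const
    · exact (contDiff_const.prodMk (contDiff_id.prodMk contDiff_const)).contDiffOn
    · exact fun p hp => ⟨hy₀, hp, hq₀⟩
  · exact fun p hp => mul_ne_zero (S.F_ne_zero _ hy₀ _ hp _ hq₀) (hne _ hy₀)
  · intro y hy p hp q hq
    rw [eq_div_iff (hne y hy), key y hy p hp q hq]

end SWSystem

/-! ### Conservation laws and their multipliers -/

namespace SWSystem

open DF

variable {S : SWSystem} {W : Set (ℝ × ℝ × ℝ)} {hW : IsOpen W}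

/-- Smooth functions of `t, x, u, h`. -/
def IsZeroth (f : DF (S.domO hW)) : Prop :=
  ∃ l : (ℝ × ℝ × ℝ) × ℝ → ℝ, ContDiffOn ℝ ∞ l (W ×ˢ S.I) ∧
    ∀ z : S.domO hW, ev z f = l (((z : Jet) .t, (z : Jet) .x, (z : Jet) (.u 0 0)), (z : Jet) (.h 0 0))

namespace IsZeroth

variable {f f' : DF (S.domO hW)}

theorem dep (hf : IsZeroth f) : Dep coords₀ f := by
  obtain ⟨l, hl, h⟩ := hf
  intro v hv
  simp only [coords₀, Finset.mem_insert, Finset.mem_singleton, not_or] at hv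
  have hs : IsSmoothCyl (S.domO hW) fun z => l ((z .t, z .x, z (.u 0 0)), z (.h 0 0)) :=
    (((IsSmoothCyl.coord .t).prodMk ((IsSmoothCyl.coord .x).prodMk
      (IsSmoothCyl.coord (.u 0 0)))).prodMk (IsSmoothCyl.coord (.h 0 0))).comp hl
      fun z hz => ⟨hz.1, hz.2.1⟩
  have hf : f = DF.mk _ hs := DF.ext h
  rw [hf]
  refine pdA_mk_eq_zero _ fun z s => ?_
  rw [Function.update_of_ne (Ne.symm hv.1), Function.update_of_ne (Ne.symm hv.2.1),
    Function.update_of_ne (Ne.symm hv.2.2.1), Function.update_of_ne (Ne.symm hv.2.2.2)]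

theorem ev_congr (hf : IsZeroth f) {z z' : S.domO hW} (h1 : (z : Jet) .t = (z' : Jet) .t)
    (h2 : (z : Jet) .x = (z' : Jet) .x) (h3 : (z : Jet) (.u 0 0) = (z' : Jet) (.u 0 0))
    (h4 : (z : Jet) (.h 0 0) = (z' : Jet) (.h 0 0)) : ev z f = ev z' f := by
  obtain ⟨l, hl, h⟩ := hf
  rw [h, h, h1, h2, h3, h4]

theorem add (hf : IsZeroth f) (hf' : IsZeroth f') : IsZeroth (f + f') := by
  obtain ⟨l, hl, h⟩ := hf
  obtain ⟨l', hl', h'⟩ := hf'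
  exact ⟨_, hl.add hl', fun z => by rw [map_add, h, h']⟩

theorem sub (hf : IsZeroth f) (hf' : IsZeroth f') : IsZeroth (f - f') := by
  obtain ⟨l, hl, h⟩ := hf
  obtain ⟨l', hl', h'⟩ := hf'
  exact ⟨_, hl.sub hl', fun z => by rw [map_sub, h, h']⟩

theorem mul (hf : IsZeroth f) (hf' : IsZeroth f') : IsZeroth (f * f') := by
  obtain ⟨l, hl, h⟩ := hf
  obtain ⟨l', hl', h'⟩ := hf'
  exact ⟨_, hl.mul hl', fun z => by rw [map_mul, h, h']⟩

theorem neg (hf : IsZeroth f) : IsZeroth (-f) := by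
  obtain ⟨l, hl, h⟩ := hf
  exact ⟨_, hl.neg, fun z => by rw [map_neg, h]⟩

theorem algebraMap (c : ℝ) : IsZeroth (algebraMap ℝ (DF (S.domO hW)) c) :=
  ⟨fun _ => c, contDiffOn_const, fun z => by rw [AlgHom.commutes]; rfl⟩

theorem pow (hf : IsZeroth f) (n : ℕ) : IsZeroth (f ^ n) := by
  obtain ⟨l, hl, h⟩ := hf
  exact ⟨_, hl.pow n, fun z => by rw [map_pow, h]⟩

theorem t : IsZeroth (Xt : DF (S.domO hW)) := ⟨fun a => a.1.1, by fun_prop, fun _ => rfl⟩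

theorem x : IsZeroth (Xx : DF (S.domO hW)) := ⟨fun a => a.1.2.1, by fun_prop, fun _ => rfl⟩

theorem u : IsZeroth (Xu : DF (S.domO hW)) := ⟨fun a => a.1.2.2, by fun_prop, fun _ => rfl⟩

theorem h : IsZeroth (Xh : DF (S.domO hW)) := ⟨fun a => a.2, by fun_prop, fun _ => rfl⟩

theorem lnH : IsZeroth (S.lnH hW) :=
  ⟨fun a => Real.log a.2, Real.contDiffOn_log.comp contDiff_snd.contDiffOn
    fun _ ha => (S.pos_of_mem _ ha.2).ne', fun _ => rfl⟩

theorem smul (c : ℝ) (hf : IsZeroth f) : IsZeroth (c • f) := by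
  rw [Algebra.smul_def]; exact (algebraMap c).mul hf

theorem sum {ι : Type*} (s : Finset ι) {f : ι → DF (S.domO hW)} (hf : ∀ i, IsZeroth (f i)) :
    IsZeroth (∑ i ∈ s, f i) := by
  classical
  induction s using Finset.induction_on with
  | empty => simpa using algebraMap 0
  | insert i s hi ih => rw [Finset.sum_insert hi]; exact (hf i).add ih

end IsZeroth

/-- `Φ` is represented by the density `R` and the flux `X`, and its multipliers are `L`, `M`. -/
structure IsMult (hW : IsOpen W) (Φ : FluxPair) (R X L M : DF (S.domO hW)) : Prop where
  dens : ∀ z : S.domO hW, Φ.1 z = ev z R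
  flux : ∀ z : S.domO hW, Φ.2 z = ev z X
  zerothL : IsZeroth L
  zerothM : IsZeroth M
  div : dt R + dx X = L * S.delta hW true + M * S.delta hW false

theorem totalDiv_eq_ev {Φ : FluxPair} {R X : DF (S.domO hW)}
    (h1 : ∀ z : S.domO hW, Φ.1 z = ev z R) (h2 : ∀ z : S.domO hW, Φ.2 z = ev z X)
    (z : S.domO hW) : totalDiv Φ z = ev z (dt R + dx X) := by
  rw [totalDiv, Dt_eq_ev (isSmoothCyl_of_eq_ev h1), Dx_eq_ev (isSmoothCyl_of_eq_ev h2),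
    mk_eq_of_eq_ev h1, mk_eq_of_eq_ev h2, map_add]

theorem HasZerothOrderMultipliers.exists_isMult (hW : IsOpen W) {Φ : FluxPair}
    (h : S.HasZerothOrderMultipliers W Φ) : ∃ R X L M, IsMult (S := S) hW Φ R X L M := by
  obtain ⟨⟨h1, h2, -⟩, l, m, hl, hm, h⟩ := h
  have hs : ∀ l : (ℝ × ℝ × ℝ) × ℝ → ℝ, ContDiffOn ℝ ∞ l (W ×ˢ S.I) →
      IsSmoothCyl (S.domO hW) fun z => l ((z .t, z .x, z (.u 0 0)), z (.h 0 0)) := fun l hl =>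
    (((IsSmoothCyl.coord .t).prodMk ((IsSmoothCyl.coord .x).prodMk
      (IsSmoothCyl.coord (.u 0 0)))).prodMk (IsSmoothCyl.coord (.h 0 0))).comp hl
      fun z hz => ⟨hz.1, hz.2.1⟩
  refine ⟨DF.mk Φ.1 h1, DF.mk Φ.2 h2, DF.mk _ (hs l hl), DF.mk _ (hs m hm), fun _ => rfl,
    fun _ => rfl, ⟨l, hl, fun _ => rfl⟩, ⟨m, hm, fun _ => rfl⟩, DF.ext fun z => ?_⟩
  rw [← totalDiv_eq_ev (Φ := Φ) (fun _ => rfl) (fun _ => rfl), h z z.2, map_add, map_mul, map_mul,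
    ev_delta_true, ev_delta_false]
  rfl

namespace IsMult

variable {Φ Φ' : FluxPair} {R X L M R' X' L' M' : DF (S.domO hW)}

theorem hasZerothOrderMultipliers (h : IsMult hW Φ R X L M) : S.HasZerothOrderMultipliers W Φ := by
  obtain ⟨hR, hX, ⟨l, hl, hl'⟩, ⟨m, hm, hm'⟩, hd⟩ := h
  have key : ∀ z ∈ S.dom W, totalDiv Φ z =
      l ((z .t, z .x, z (.u 0 0)), z (.h 0 0)) * S.Delta₁ z
        + m ((z .t, z .x, z (.u 0 0)), z (.h 0 0)) * Delta₂ z := by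
    intro z hz
    rw [totalDiv_eq_ev hR hX ⟨z, hz⟩, hd, map_add, map_mul, map_mul, ev_delta_true, ev_delta_false,
      hl', hm']
  refine ⟨⟨isSmoothCyl_of_eq_ev hR, isSmoothCyl_of_eq_ev hX, fun z hz => ?_⟩, l, m, hl, hm, key⟩
  obtain ⟨h1, h2⟩ := hz.2 0 0
  simp only [Function.iterate_zero, id] at h1 h2
  rw [key z hz.1, h1, h2]
  ring

theorem sub (h : IsMult hW Φ R X L M) (h' : IsMult hW Φ' R' X' L' M') :
    IsMult hW (Φ - Φ') (R - R') (X - X') (L - L') (M - M') where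
  dens z := by rw [map_sub, ← h.dens, ← h'.dens]; rfl
  flux z := by rw [map_sub, ← h.flux, ← h'.flux]; rfl
  zerothL := h.zerothL.sub h'.zerothL
  zerothM := h.zerothM.sub h'.zerothM
  div := by
    rw [map_sub, map_sub]
    linear_combination h.div - h'.div

theorem sum {n : ℕ} {φ : Fin n → FluxPair} {R X L M : Fin n → DF (S.domO hW)}
    (h : ∀ i, IsMult hW (φ i) (R i) (X i) (L i) (M i)) (c : Fin n → ℝ) :
    IsMult hW (∑ i, c i • φ i) (∑ i, c i • R i) (∑ i, c i • X i) (∑ i, c i • L i)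
      (∑ i, c i • M i) where
  dens z := by simp [(h _).dens, Prod.fst_sum]
  flux z := by simp [(h _).flux, Prod.snd_sum]
  zerothL := .sum _ fun i => (h i).zerothL.smul _
  zerothM := .sum _ fun i => (h i).zerothM.smul _
  div := by
    simp only [map_sum, Derivation.map_smul, ← Finset.sum_add_distrib, Finset.sum_mul, smul_mul_assoc,
      ← smul_add, (h _).div]

/-- With zero multipliers the pair is itself a null divergence on the whole domain. -/
theorem isTrivial (h : IsMult hW Φ R X 0 0) : S.IsTrivial W Φ := by
  have h0 : IsDiffFun (S.dom W) fun _ => 0 := IsSmoothCyl.const (D := S.domO hW) (0 : ℝ)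
  refine ⟨(fun _ => 0, fun _ => 0), Φ, ⟨h0, h0⟩,
    ⟨isSmoothCyl_of_eq_ev h.dens, isSmoothCyl_of_eq_ev h.flux⟩, fun z _ => by simp,
    fun z _ => ⟨rfl, rfl⟩, fun z hz => ?_⟩
  rw [totalDiv_eq_ev h.dens h.flux ⟨z, hz⟩, h.div, zero_mul, zero_mul, add_zero, map_zero]

theorem detEqs (h : IsMult hW Φ R X L M) : DetEqs (S.FF hW) L M :=
  S.detEqs hW h.zerothL.dep h.zerothM.dep h.div

/-- The multipliers of a trivial conserved vector with a density of order zero vanish. -/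
theorem eq_zero_of_isTrivial (h : IsMult hW Φ R X L M) (hR : IsZeroth R)
    (ht : S.IsTrivial W Φ) : L = 0 ∧ M = 0 := by
  have hpd : ∀ κ j, pdA (jv κ 0 (j + 1)) R = 0 := fun κ j =>
    hR.dep _ (by cases κ <;> simp [jv])
  have h0 : ∀ κ, pdA (jv κ 0 0) R = 0 := ht.pdA_density h.dens
    (fun z z' h1 h2 h3 => hR.ev_congr h1 h2 (h3 true) (h3 false)) hpd
  have hall : ∀ κ i j, pdA (jv κ i j) R = 0 := by
    intro κ i j
    rcases i with _ | i
    · rcases j with _ | j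
      · exact h0 κ
      · exact hpd κ j
    · exact hR.dep _ (by cases κ <;> simp [jv])
  -- The density depends on t and x alone, so E₁ of the divergence, which is the multiplier,
  -- vanishes.
  have hE : ∀ κ, eul κ 1 1 (dt R + dx X) = 0 := fun κ => by
    have : ∀ i, eul κ i 1 R = 0 := fun i => by
      rw [eul_eq_sum κ i 1 (N := 0) fun j _ => hall κ i j]; rfl
    rw [eul_add_right, eul_succ_dt, eul_one_dx, this, this, map_zero, add_zero, add_zero]
  have hL := S.eul_true_one_mul_delta hW h.zerothL.dep h.zerothM.dep
  have hM := S.eul_false_one_mul_delta hW h.zerothL.dep h.zerothM.dep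
  rw [← h.div, hE] at hL hM
  exact ⟨hL.symm, hM.symm⟩

/-- Linear independence of conservation laws follows from linear independence of their
multipliers. -/
theorem areIndependentCLs {n : ℕ} {φ : Fin n → FluxPair} {R X L M : Fin n → DF (S.domO hW)}
    (h : ∀ i, IsMult hW (φ i) (R i) (X i) (L i) (M i)) (hR : ∀ i, IsZeroth (R i))
    (hind : ∀ c : Fin n → ℝ, ∑ i, c i • L i = 0 → ∑ i, c i • M i = 0 → c = 0) :
    S.AreIndependentCLs W φ := by
  refine ⟨fun i => (h i).hasZerothOrderMultipliers, fun c hc => ?_⟩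
  obtain ⟨h1, h2⟩ := (sum h c).eq_zero_of_isTrivial (.sum _ fun i => (hR i).smul _) hc
  exact hind c h1 h2

theorem isCLBasis {n : ℕ} {φ : Fin n → FluxPair} {R X L M : Fin n → DF (S.domO hW)}
    (h : ∀ i, IsMult hW (φ i) (R i) (X i) (L i) (M i)) (hind : S.AreIndependentCLs W φ)
    (hspan : ∀ {Φ R' X' L' M'}, IsMult hW Φ R' X' L' M' →
      ∃ c : Fin n → ℝ, L' = ∑ i, c i • L i ∧ M' = ∑ i, c i • M i) :
    S.IsCLBasis W φ := by
  refine ⟨hind, fun Φ hΦ => ?_⟩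
  obtain ⟨R', X', L', M', hm⟩ := hΦ.exists_isMult hW
  obtain ⟨c, h1, h2⟩ := hspan hm
  have := hm.sub (sum h c)
  rw [← h1, ← h2, sub_self, sub_self] at this
  exact ⟨c, this.isTrivial⟩

end IsMult

end SWSystem

/-! ### The conservation laws of the table -/

namespace SWSystem

open DF

variable {S : SWSystem} {W : Set (ℝ × ℝ × ℝ)} {hW : IsOpen W}

variable (S hW) in
/-- The differential function `k(uₓ)`. -/
def ofP (k : ℝ → ℝ) (hk : ContDiffOn ℝ ∞ k S.J) : DF (S.domO hW) :=
  DF.mk (fun z => k (z (.u 0 1))) ((IsSmoothCyl.coord (.u 0 1)).comp hk fun _ hz => hz.2.2.1)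

theorem ev_ofP {k : ℝ → ℝ} (hk : ContDiffOn ℝ ∞ k S.J) (z : S.domO hW) :
    ev z (S.ofP hW k hk) = k ((z : Jet) (.u 0 1)) := rfl

theorem dep_ofP {k : ℝ → ℝ} (hk : ContDiffOn ℝ ∞ k S.J) : Dep {.u 0 1} (S.ofP hW k hk) :=
  fun v hv => pdA_mk_eq_zero _ fun z s => by
    rw [Function.update_of_ne]
    simpa [eq_comm] using hv

theorem pdA_ofP {k k' : ℝ → ℝ} (hk : ContDiffOn ℝ ∞ k S.J) (hk' : ContDiffOn ℝ ∞ k' S.J)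
    (h : ∀ p ∈ S.J, HasDerivAt k (k' p) p) : Pp (S.ofP hW k hk) = S.ofP hW k' hk' :=
  DF.ext fun z => ev_pdA_mk _ (by simpa [ev_ofP] using h _ z.2.2.2.1)

theorem dx_ofP {k k' : ℝ → ℝ} (hk : ContDiffOn ℝ ∞ k S.J) (hk' : ContDiffOn ℝ ∞ k' S.J)
    (h : ∀ p ∈ S.J, HasDerivAt k (k' p) p) : dx (S.ofP hW k hk) = Xr * S.ofP hW k' hk' := by
  rw [dx, (dep_ofP hk).vf, Finset.sum_singleton, pdA_ofP hk hk' h]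
  rfl

theorem contDiffOn_antideriv {g G : ℝ → ℝ} (hg : ContDiffOn ℝ ∞ g S.J)
    (hG : ∀ p ∈ S.J, HasDerivAt G (g p) p) : ContDiffOn ℝ ∞ G S.J :=
  (contDiffOn_infty_iff_deriv_of_isOpen S.isOpen_J).2
    ⟨fun p hp => (hG p hp).differentiableAt.differentiableWithinAt,
      hg.congr fun p hp => (hG p hp).deriv⟩

variable (S hW) in
/-- The differential function `α h + β`. -/
def phi (α β : ℝ) : DF (S.domO hW) := algebraMap ℝ _ α * Xh + algebraMap ℝ _ β

theorem ev_phi (α β : ℝ) (z : S.domO hW) : ev z (S.phi hW α β) = α * (z : Jet) (.h 0 0) + β := by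
  simp [phi]

theorem IsAffine.FF_mul {α β : ℝ} {g : ℝ → ℝ} (h : S.IsAffine α β g) :
    S.FF hW * S.phi hW α β = S.ofP hW g h.smooth := DF.ext fun z => by
  rw [map_mul, ev_FF, ev_phi, ev_ofP, h.F_eq _ z.2.2.1 _ z.2.2.2.1 _ z.2.2.2.2,
    div_mul_cancel₀ _ (h.ne _ z.2.2.1)]

theorem IsAffine.isUnit_phi {α β : ℝ} {g : ℝ → ℝ} (h : S.IsAffine α β g) :
    IsUnit (S.phi hW α β) := isUnit_of_ev_ne_zero fun z => by
  rw [ev_phi]; exact h.ne _ z.2.2.1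

theorem isZeroth_phi (α β : ℝ) : IsZeroth (S.phi hW α β) :=
  ((IsZeroth.algebraMap α).mul .h).add (.algebraMap β)

theorem isZeroth_one : IsZeroth (1 : DF (S.domO hW)) := by
  simpa using IsZeroth.algebraMap (hW := hW) (S := S) 1

theorem isZeroth_zero : IsZeroth (0 : DF (S.domO hW)) := by
  simpa using IsZeroth.algebraMap (hW := hW) (S := S) 0

theorem two_mul_half : (2 : DF (S.domO hW)) * algebraMap ℝ _ 2⁻¹ = 1 := by
  rw [← map_ofNat (algebraMap ℝ (DF (S.domO hW))) 2, ← map_mul]; norm_num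

theorem three_mul_third : (3 : DF (S.domO hW)) * algebraMap ℝ _ 3⁻¹ = 1 := by
  rw [← map_ofNat (algebraMap ℝ (DF (S.domO hW))) 3, ← map_mul]; norm_num

/-! ### Multipliers of the listed laws -/

theorem isMult_clMass : IsMult hW clMass Xh (Xh * Xu) (0 : DF (S.domO hW)) 1 where
  dens _ := rfl
  flux _ := rfl
  zerothL := isZeroth_zero
  zerothM := isZeroth_one
  div := by
    rw [mul_delta_eq]
    simp [Derivation.leibniz, ct, cx]
    ring

theorem dt_algebraMap (c : ℝ) : dt (algebraMap ℝ (DF D) c) = 0 := Derivation.map_algebraMap _ _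

theorem dx_algebraMap (c : ℝ) : dx (algebraMap ℝ (DF D) c) = 0 := Derivation.map_algebraMap _ _

/-- This is the parameter c = 1 of `RedEqs.solve`; `isMult_clC₁` is e = -1 and `isMult_clB₂` is d =
1, the other parameters being zero. -/
theorem isMult_clA {α β : ℝ} {g G : ℝ → ℝ} (h : S.IsAffine α β g)
    (hG : ∀ p ∈ S.J, HasDerivAt G (g p) p) :
    IsMult hW (clA α β G) (S.phi hW α β * Xu)
      (algebraMap ℝ _ 2⁻¹ * (algebraMap ℝ _ α * Xh ^ 2 + algebraMap ℝ _ β * Xu ^ 2)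
        + algebraMap ℝ _ α * Xh * Xu ^ 2 + algebraMap ℝ _ β * Xh
        - S.ofP hW G (contDiffOn_antideriv h.smooth hG))
      (S.phi hW α β) (algebraMap ℝ _ α * Xu) where
  dens z := by simp [clA, phi]; ring
  flux z := by simp [clA, ev_ofP]; ring
  zerothL := isZeroth_phi α β
  zerothM := (IsZeroth.algebraMap α).mul .u
  div := by
    have hF := h.FF_mul (hW := hW)
    rw [mul_delta_eq]
    simp only [map_add, map_sub, Derivation.leibniz, Derivation.leibniz_pow, dx_ofP _ h.smooth hG,
      ← hF, phi, dt_algebraMap, dx_algebraMap, dt_coord, dx_coord, ct, cx, smul_eq_mul, nsmul_eq_mul]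
    push_cast
    linear_combination (algebraMap ℝ _ α * Xh * Xq + algebraMap ℝ _ β * Xu * Xp)
      * two_mul_half (S := S) (hW := hW)

theorem isMult_clC₁ {g G : ℝ → ℝ} (h : S.IsAffine 1 0 g)
    (hG : ∀ p ∈ S.J, HasDerivAt G (g p) p) :
    IsMult hW (clC₁ G) (Xx * Xh - Xt * Xh * Xu)
      (Xx * Xh * Xu - Xt * Xh * Xu ^ 2 - algebraMap ℝ _ 2⁻¹ * Xt * Xh ^ 2
        + Xt * S.ofP hW G (contDiffOn_antideriv h.smooth hG))
      (-(Xt * Xh)) (Xx - Xt * Xu) where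
  dens z := by simp [clC₁]
  flux z := by simp [clC₁, ev_ofP]
  zerothL := (IsZeroth.t.mul .h).neg
  zerothM := IsZeroth.x.sub (IsZeroth.t.mul .u)
  div := by
    have hF := h.FF_mul (hW := hW)
    rw [mul_delta_eq]
    simp only [map_add, map_sub, Derivation.leibniz, Derivation.leibniz_pow, dx_ofP _ h.smooth hG,
      ← hF, phi, dx_algebraMap, dt_coord, dx_coord, ct, cx, smul_eq_mul, nsmul_eq_mul,
      map_one, map_zero]
    push_cast
    linear_combination (-Xt * Xh * Xq) * two_mul_half (S := S) (hW := hW)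

theorem hasDerivAt_neg_one_div {p : ℝ} (hp : p ≠ 0) :
    HasDerivAt (fun p : ℝ => -(1 / p)) (1 / p ^ 2) p := by
  have := (hasDerivAt_inv hp).neg
  refine (this.congr_of_eventuallyEq (.of_forall fun y => ?_)).congr_deriv ?_ <;> simp

theorem isMult_clB₂ {α β : ℝ} (h : S.IsAffine α β fun p => 1 / p ^ 2) (h0 : (0 : ℝ) ∉ S.J) :
    IsMult hW (clB₂ α β) (algebraMap ℝ _ 2⁻¹ * (S.phi hW α β * Xu ^ 2 + algebraMap ℝ _ α * Xh ^ 2)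
        + algebraMap ℝ _ β * (Xh * S.lnH hW - Xh) - Xt)
      (algebraMap ℝ _ 2⁻¹ * algebraMap ℝ _ α * Xh * Xu ^ 3
        + algebraMap ℝ _ 3⁻¹ * algebraMap ℝ _ β * Xu ^ 3
        + algebraMap ℝ _ β * Xh * Xu * S.lnH hW + algebraMap ℝ _ α * Xh ^ 2 * Xu
        - Xu * S.ofP hW (fun p => -(1 / p)) (contDiffOn_antideriv h.smooth fun _ hp =>
          hasDerivAt_neg_one_div fun e => h0 (e ▸ hp)))
      (S.phi hW α β * Xu)
      (algebraMap ℝ _ 2⁻¹ * algebraMap ℝ _ α * Xu ^ 2 + algebraMap ℝ _ α * Xh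
        + algebraMap ℝ _ β * S.lnH hW) where
  dens z := by
    have : ev z (S.lnH hW) = Real.log ((z : Jet) (.h 0 0)) := rfl
    simp [clB₂, phi, this]; ring
  flux z := by
    have : ev z (S.lnH hW) = Real.log ((z : Jet) (.h 0 0)) := rfl
    simp [clB₂, ev_ofP, this]; ring
  zerothL := (isZeroth_phi α β).mul .u
  zerothM := ((((IsZeroth.algebraMap _).mul (.algebraMap _)).mul (IsZeroth.u.pow 2)).add
    ((IsZeroth.algebraMap _).mul .h)).add ((IsZeroth.algebraMap _).mul .lnH)
  div := by
    have hd : ∀ p ∈ S.J, HasDerivAt (fun p : ℝ => -(1 / p)) (1 / p ^ 2) p := fun p hp =>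
      hasDerivAt_neg_one_div fun e => h0 (e ▸ hp)
    have hF := h.FF_mul (hW := hW)
    have hlog := S.h_mul_pdA_lnH hW
    -- The antiderivative -1/uₓ satisfies uₓG = -1. The resulting constant in DₓX is balanced by the
    -- term -t of the density.
    have hinv : Xp * S.ofP hW (fun p => -(1 / p)) (contDiffOn_antideriv h.smooth hd) = -1 :=
      DF.ext fun z => by
        have hz : (z : Jet) (.u 0 1) ≠ 0 := fun e => h0 (e ▸ z.2.2.2.1)
        simp [ev_ofP, hz]
    rw [mul_delta_eq]
    simp only [map_add, map_sub, Derivation.leibniz, Derivation.leibniz_pow, dx_ofP _ h.smooth hd,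
      ← hF, phi, dt_algebraMap, dx_algebraMap, dt_coord, dx_coord, ct, cx, smul_eq_mul, nsmul_eq_mul,
      (IsZeroth.lnH (S := S) (hW := hW)).dep.dt₀, (IsZeroth.lnH (S := S) (hW := hW)).dep.dx₀,
      S.dep_lnH hW .t (by simp), S.dep_lnH hW .x (by simp), S.dep_lnH hW (.u 0 0) (by simp)]
    push_cast
    linear_combination ((algebraMap ℝ _ α * Xh + algebraMap ℝ _ β) * Xu * coord _ (.u 1 0)
      + algebraMap ℝ _ α * Xh * coord _ (.h 1 0) + algebraMap ℝ _ α * Xh * Xu ^ 2 * Xp)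
        * two_mul_half (S := S) (hW := hW)
      + algebraMap ℝ _ β * Xu ^ 2 * Xp * three_mul_third (S := S) (hW := hW)
      + algebraMap ℝ _ β * (coord _ (.h 1 0) + Xu * Xq) * hlog - hinv

end SWSystem

/-! ### Classification -/

namespace SWSystem

open DF

variable {S : SWSystem} {W : Set (ℝ × ℝ × ℝ)} {hW : IsOpen W}

/-- With L = 0, `mom` reads h M_x = 0 and `mass` then gives Mₜ = 0; M_u and M_h vanish as well. -/
theorem eq_const_of_left_eq_zero (hW' : IsConnected W) {Φ : FluxPair} {R X L M : DF (S.domO hW)}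
    (h : IsMult hW Φ R X L M) (hL : L = 0) : ∃ k : ℝ, M = algebraMap ℝ _ k := by
  obtain ⟨-, e2, e3, -, e5, -, e7⟩ := h.detEqs
  rw [hL] at e2 e3 e5 e7
  simp only [map_zero, mul_zero, zero_add, add_zero] at e2 e3 e5 e7
  have hx : Px M = 0 := (S.isUnit_h hW).mul_right_eq_zero.1 e7
  rw [hx, mul_zero, zero_add] at e5
  exact h.zerothM.dep.eq_const (S.isPreconnected_domO hW hW'.isPreconnected)
    (by simp [e2, hx, e5, (S.isUnit_h hW).mul_right_eq_zero.1 e3])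

theorem IsMult.exists_isAffine (hW' : IsConnected W) {Φ : FluxPair} {R X L M : DF (S.domO hW)}
    (h : IsMult hW Φ R X L M) (hL : L ≠ 0) : ∃ α β g, S.IsAffine α β g :=
  SWSystem.exists_isAffine hW' h.detEqs h.zerothL.dep
    (fun _ _ h1 h2 h3 h4 => h.zerothL.ev_congr h1 h2 h3 h4) hL

/-- Since (p²g)' = p(2g + pg'), d ≠ 0 makes p²g a constant K; and 0 in `J` would force g(0) = 0. -/
theorem IsAffine.solve (hW' : IsConnected W) {α β : ℝ} {g : ℝ → ℝ} (ha : S.IsAffine α β g)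
    {Φ : FluxPair} {R X L M : DF (S.domO hW)} (h : IsMult hW Φ R X L M) :
    ∃ c d e k : ℝ, β * e = 0 ∧
      (d = 0 ∨ (0 : ℝ) ∉ S.J ∧ ∃ K, K ≠ 0 ∧ ∀ p ∈ S.J, g p = K / p ^ 2) ∧
      L = (algebraMap ℝ _ c + algebraMap ℝ _ e * Xt + algebraMap ℝ _ d * Xu) * S.phi hW α β ∧
      M = algebraMap ℝ _ α * (algebraMap ℝ _ c * Xu + algebraMap ℝ _ e * (Xt * Xu - Xx)
        + algebraMap ℝ _ 2⁻¹ * algebraMap ℝ _ d * Xu ^ 2)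
        + algebraMap ℝ _ d * (algebraMap ℝ _ α * Xh + algebraMap ℝ _ β * S.lnH hW)
        + algebraMap ℝ _ k := by
  have hφd : Dep {.h 0 0} (S.phi hW α β) :=
    ((dep_algebraMap α).mul (dep_coord (by simp))).add (dep_algebraMap β)
  obtain ⟨ℓ, hL, hℓ, hred⟩ := h.detEqs.reduce h.zerothL.dep (S.isUnit_FF hW) ha.isUnit_phi hφd
    (dep_ofP ha.smooth) ha.FF_mul
  obtain ⟨c, d, e, k, h1, h2, h3, h4⟩ := hred.solve hW' rfl ha.isUnit_phi (dep_ofP ha.smooth) hℓ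
    h.zerothM.dep
  refine ⟨c, d, e, k, h1, ?_, by rw [hL, h3], h4⟩
  by_cases hd : d = 0
  · exact Or.inl hd
  have hdu : IsUnit (algebraMap ℝ (DF (S.domO hW)) d) := (IsUnit.mk0 d hd).map _
  have h5 := hdu.mul_right_eq_zero.1 h2
  have hK : ∃ K : ℝ, Xp ^ 2 * S.ofP hW g ha.smooth = algebraMap ℝ _ K := by
    refine Dep.eq_const (A := {.u 0 1}) (S.isPreconnected_domO hW hW'.isPreconnected)
      (((dep_coord (by simp)).pow 2).mul (dep_ofP ha.smooth)) ?_
    simp [Derivation.leibniz, Derivation.leibniz_pow]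
    linear_combination Xp * h5
  obtain ⟨K, hK⟩ := hK
  obtain ⟨w, hw⟩ := hW'.nonempty
  obtain ⟨y, hy⟩ := S.nonempty_I
  obtain ⟨q, hq⟩ := S.nonempty_K
  have h0 : (0 : ℝ) ∉ S.J := by
    intro h0
    have e := congrArg (ev ⟨_, S.jetWith_mem hW 0 hw hy h0 hq⟩) h5
    have e1 : ev ⟨_, S.jetWith_mem hW 0 hw hy h0 hq⟩ (Xp : DF (S.domO hW)) = 0 := rfl
    rw [map_add, map_mul, map_mul, map_ofNat, e1, zero_mul, add_zero, map_zero] at e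
    exact ha.g_ne 0 h0 ((mul_eq_zero.1 e).resolve_left two_ne_zero)
  have hKp : ∀ p ∈ S.J, p ^ 2 * g p = K := by
    intro p hp
    have e := congrArg (ev ⟨_, S.jetWith_mem hW 0 hw hy hp hq⟩) hK
    rw [map_mul, map_pow, AlgHom.commutes] at e
    exact e
  have hp0 : ∀ p ∈ S.J, p ≠ 0 := fun p hp e => h0 (e ▸ hp)
  refine Or.inr ⟨h0, K, ?_, fun p hp => ?_⟩
  · obtain ⟨p, hp⟩ := S.nonempty_J
    rw [← hKp p hp]
    exact mul_ne_zero (pow_ne_zero 2 (hp0 p hp)) (ha.g_ne p hp)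
  · rw [← hKp p hp, mul_div_cancel_left₀ _ (pow_ne_zero 2 (hp0 p hp))]

/-! ### The bound of four -/

theorem affine_eq_zero (hW' : IsConnected W) {c d e : ℝ}
    (h : algebraMap ℝ (DF (S.domO hW)) c + algebraMap ℝ _ e * Xt + algebraMap ℝ _ d * Xu = 0) :
    c = 0 ∧ d = 0 ∧ e = 0 := by
  obtain ⟨z⟩ := S.nonempty_domO hW hW'.nonempty
  have inj : ∀ r : ℝ, algebraMap ℝ (DF (S.domO hW)) r = 0 → r = 0 := fun r hr => by
    simpa using congrArg (ev z) hr
  have h1 := congrArg Pt h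
  have h2 := congrArg Pu h
  simp [Derivation.leibniz] at h1 h2
  refine ⟨?_, inj d h2, inj e h1⟩
  rw [h1, h2, zero_mul, zero_mul, add_zero, add_zero] at h
  exact inj c h

/-- Multipliers are determined by four numbers. -/
theorem IsMult.eq_zero_of_ev (hW' : IsConnected W) {Φ : FluxPair} {R X L M : DF (S.domO hW)}
    (h : IsMult hW Φ R X L M) (z : S.domO hW) (h1 : ev z L = 0) (h2 : ev z (Pt L) = 0)
    (h3 : ev z (Pu L) = 0) (h4 : ev z M = 0) : L = 0 ∧ M = 0 := by
  have hL : L = 0 := by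
    by_contra hne
    obtain ⟨α, β, g, ha⟩ := h.exists_isAffine hW' hne
    obtain ⟨c, d, e, k, -, -, hL, -⟩ := ha.solve hW' h
    have hφ : α * (z : Jet) (.h 0 0) + β ≠ 0 := ha.ne _ z.2.2.1
    rw [hL] at h1 h2 h3
    simp [phi, Derivation.leibniz, hφ] at h1 h2 h3
    have hc : c = 0 := by rw [h2, h3] at h1; simpa using h1
    exact hne (by rw [hL, hc, h2, h3]; simp)
  obtain ⟨k, hk⟩ := eq_const_of_left_eq_zero hW' h hL
  refine ⟨hL, ?_⟩
  rw [hk] at h4 ⊢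
  simp at h4
  rw [h4, map_zero]

/-- There are at most four linearly independent conservation laws. -/
theorem AreIndependentCLs.le_four (hW : IsOpen W) (hW' : IsConnected W) {n : ℕ}
    {φ : Fin n → FluxPair} (h : S.AreIndependentCLs W φ) : n ≤ 4 := by
  by_contra! hn
  obtain ⟨z⟩ := S.nonempty_domO hW hW'.nonempty
  choose R X L M hm using fun i => (h.1 i).exists_isMult hW
  -- The four numbers that determine the multipliers, as functions of the combination. For n > 4 a
  -- nonzero kernel element exists and gives a trivial combination.
  let T : (Fin n → ℝ) →ₗ[ℝ] Fin 4 → ℝ := LinearMap.pi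
    ![∑ i, (LinearMap.proj i).smulRight (ev z (L i)),
      ∑ i, (LinearMap.proj i).smulRight (ev z (Pt (L i))),
      ∑ i, (LinearMap.proj i).smulRight (ev z (Pu (L i))),
      ∑ i, (LinearMap.proj i).smulRight (ev z (M i))]
  obtain ⟨c, hc, hc0⟩ := (Submodule.ne_bot_iff _).1
    (LinearMap.ker_ne_bot_of_finrank_lt (f := T) (by simpa using hn))
  have hT : ∀ i, T c i = 0 := fun i => congrFun (LinearMap.mem_ker.1 hc) i
  have h1 := hT 0
  have h2 := hT 1
  have h3 := hT 2
  have h4 := hT 3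
  simp [T] at h1 h2 h3 h4
  have hsum := IsMult.sum hm c
  obtain ⟨hL, hM⟩ := hsum.eq_zero_of_ev hW' z (by simpa using h1)
    (by simpa using h2) (by simpa using h3) (by simpa using h4)
  rw [hL, hM] at hsum
  exact hc0 (h.2 c hsum.isTrivial)

/-! ### Bases of conservation laws -/

theorem areIndependentCLs_clMass (hW : IsOpen W) (hW' : IsConnected W) :
    S.AreIndependentCLs W ![clMass] := by
  obtain ⟨z⟩ := S.nonempty_domO hW hW'.nonempty
  refine IsMult.areIndependentCLs (hW := hW) (R := ![_]) (X := ![_]) (L := ![_]) (M := ![_])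
    (by simpa using isMult_clMass) (by simpa using IsZeroth.h) fun c _ h2 => ?_
  have e := congrArg (ev z) h2
  funext i
  fin_cases i
  simpa using e

theorem affine_mul_phi_eq_zero (hW' : IsConnected W) {α β : ℝ} {g : ℝ → ℝ}
    (ha : S.IsAffine α β g) {c d e : ℝ}
    (h : (algebraMap ℝ (DF (S.domO hW)) c + algebraMap ℝ _ e * Xt + algebraMap ℝ _ d * Xu)
      * S.phi hW α β = 0) : c = 0 ∧ d = 0 ∧ e = 0 :=
  affine_eq_zero hW' (ha.isUnit_phi.mul_left_eq_zero.1 h)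

theorem areIndependentCLs_clA (hW : IsOpen W) (hW' : IsConnected W) {α β : ℝ} {g G : ℝ → ℝ}
    (ha : S.IsAffine α β g) (hG : ∀ p ∈ S.J, HasDerivAt G (g p) p) :
    S.AreIndependentCLs W ![clMass, clA α β G] := by
  obtain ⟨z⟩ := S.nonempty_domO hW hW'.nonempty
  refine IsMult.areIndependentCLs (hW := hW) (R := ![_, _]) (X := ![_, _]) (L := ![_, _])
    (M := ![_, _]) (by simpa [Fin.forall_fin_succ] using ⟨isMult_clMass, isMult_clA ha hG⟩)
    (by simpa [Fin.forall_fin_succ] using ⟨IsZeroth.h, (isZeroth_phi α β).mul .u⟩)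
    fun c h1 h2 => ?_
  simp [Fin.sum_univ_succ, Algebra.smul_def] at h1 h2
  obtain ⟨hc, -, -⟩ := affine_mul_phi_eq_zero (hW := hW) hW' ha (c := c 1) (d := 0) (e := 0)
    (by rw [map_zero]; linear_combination h1)
  have e := congrArg (ev z) h2
  rw [hc] at e
  funext i
  fin_cases i
  · simpa using e
  · exact hc

/-- The assumption β ≠ 0 excludes e, and the assumption on g excludes d, leaving the constants k and
c. -/
theorem isCLBasis_clA (hW : IsOpen W) (hW' : IsConnected W) {α β : ℝ} {g G : ℝ → ℝ}
    (ha : S.IsAffine α β g) (hG : ∀ p ∈ S.J, HasDerivAt G (g p) p) (hβ : β ≠ 0)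
    (hg : ¬ ((0 : ℝ) ∉ S.J ∧ ∃ K, K ≠ 0 ∧ ∀ p ∈ S.J, g p = K / p ^ 2)) :
    S.IsCLBasis W ![clMass, clA α β G] := by
  refine IsMult.isCLBasis (hW := hW) (R := ![_, _]) (X := ![_, _]) (L := ![_, _])
    (M := ![_, _]) (by simpa [Fin.forall_fin_succ] using ⟨isMult_clMass, isMult_clA ha hG⟩)
    (areIndependentCLs_clA hW hW' ha hG) fun {Φ R' X' L' M'} h => ?_
  obtain ⟨c, d, e, k, h1, h2, rfl, rfl⟩ := ha.solve hW' h
  obtain rfl : e = 0 := (mul_eq_zero.1 h1).resolve_left hβ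
  obtain rfl : d = 0 := h2.resolve_right hg
  refine ⟨![k, c], ?_, ?_⟩
  · simp [Fin.sum_univ_succ, Algebra.smul_def]
  · simp [Fin.sum_univ_succ, Algebra.smul_def]
    ring

theorem isCLBasis_clB (hW : IsOpen W) (hW' : IsConnected W) {α β : ℝ} {G : ℝ → ℝ}
    (ha : S.IsAffine α β fun p => 1 / p ^ 2) (hG : ∀ p ∈ S.J, HasDerivAt G (1 / p ^ 2) p)
    (hβ : β ≠ 0) (h0 : (0 : ℝ) ∉ S.J) :
    S.IsCLBasis W ![clMass, clA α β G, clB₂ α β] := by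
  obtain ⟨z⟩ := S.nonempty_domO hW hW'.nonempty
  have hm := And.intro (isMult_clMass (S := S) (hW := hW))
    (And.intro (isMult_clA (hW := hW) ha hG) (isMult_clB₂ (hW := hW) ha h0))
  refine IsMult.isCLBasis (hW := hW) (R := ![_, _, _]) (X := ![_, _, _]) (L := ![_, _, _])
    (M := ![_, _, _]) (by simpa [Fin.forall_fin_succ] using hm)
    (IsMult.areIndependentCLs (hW := hW) (R := ![_, _, _]) (X := ![_, _, _]) (L := ![_, _, _])
      (M := ![_, _, _]) (by simpa [Fin.forall_fin_succ] using hm) ?_ fun c h1 h2 => ?_)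
    fun {Φ R' X' L' M'} h => ?_
  · simpa [Fin.forall_fin_succ] using ⟨IsZeroth.h, (isZeroth_phi α β).mul .u,
      (((IsZeroth.algebraMap 2⁻¹).mul (((isZeroth_phi α β).mul (IsZeroth.u.pow 2)).add
        ((IsZeroth.algebraMap α).mul (IsZeroth.h.pow 2)))).add
        ((IsZeroth.algebraMap β).mul ((IsZeroth.h.mul .lnH).sub .h))).sub .t⟩
  · simp [Fin.sum_univ_succ, Algebra.smul_def] at h1 h2
    obtain ⟨hc, hd, -⟩ := affine_mul_phi_eq_zero (hW := hW) hW' ha (c := c 1) (d := c 2) (e := 0)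
      (by rw [map_zero]; linear_combination h1)
    have e := congrArg (ev z) h2
    rw [hc, hd] at e
    funext i
    fin_cases i
    · simpa using e
    · exact hc
    · exact hd
  · obtain ⟨c, d, e, k, h1, h2, rfl, rfl⟩ := ha.solve hW' h
    obtain rfl : e = 0 := (mul_eq_zero.1 h1).resolve_left hβ
    refine ⟨![k, c, d], ?_, ?_⟩
    · simp [Fin.sum_univ_succ, Algebra.smul_def]
      ring
    · simp [Fin.sum_univ_succ, Algebra.smul_def]
      ring

theorem areIndependentCLs_clC (hW : IsOpen W) (hW' : IsConnected W) {g G : ℝ → ℝ}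
    (ha : S.IsAffine 1 0 g) (hG : ∀ p ∈ S.J, HasDerivAt G (g p) p) :
    S.AreIndependentCLs W ![clMass, clC₁ G, clA 1 0 G] := by
  obtain ⟨z⟩ := S.nonempty_domO hW hW'.nonempty
  have hφ : S.phi hW 1 0 = Xh := by simp [phi]
  have hm := And.intro (isMult_clMass (S := S) (hW := hW)) (And.intro
    (isMult_clC₁ (hW := hW) ha hG) (isMult_clA (hW := hW) ha hG))
  refine IsMult.areIndependentCLs (hW := hW) (R := ![_, _, _]) (X := ![_, _, _])
    (L := ![_, _, _]) (M := ![_, _, _]) (by simpa [Fin.forall_fin_succ] using hm)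
    (by simpa [Fin.forall_fin_succ] using ⟨IsZeroth.h,
      (IsZeroth.x.mul .h).sub ((IsZeroth.t.mul .h).mul .u), (isZeroth_phi 1 0).mul .u⟩)
    fun c h1 h2 => ?_
  simp [Fin.sum_univ_succ, Algebra.smul_def] at h1 h2
  obtain ⟨hc, -, he⟩ := affine_mul_phi_eq_zero (hW := hW) hW' ha (c := c 2) (d := 0)
    (e := -c 1) (by rw [map_zero, map_neg, hφ]; rw [hφ] at h1; linear_combination h1)
  have he : c 1 = 0 := by simpa using he
  have e := congrArg (ev z) h2
  rw [hc, he] at e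
  funext i
  fin_cases i
  · simpa using e
  · exact he
  · exact hc

theorem isCLBasis_clC (hW : IsOpen W) (hW' : IsConnected W) {g G : ℝ → ℝ}
    (ha : S.IsAffine 1 0 g) (hG : ∀ p ∈ S.J, HasDerivAt G (g p) p)
    (hg : ¬ ((0 : ℝ) ∉ S.J ∧ ∃ K, K ≠ 0 ∧ ∀ p ∈ S.J, g p = K / p ^ 2)) :
    S.IsCLBasis W ![clMass, clC₁ G, clA 1 0 G] := by
  have hφ : S.phi hW 1 0 = Xh := by simp [phi]
  have hm := And.intro (isMult_clMass (S := S) (hW := hW)) (And.intro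
    (isMult_clC₁ (hW := hW) ha hG) (isMult_clA (hW := hW) ha hG))
  refine IsMult.isCLBasis (hW := hW) (R := ![_, _, _]) (X := ![_, _, _])
    (L := ![_, _, _]) (M := ![_, _, _]) (by simpa [Fin.forall_fin_succ] using hm)
    (areIndependentCLs_clC hW hW' ha hG) fun {Φ R' X' L' M'} h => ?_
  obtain ⟨c, d, e, k, -, h2, rfl, rfl⟩ := ha.solve hW' h
  obtain rfl : d = 0 := h2.resolve_right hg
  -- The sign is due to the first multiplier -th of `clC₁`.
  refine ⟨![k, -e, c], ?_, ?_⟩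
  · simp [Fin.sum_univ_succ, Algebra.smul_def, hφ]
    ring
  · simp [Fin.sum_univ_succ, Algebra.smul_def]
    ring

theorem isCLBasis_clD (hW : IsOpen W) (hW' : IsConnected W) {G : ℝ → ℝ}
    (ha : S.IsAffine 1 0 fun p => 1 / p ^ 2) (hG : ∀ p ∈ S.J, HasDerivAt G (1 / p ^ 2) p)
    (h0 : (0 : ℝ) ∉ S.J) :
    S.IsCLBasis W ![clMass, clC₁ G, clA 1 0 G, clB₂ 1 0] := by
  obtain ⟨z⟩ := S.nonempty_domO hW hW'.nonempty
  have hφ : S.phi hW 1 0 = Xh := by simp [phi]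
  have hm := And.intro (isMult_clMass (S := S) (hW := hW)) (And.intro (isMult_clC₁ (hW := hW) ha hG)
    (And.intro (isMult_clA (hW := hW) ha hG) (isMult_clB₂ (hW := hW) ha h0)))
  refine IsMult.isCLBasis (hW := hW) (R := ![_, _, _, _]) (X := ![_, _, _, _])
    (L := ![_, _, _, _]) (M := ![_, _, _, _]) (by simpa [Fin.forall_fin_succ] using hm)
    (IsMult.areIndependentCLs (hW := hW) (R := ![_, _, _, _]) (X := ![_, _, _, _])
      (L := ![_, _, _, _]) (M := ![_, _, _, _]) (by simpa [Fin.forall_fin_succ] using hm)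
      ?_ fun c h1 h2 => ?_)
    fun {Φ R' X' L' M'} h => ?_
  · simpa [Fin.forall_fin_succ] using ⟨IsZeroth.h,
      (IsZeroth.x.mul .h).sub ((IsZeroth.t.mul .h).mul .u), (isZeroth_phi 1 0).mul .u,
      (((IsZeroth.algebraMap 2⁻¹).mul (((isZeroth_phi 1 0).mul (IsZeroth.u.pow 2)).add
        (IsZeroth.h.pow 2)))).sub .t⟩
  · simp [Fin.sum_univ_succ, Algebra.smul_def] at h1 h2
    obtain ⟨hc, hd, he⟩ := affine_mul_phi_eq_zero (hW := hW) hW' ha (c := c 2) (d := c 3)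
      (e := -c 1) (by rw [map_neg, hφ]; rw [hφ] at h1; linear_combination h1)
    have he : c 1 = 0 := by simpa using he
    have e := congrArg (ev z) h2
    rw [hc, hd, he] at e
    funext i
    fin_cases i
    · simpa using e
    · exact he
    · exact hc
    · exact hd
  · obtain ⟨c, d, e, k, -, -, rfl, rfl⟩ := ha.solve hW' h
    refine ⟨![k, -e, c, d], ?_, ?_⟩
    · simp [Fin.sum_univ_succ, Algebra.smul_def, hφ]
      ring
    · simp [Fin.sum_univ_succ, Algebra.smul_def]
      ring

end SWSystem

/-! ### The equivalence group and the table -/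

namespace SWSystem

open DF

variable {S S' : SWSystem} {W : Set (ℝ × ℝ × ℝ)} {hW : IsOpen W}

theorem Equivalent.refl (S : SWSystem) : S.Equivalent S :=
  ⟨⟨1, 0, 1, 0, 0, one_ne_zero, one_ne_zero⟩, by simp, by simp, by simp, by simp⟩

/-- F is (a/c²) times the transformed F at h' = (c/a)²h. Only the slope is rescaled, so vanishing of
β is preserved. -/
theorem Equivalent.isAffine (h : S.Equivalent S') {α β : ℝ} {g : ℝ → ℝ}
    (ha : S'.IsAffine α β g) : ∃ κ ≠ 0, ∃ g', S.IsAffine (α * κ) β g' := by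
  obtain ⟨⟨a, b, c, d, e, ha0, hc0⟩, hI, hJ, hK, hF⟩ := h
  dsimp only at hI hJ hK hF
  have mI : ∀ y ∈ S.I, (c / a) ^ 2 * y ∈ S'.I := fun y hy => hI ▸ mem_image_of_mem _ hy
  have mJ : ∀ p ∈ S.J, p / a ∈ S'.J := fun p hp => hJ ▸ mem_image_of_mem _ hp
  have mK : ∀ q ∈ S.K, c / a ^ 2 * q ∈ S'.K := fun q hq => hK ▸ mem_image_of_mem _ hq
  refine ⟨(c / a) ^ 2, by positivity, fun p => a / c ^ 2 * g (p / a), ⟨fun y hy => ?_, ?_,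
    fun p hp => mul_ne_zero (by positivity) (ha.g_ne _ (mJ p hp)), fun y hy p hp q hq => ?_⟩⟩
  · rw [mul_assoc]
    exact ha.ne _ (mI y hy)
  · exact contDiffOn_const.mul (ha.smooth.comp (by fun_prop) mJ)
  · have h1 := hF y hy p hp q hq
    rw [ha.F_eq _ (mI y hy) _ (mJ p hp) _ (mK q hq)] at h1
    rw [mul_assoc, mul_div_assoc, h1]
    field_simp

theorem FormA.isAffine {c₁ c₂ : ℝ} {g : ℝ → ℝ} (h : S.FormA c₁ c₂ g) : S.IsAffine c₁ c₂ g :=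
  ⟨h.2.1, h.2.2.1, h.2.2.2.1, h.2.2.2.2⟩

theorem isAffine_one_div_sq {α β : ℝ} (h1 : ∀ y ∈ S.I, α * y + β ≠ 0) (h0 : (0 : ℝ) ∉ S.J)
    (h : ∀ y ∈ S.I, ∀ p ∈ S.J, ∀ q ∈ S.K, S.F y p q = 1 / ((α * y + β) * p ^ 2)) :
    S.IsAffine α β fun p => 1 / p ^ 2 := by
  have hp : ∀ p ∈ S.J, p ^ 2 ≠ 0 := fun p hp => pow_ne_zero 2 (ne_of_mem_of_not_mem hp h0)
  exact ⟨h1, contDiffOn_const.div (by fun_prop) hp, fun p hp' => one_div_ne_zero (hp p hp'),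
    fun y hy p hp q hq => by rw [h y hy p hp q hq, div_div, mul_comm]⟩

theorem FormB.isAffine {c₁ c₂ : ℝ} (h : S.FormB c₁ c₂) : S.IsAffine c₁ c₂ fun p => 1 / p ^ 2 :=
  isAffine_one_div_sq h.2.1 h.2.2.1 h.2.2.2

theorem FormC.isAffine {g : ℝ → ℝ} (h : S.FormC g) : S.IsAffine 1 0 g :=
  ⟨fun y hy => by simpa using (S.pos_of_mem y hy).ne', h.1, h.2.1, by simpa using h.2.2⟩

theorem FormD.isAffine (h : S.FormD) : S.IsAffine 1 0 fun p => 1 / p ^ 2 :=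
  isAffine_one_div_sq (fun y hy => by simpa using (S.pos_of_mem y hy).ne') h.1
    (by simpa using h.2)

theorem InTable.exists_isAffine (h : S.InTable) : ∃ α β g, S.IsAffine α β g := by
  obtain ⟨_, _, _, h⟩ | ⟨_, _, h⟩ | ⟨_, h⟩ | h := h
  exacts [⟨_, _, _, h.isAffine⟩, ⟨_, _, _, h.isAffine⟩, ⟨_, _, _, h.isAffine⟩,
    ⟨_, _, _, h.isAffine⟩]

/-- Forms (b) and (d) are instances of (a) and (c), so only whether β vanishes matters. -/
theorem IsAffine.inTable {α β : ℝ} {g : ℝ → ℝ} (h : S.IsAffine α β g) : S.InTable := by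
  by_cases hβ : β = 0
  · subst hβ
    obtain ⟨y, hy⟩ := S.nonempty_I
    have hα : α ≠ 0 := by rintro rfl; simpa using h.ne y hy
    refine .inr (.inr (.inl ⟨fun p => g p / α, h.smooth.div_const α,
      fun p hp => div_ne_zero (h.g_ne p hp) hα, fun y hy p hp q hq => ?_⟩))
    rw [h.F_eq y hy p hp q hq, add_zero, div_div]
  · exact .inl ⟨α, β, g, hβ, h.ne, h.smooth, h.g_ne, h.F_eq⟩

/-- `F` determines the denominator up to a factor. -/
theorem IsAffine.mul_eq_mul {α β α' β' : ℝ} {g g' : ℝ → ℝ} (h : S.IsAffine α β g)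
    (h' : S.IsAffine α' β' g') : α * β' = α' * β := by
  obtain ⟨p, hp⟩ := S.nonempty_J
  obtain ⟨q, hq⟩ := S.nonempty_K
  obtain ⟨y, hy⟩ := S.nonempty_I
  have key : ∀ y ∈ S.I, g p * (α' * y + β') = g' p * (α * y + β) := fun y hy => by
    have e := h.F_eq y hy p hp q hq
    rw [h'.F_eq y hy p hp q hq, div_eq_div_iff (h'.ne y hy) (h.ne y hy)] at e
    exact e.symm
  -- Two distinct heights separate the coefficients of the affine identity `key`.
  obtain ⟨y', hy', hne⟩ : ∃ y' ∈ S.I, y' ≠ y := by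
    obtain ⟨ε, hε, hb⟩ := Metric.isOpen_iff.1 S.isOpen_I y hy
    exact ⟨y + ε / 2, hb (by simp [abs_of_pos hε, hε]), by simpa using hε.ne'⟩
  have h1 : g p * α' = g' p * α := mul_right_cancel₀ (sub_ne_zero.2 hne)
    (by linear_combination key y' hy' - key y hy)
  have h2 : g p * β' = g' p * β := by linear_combination key y hy - y * h1
  refine mul_left_cancel₀ (mul_ne_zero (h.g_ne p hp) (h'.g_ne p hp)) ?_
  linear_combination g' p * α * h2 - g' p * β * h1

/-- The transformation a = c = k fixes h, divides uₓ by k and multiplies F by k, so k/(h uₓ²)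
becomes 1/(h u'²) with u' = uₓ/k. -/
theorem exists_formD {g : ℝ → ℝ} (ha : S.IsAffine 1 0 g) (h0 : (0 : ℝ) ∉ S.J) {k : ℝ} (hk : k ≠ 0)
    (hg : ∀ p ∈ S.J, g p = k / p ^ 2) : ∃ S' : SWSystem, S.Equivalent S' ∧ S'.FormD := by
  have hK : k / k ^ 2 ≠ 0 := by positivity
  let eJ : ℝ ≃ₜ ℝ := Homeomorph.mulRight₀ k⁻¹ (inv_ne_zero hk)
  let eK : ℝ ≃ₜ ℝ := Homeomorph.mulLeft₀ (k / k ^ 2) hK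
  have oc : ∀ (e : ℝ ≃ₜ ℝ) (s : Set ℝ), s.OrdConnected → (e '' s).OrdConnected := fun e s hs =>
    (hs.isPreconnected.image e e.continuous.continuousOn).ordConnected
  have J0 : (0 : ℝ) ∉ eJ '' S.J := by
    rintro ⟨p, hp, h⟩
    have : p * k⁻¹ = 0 := h
    rcases mul_eq_zero.1 this with rfl | h
    · exact h0 hp
    · exact inv_ne_zero hk h
  have hne : ∀ y ∈ S.I, ∀ p ∈ eJ '' S.J, y * p ^ 2 ≠ 0 := fun y hy p hp =>
    mul_ne_zero (S.pos_of_mem y hy).ne' (pow_ne_zero 2 (ne_of_mem_of_not_mem hp J0))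
  let S' : SWSystem :=
    { I := S.I
      J := eJ '' S.J
      K := eK '' S.K
      F := fun y p _ => 1 / (y * p ^ 2)
      isOpen_I := S.isOpen_I
      isOpen_J := eJ.isOpenMap _ S.isOpen_J
      isOpen_K := eK.isOpenMap _ S.isOpen_K
      ordConnected_I := S.ordConnected_I
      ordConnected_J := oc eJ _ S.ordConnected_J
      ordConnected_K := oc eK _ S.ordConnected_K
      nonempty_I := S.nonempty_I
      nonempty_J := S.nonempty_J.image _
      nonempty_K := S.nonempty_K.image _
      pos_of_mem := S.pos_of_mem
      smooth_F := contDiffOn_const.div (by fun_prop) fun w hw => hne _ hw.1 _ hw.2.1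
      F_ne_zero := fun y hy p hp _ _ => one_div_ne_zero (hne y hy p hp) }
  refine ⟨S', ⟨⟨k, 0, k, 0, 0, hk, hk⟩, ?_, rfl, rfl, fun y hy p hp q hq => ?_⟩, J0,
    fun _ _ _ _ _ _ => rfl⟩
  · simp [S', hk]
  · have hp0 : p ≠ 0 := ne_of_mem_of_not_mem hp h0
    have hy0 : y ≠ 0 := (S.pos_of_mem y hy).ne'
    rw [ha.F_eq y hy p hp q hq, hg p hp]
    simp only [S', div_self hk, one_pow, one_mul, add_zero]
    field_simp

/-- No transformation is needed: c₁ and c₂ absorb the constant. -/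
theorem FormA.formB {c₁ c₂ : ℝ} {g : ℝ → ℝ} (h : S.FormA c₁ c₂ g) (h0 : (0 : ℝ) ∉ S.J) {k : ℝ}
    (hk : k ≠ 0) (hg : ∀ p ∈ S.J, g p = k / p ^ 2) : S.FormB (c₁ / k) (c₂ / k) := by
  have e : ∀ y, c₁ / k * y + c₂ / k = (c₁ * y + c₂) / k := fun y => by ring
  refine ⟨div_ne_zero h.1 hk, fun y hy => ?_, h0, fun y hy p hp q hq => ?_⟩
  · rw [e]
    exact div_ne_zero (h.2.1 y hy) hk
  · rw [h.2.2.2.2 y hy p hp q hq, hg p hp, e]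
    have := h.2.1 y hy
    have : p ≠ 0 := ne_of_mem_of_not_mem hp h0
    field_simp

theorem exists_antideriv {g : ℝ → ℝ} (hg : ContinuousOn g S.J) :
    ∃ G : ℝ → ℝ, ∀ p ∈ S.J, HasDerivAt G (g p) p := by
  obtain ⟨p₀, hp₀⟩ := S.nonempty_J
  refine ⟨fun p => ∫ s in p₀..p, g s, fun p hp => ?_⟩
  exact intervalIntegral.integral_hasDerivAt_right
    (hg.mono (S.ordConnected_J.uIcc_subset hp₀ hp)).intervalIntegrable
    (hg.stronglyMeasurableAtFilter S.isOpen_J p hp) (hg.continuousAt (S.isOpen_J.mem_nhds hp))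

/-- `clA` has the nowhere zero first multiplier αh + β, while multiples of mass have first
multiplier zero. Conversely, a law with L ≠ 0 puts the system itself in the table. -/
theorem isCLBasis_clMass_iff (hW : IsOpen W) (hW' : IsConnected W) :
    S.IsCLBasis W ![clMass] ↔ ¬ ∃ S' : SWSystem, S.Equivalent S' ∧ S'.InTable := by
  constructor
  · rintro ⟨-, h⟩ ⟨S', he, hT⟩
    obtain ⟨α, β, g, ha'⟩ := hT.exists_isAffine
    obtain ⟨κ, -, g', ha⟩ := he.isAffine ha'
    obtain ⟨G, hG⟩ := exists_antideriv ha.smooth.continuousOn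
    have hm := isMult_clA (hW := hW) ha hG
    obtain ⟨c, hc⟩ := h _ hm.hasZerothOrderMultipliers
    have hs := IsMult.sum (S := S) (hW := hW) (φ := ![clMass]) (R := ![_]) (X := ![_]) (L := ![_])
      (M := ![_]) (by simpa using isMult_clMass) c
    have h0 := ((hm.sub hs).eq_zero_of_isTrivial (((isZeroth_phi _ β).mul .u).sub
      (.sum _ fun i => by simpa [Fin.fin_one_eq_zero i] using IsZeroth.h.smul (c 0))) hc).1
    obtain ⟨z⟩ := S.nonempty_domO hW hW'.nonempty
    have := congrArg (ev z) h0
    simp [ev_phi] at this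
    exact ha.ne _ z.2.2.1 this
  · intro h
    refine IsMult.isCLBasis (hW := hW) (R := ![_]) (X := ![_]) (L := ![_]) (M := ![_])
      (by simpa using isMult_clMass) (areIndependentCLs_clMass hW hW')
      fun {Φ R' X' L' M'} hm => ?_
    have hL : L' = 0 := by
      by_contra hne
      obtain ⟨α, β, g, ha⟩ := hm.exists_isAffine hW' hne
      exact h ⟨S, .refl S, ha.inTable⟩
    obtain ⟨k, hk⟩ := eq_const_of_left_eq_zero hW' hm hL
    exact ⟨![k], by simp [hL], by simp [hk, Algebra.smul_def]⟩

/-! ### The listed pairs as instances of three families -/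

theorem clB₁_eq (c₁ c₂ : ℝ) : clB₁ c₁ c₂ = clA c₁ c₂ fun p => -(1 / p) :=
  Prod.ext rfl (by funext z; simp only [clB₁, clA]; ring)

theorem clC₂_eq (G : ℝ → ℝ) : clC₂ G = clA 1 0 G :=
  Prod.ext (by funext z; simp [clC₂, clA]) (by funext z; simp [clC₂, clA])

theorem clD₁_eq : clD₁ = clC₁ fun p => -(1 / p) :=
  Prod.ext rfl (by funext z; simp only [clD₁, clC₁]; ring)

theorem clD₂_eq : clD₂ = clA 1 0 fun p => -(1 / p) :=
  Prod.ext (by funext z; simp [clD₂, clA]) (by funext z; simp [clD₂, clA])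

theorem clD₃_eq : clD₃ = clB₂ 1 0 :=
  Prod.ext (by funext z; simp [clD₃, clB₂]) (by funext z; simp [clD₃, clB₂])

end SWSystem

end

/-! ### The classification theorem -/

theorem mainTheorem1 :
    -- at most four linearly independent conservation laws
    (∀ (S : SWSystem) (W : Set (ℝ × ℝ × ℝ)), IsOpen W → IsConnected W →
      ∀ (n : ℕ) (φ : Fin n → FluxPair), S.AreIndependentCLs W φ → n ≤ 4) ∧
    -- for every `F`: mass is conserved, and it is the only conservation law exactly when the
    -- system is equivalent to none of the four special forms
    (∀ (S : SWSystem) (W : Set (ℝ × ℝ × ℝ)), IsOpen W → IsConnected W →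
      S.AreIndependentCLs W ![clMass] ∧
      (S.IsCLBasis W ![clMass] ↔ ¬ ∃ S' : SWSystem, S.Equivalent S' ∧ S'.InTable)) ∧
    -- `F = g(uₓ) / (c₁ h + c₂)`
    (∀ (S : SWSystem) (W : Set (ℝ × ℝ × ℝ)), IsOpen W → IsConnected W →
      ∀ (c₁ c₂ : ℝ) (g G : ℝ → ℝ), S.FormA c₁ c₂ g → (∀ p ∈ S.J, HasDerivAt G (g p) p) →
        S.AreIndependentCLs W ![clMass, clA c₁ c₂ G] ∧
        ((¬ ∃ (S' : SWSystem) (b₁ b₂ : ℝ), S.Equivalent S' ∧ S'.FormB b₁ b₂) →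
          S.IsCLBasis W ![clMass, clA c₁ c₂ G])) ∧
    -- `F = 1 / ((c₁ h + c₂) uₓ²)`
    (∀ (S : SWSystem) (W : Set (ℝ × ℝ × ℝ)), IsOpen W → IsConnected W →
      ∀ c₁ c₂ : ℝ, S.FormB c₁ c₂ →
        S.IsCLBasis W ![clMass, clB₁ c₁ c₂, clB₂ c₁ c₂]) ∧
    -- `F = g(uₓ) / h`
    (∀ (S : SWSystem) (W : Set (ℝ × ℝ × ℝ)), IsOpen W → IsConnected W →
      ∀ g G : ℝ → ℝ, S.FormC g → (∀ p ∈ S.J, HasDerivAt G (g p) p) →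
        S.AreIndependentCLs W ![clMass, clC₁ G, clC₂ G] ∧
        ((¬ ∃ S' : SWSystem, S.Equivalent S' ∧ S'.FormD) →
          S.IsCLBasis W ![clMass, clC₁ G, clC₂ G])) ∧
    -- `F = 1 / (h uₓ²)`
    (∀ (S : SWSystem) (W : Set (ℝ × ℝ × ℝ)), IsOpen W → IsConnected W →
      S.FormD → S.IsCLBasis W ![clMass, clD₁, clD₂, clD₃]) ∧
    -- the forms with denominator `c₁ h + c₂`, `c₂ ≠ 0`, are inequivalent to those with
    -- denominator `h`
    (∀ S S' : SWSystem, S.Equivalent S' →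
      ((∃ c₁ c₂ g, S.FormA c₁ c₂ g) ∨ ∃ c₁ c₂, S.FormB c₁ c₂) →
      ¬ ((∃ g, S'.FormC g) ∨ S'.FormD)) := by
  refine ⟨fun S W hW hW' n φ h => h.le_four hW hW',
    fun S W hW hW' => ⟨SWSystem.areIndependentCLs_clMass hW hW', SWSystem.isCLBasis_clMass_iff hW hW'⟩,
    fun S W hW hW' c₁ c₂ g G h hG => ⟨SWSystem.areIndependentCLs_clA hW hW' h.isAffine hG, fun hB =>
      SWSystem.isCLBasis_clA hW hW' h.isAffine hG h.1 ?_⟩,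
    fun S W hW hW' c₁ c₂ h => ?_,
    fun S W hW hW' g G h hG => ?_,
    fun S W hW hW' h => ?_,
    fun S S' he h h' => ?_⟩
  · rintro ⟨h0, k, hk, hg⟩
    exact hB ⟨S, _, _, .refl S, h.formB h0 hk hg⟩
  · rw [SWSystem.clB₁_eq]
    exact SWSystem.isCLBasis_clB hW hW' h.isAffine
      (fun p hp => SWSystem.hasDerivAt_neg_one_div (ne_of_mem_of_not_mem hp h.2.2.1)) h.1 h.2.2.1
  · rw [SWSystem.clC₂_eq]
    refine ⟨SWSystem.areIndependentCLs_clC hW hW' h.isAffine hG, fun hD =>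
      SWSystem.isCLBasis_clC hW hW' h.isAffine hG ?_⟩
    rintro ⟨h0, k, hk, hg⟩
    exact hD (SWSystem.exists_formD h.isAffine h0 hk hg)
  · rw [SWSystem.clD₁_eq, SWSystem.clD₂_eq, SWSystem.clD₃_eq]
    exact SWSystem.isCLBasis_clD hW hW' h.isAffine
      (fun p hp => SWSystem.hasDerivAt_neg_one_div (ne_of_mem_of_not_mem hp h.1)) h.1
  · obtain ⟨α, β, g, hβ, ha⟩ : ∃ α β g, β ≠ 0 ∧ S.IsAffine α β g := by
      obtain ⟨_, _, _, h⟩ | ⟨_, _, h⟩ := h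
      exacts [⟨_, _, _, h.1, h.isAffine⟩, ⟨_, _, _, h.1, h.isAffine⟩]
    obtain ⟨g', ha'⟩ : ∃ g', S'.IsAffine 1 0 g' := by
      obtain ⟨_, h⟩ | h := h'
      exacts [⟨_, h.isAffine⟩, ⟨_, h.isAffine⟩]
    obtain ⟨κ, hκ, g'', ha''⟩ := he.isAffine ha'
    -- Pulling the denominator h back to `S` gives κh beside αh + β for the same F; proportionality
    -- then forces κβ = 0.
    have := ha.mul_eq_mul ha''
    rw [mul_zero, one_mul] at this
    exact mul_ne_zero hκ hβ this.symm
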